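/- All graphs are simple, undirected, connected (and non-empty), not necessarily finite or locally finite. Let $d$ be the graph distance, $I(u,v)=\{x : d(u,x)+d(x,v)=d(u,v)\}$, and call a vertex set $A$ \emph{gated} if for every vertex $x\notin A$ there is $x'\in A$ with $x'\in I(x,y)$ for all $y\in A$; the \emph{gated hull} of a non-empty set is the smallest gated set containing it. A graph $G$ is a \emph{dual polar graph} if it satisfies Cameron's axioms without the finite-diameter axiom: \begin{itemize} \item[(A1)] for every vertex $p$ and every maximal clique $\ell$ there is a unique vertex of $\ell$ nearest to $p$; \item[(A3\&4)] the gated hull of any two vertices at distance $2$ has diameter $2$; \item[(A5)] for every pair of nonadjacent vertices $u,v$ and every neighbor $x$ of $u$ in $I(u,v)$ there is a neighbor $y$ of $v$ in $I(u,v)$ with $d(u,v)=d(x,y)=d(u,y)+1=d(x,v)+1$. \end{itemize} $G$ is \emph{thick} if for all $u,v$ with $d(u,v)=2$ the set $I(u,v)$ contains an induced $4$-cycle. $G$ is \emph{weakly modular} if for every vertex $u$: (TC) for all $v,w$ with $1=d(v,w)<d(u,v)=d(u,w)$ there is a common neighbor $x$ of $v,w$ with $d(u,x)=d(u,v)-1$;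 and (QC) for all $v,w,z$ with $d(v,z)=d(w,z)=1$ and $2=d(v,w)\le d(u,v)=d(u,w)=d(u,z)-1$ there is a common neighbor $x$ of $v,w$ with $d(u,x)=d(u,v)-1$. $G$ is \emph{locally weakly modular} if for every vertex $u$: (LTC) for all adjacent $v,w$ with $d(u,v)=d(u,w)=2$ there is a common neighbor of $u,v,w$; and (LQC) for all $v,w,z$ with $z$ adjacent to $v,w$ and $d(v,w)=d(u,v)=d(u,w)=d(u,z)-1=2$ there is a common neighbor of $u,v,w$. $K_4^-$ and $K_{3,3}^-$ are $K_4$ and $K_{3,3}$ minus one edge; an isometric $K_{3,3}^-$ in $G$ is a copy of $K_{3,3}^-$ whose distances are those of $G$. The \emph{triangle-square complex} of $G$ is the two-dimensional cell complex with $1$-skeleton $G$ whose $2$-cells are solid triangles and squares attached along all triangles and all induced $4$-cycles of $G$, one for each. \textbf{Theorem.} For a graph $G$ the following conditions are equivalent: \begin{itemize} \item[(i)] $G$ is a dual polar graph; \item[(ii)] $G$ is a thick weakly modular graph containing no induced $K_4^-$ and no isometric $K_{3,3}^-$; \item[(iii)] $G$ is a thick locally weakly modular graph containing no induced $K_4^-$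 and no isometric $K_{3,3}^-$, and the triangle-square complex of $G$ is simply connected. \end{itemize} -/

import Mathlib

namespace DualPolar

section Metric

variable {V : Type*} (G : SimpleGraph V)

/-- The interval `I(u,v)`: all vertices lying on shortest `(u,v)`-paths. -/
def interval (u v : V) : Set V :=
  {x | G.dist u x + G.dist x v = G.dist u v}

/-- A set `A` of vertices is gated if every vertex `x` outside `A` has a gate in `A`: a vertex
`g ∈ A` that lies in `I(x,y)` for all `y ∈ A`. -/
def IsGated (A : Set V) : Prop :=
  ∀ x ∉ A, ∃ g ∈ A, ∀ y ∈ A, g ∈ interval G x y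

/-- The gated hull: the smallest gated set containing `S`. -/
def gatedHull (S : Set V) : Set V :=
  ⋂₀ {A | IsGated G A ∧ S ⊆ A}

/-- The gated hull of a nonempty set is itself gated, so it is the smallest gated set
containing it. -/
theorem isGated_gatedHull (hG : G.Connected) {S : Set V} (hS : S.Nonempty) :
    IsGated G (gatedHull G S) := by
  obtain ⟨y₀, hy₀⟩ := hS
  have hS₀ : y₀ ∈ gatedHull G S := fun A hA => hA.2 hy₀
  suffices h : ∀ n x, G.dist x y₀ = n →
      ∃ g ∈ gatedHull G S, ∀ y ∈ gatedHull G S, g ∈ interval G x y from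
    fun x _ => h _ x rfl
  intro n
  induction n using Nat.strong_induction_on with
  | _ n ih =>
    intro x hx
    by_cases hxA : x ∈ gatedHull G S
    · exact ⟨x, hxA, fun y _ => by simp [interval]⟩
    · have hex : ∃ B, (IsGated G B ∧ S ⊆ B) ∧ x ∉ B := by
        by_contra hcon
        exact hxA fun B hB => by_contra fun hxB => hcon ⟨B, hB, hxB⟩
      obtain ⟨B, hB, hxB⟩ := hex
      obtain ⟨b, hbB, hb⟩ := hB.1 x hxB
      have hsub : gatedHull G S ⊆ B := fun z hz => hz B hB
      have hpos : 0 < G.dist x b :=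
        hG.pos_dist_of_ne fun h => hxB (h ▸ hbB)
      have hb₀ := hb y₀ (hsub hS₀)
      simp only [interval, Set.mem_ofPred_eq] at hb hb₀
      obtain ⟨g, hgA, hg⟩ := ih (G.dist b y₀) (by omega) b rfl
      refine ⟨g, hgA, fun y hy => ?_⟩
      have h₁ := hb y (hsub hy)
      have h₂ := hb g (hsub hgA)
      have h₃ := hg y hy
      simp only [interval, Set.mem_ofPred_eq] at h₃ ⊢
      omega

/-- The set `A` has diameter `n`: `n` is the largest distance in `G` between two vertices
of `A`. -/
def HasDiameter (A : Set V) (n : ℕ) : Prop :=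
  IsGreatest {d | ∃ a ∈ A, ∃ b ∈ A, G.dist a b = d} n

/-- Axiom (A1): for every vertex `p` and every line (maximal clique) `ℓ` there is a unique
vertex of `ℓ` nearest to `p`. -/
def AxiomA1 : Prop :=
  ∀ (p : V) (l : Set V), Maximal G.IsClique l →
    ∃! x, x ∈ l ∧ ∀ y ∈ l, G.dist p x ≤ G.dist p y

/-- Axiom (A3&4): the gated hull of two vertices at distance 2 has diameter 2. -/
def AxiomA34 : Prop :=
  ∀ u v : V, G.dist u v = 2 → HasDiameter G (gatedHull G {u, v}) 2

/-- Axiom (A5): for all nonadjacent `u`, `v` and every neighbor `x` of `u` in `I(u,v)` there is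
a neighbor `y` of `v` in `I(u,v)` with `d(u,v) = d(x,y) = d(u,y) + 1 = d(x,v) + 1`. -/
def AxiomA5 : Prop :=
  ∀ u v : V, ¬ G.Adj u v → ∀ x ∈ interval G u v, G.Adj u x →
    ∃ y ∈ interval G u v, G.Adj v y ∧ G.dist u v = G.dist x y ∧
      G.dist x y = G.dist u y + 1 ∧ G.dist u y + 1 = G.dist x v + 1

/-- Dual polar graphs, of possibly infinite diameter. -/
structure IsDualPolar : Prop where
  a1 : AxiomA1 G
  a34 : AxiomA34 G
  a5 : AxiomA5 G

/-- The triangle condition TC(u). -/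
def TriangleCondition (u : V) : Prop :=
  ∀ v w : V, G.dist v w = 1 → 1 < G.dist u v → G.dist u v = G.dist u w →
    ∃ x, G.Adj x v ∧ G.Adj x w ∧ G.dist u x + 1 = G.dist u v

/-- The quadrangle condition QC(u). -/
def QuadrangleCondition (u : V) : Prop :=
  ∀ v w z : V, G.dist v z = 1 → G.dist w z = 1 → G.dist v w = 2 → 2 ≤ G.dist u v →
    G.dist u v = G.dist u w → G.dist u z = G.dist u v + 1 →
    ∃ x, G.Adj x v ∧ G.Adj x w ∧ G.dist u x + 1 = G.dist u v

/-- Weakly modular graphs. -/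
def IsWeaklyModular : Prop :=
  ∀ u : V, TriangleCondition G u ∧ QuadrangleCondition G u

/-- The local triangle condition LTC(u). -/
def LocalTriangleCondition (u : V) : Prop :=
  ∀ v w : V, G.Adj v w → G.dist u v = 2 → G.dist u w = 2 →
    ∃ x, G.Adj x u ∧ G.Adj x v ∧ G.Adj x w

/-- The local quadrangle condition LQC(u). -/
def LocalQuadrangleCondition (u : V) : Prop :=
  ∀ v w z : V, G.Adj z v → G.Adj z w → G.dist v w = 2 → G.dist u v = 2 → G.dist u w = 2 →
    G.dist u z = 3 → ∃ x, G.Adj x u ∧ G.Adj x v ∧ G.Adj x w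

/-- Locally weakly modular graphs. -/
def IsLocallyWeaklyModular : Prop :=
  ∀ u : V, LocalTriangleCondition G u ∧ LocalQuadrangleCondition G u

/-- `G` is thick if every 2-interval `I(u,v)` contains an induced 4-cycle. -/
def IsThick : Prop :=
  ∀ u v : V, G.dist u v = 2 →
    ∃ f : SimpleGraph.cycleGraph 4 ↪g G, Set.range f ⊆ interval G u v

/-- `H` occurs as an isometric subgraph of `G`. -/
def ContainsIsometric {W : Type*} (H : SimpleGraph W) : Prop :=
  ∃ f : W → V, ∀ a b : W, G.dist (f a) (f b) = H.dist a b

end Metric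

/-- The graph `K₄⁻`: the complete graph on four vertices minus one edge. -/
def K4minus : SimpleGraph (Fin 4) :=
  (⊤ : SimpleGraph (Fin 4)).deleteEdges {s(0, 1)}

/-- The graph `K₃,₃⁻`: the complete bipartite graph `K₃,₃` minus one edge. -/
def K33minus : SimpleGraph (Fin 3 ⊕ Fin 3) :=
  (completeBipartiteGraph (Fin 3) (Fin 3)).deleteEdges {s(Sum.inl 0, Sum.inr 0)}

noncomputable section Complex

variable {V : Type*} (G : SimpleGraph V)

/-- The simplices of dimension at most 2: vertices, edges and triangles of `G`. -/
def Simplex : Type _ :=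
  {s : Finset V // s.Nonempty ∧ s.card ≤ 3 ∧ G.IsClique (s : Set V)}

/-- The disjoint union of the cells of the triangle-square complex: a standard simplex for each
vertex, edge and triangle of `G`, and a unit square for each parametrized induced 4-cycle of `G`
(the parametrizations of one 4-cycle are identified with each other below). It carries the
disjoint union topology. -/
abbrev Cells : Type _ :=
  (Σ s : Simplex G, stdSimplex ℝ {v : V // v ∈ s.1}) ⊕
    (Σ _ : SimpleGraph.cycleGraph 4 ↪g G, unitInterval × unitInterval)

/-- The weights of the corners `0, 1, 2, 3` (in cyclic order) of the unit square at the point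
`(s,t)`; the corners are `(0,0)`, `(1,0)`, `(1,1)`, `(0,1)`. -/
def cornerWeights (q : unitInterval × unitInterval) : Fin 4 → ℝ :=
  ![(1 - (q.1 : ℝ)) * (1 - (q.2 : ℝ)), (q.1 : ℝ) * (1 - (q.2 : ℝ)),
    (q.1 : ℝ) * (q.2 : ℝ), (1 - (q.1 : ℝ)) * (q.2 : ℝ)]

/-- The point `∑ i, w i • φ i` of the real vector space of functions `V → ℝ`, each vertex being
viewed as a basis vector. -/
def combination {ι : Type*} [Fintype ι] (φ : ι → V) (w : ι → ℝ) : V → ℝ :=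
  open Classical in fun v => ∑ i, if φ i = v then w i else 0

/-- The weights that a point of a cell gives to the vertices: barycentric coordinates in a
simplex, bilinear coordinates in a square. Both are injective on each cell, and on the boundary
edges of a square the bilinear coordinates are the barycentric coordinates of the edge. The
coordinates with full support on a simplex or square determine that simplex or square. -/
def coordinates : Cells G → V → ℝ
  | Sum.inl ⟨_, w⟩ => combination Subtype.val w.1
  | Sum.inr ⟨f, q⟩ => combination f (cornerWeights q)

/-- The triangle-square complex of `G`: the two-dimensional cell complex with 1-skeleton `G` in
which exactly the triangles and the squares (induced 4-cycles) are filled by a 2-cell. It is the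
disjoint union of the cells with points of equal coordinates identified, that is, the cells are
glued along common vertices and edges; the topology is the quotient topology. -/
def TriangleSquareComplex : Type _ :=
  Quotient (Setoid.ker (coordinates G))

instance : TopologicalSpace (TriangleSquareComplex G) :=
  inferInstanceAs (TopologicalSpace (Quotient (Setoid.ker (coordinates G))))

end Complex

end DualPolar

namespace DualPolar

/-! ### Distances, lines and the two forbidden subgraphs -/

section Basic

variable {V : Type*} {G : SimpleGraph V}

/-! Call maximal cliques lines. Without an induced `K4minus`, equality-or-adjacency is transitive
among the neighbors of a vertex, so an edge lies on exactly one line.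

(i) ⇒ (ii): uniqueness of nearest points on lines excludes `K4minus` and gives the triangle
condition (TC). Gates in a gated set of diameter 2 give the quadrangle condition (QC) and exclude an
isometric `K33minus`. Axiom (A5) at distance 2 yields thickness.

(ii) ⇒ (i): the substance is (A3&4). For `u`, `v` at distance 2 the hull is compared with a `quad`
seen from `u`: the vertex `u`, the lines through `u` that carry a neighbor of `v` (the `cone`), and
the vertices at distance 2 with the same cone. Two lines of a cone determine it
(`cone_eq_of_two_lines`), which is where `K33minus` is excluded. Hence the quad is closed under
common neighbors of two of its vertices (`quad_closed`) and has diameter 2 (`quad_diam`); under TC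
and QC such a set is gated (`isGated_of_closed`). Then (A1) follows from TC, and (A5) by induction
using gates in quads.

(ii) ⇒ (iii): open stars in the complex contract to their centers, and each edge has a path class
compatible with triangles and squares. TC and QC at `b` make transport along geodesics from `b`
independent of the geodesic (`IsFlatSystem.exists_section`). So every vertex receives a class of
paths to `b`, consistently along edges, and this trivializes all loops.

(iii) ⇒ (ii): around any base vertex the local conditions build, ball by ball, a cover of `G` that
satisfies TC and QC with respect to the base point (`IsNewLayer.isPartialCover_extend`). Its edge
lifts form a flat system, that is, a covering space of the complex. Simple connectedness gives a
section through the base point; levels along it are distances in `G`, so TC and QC descend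
(`IsLayeredCover.conditions`). -/

theorem dist_le_succ_of_adj (hG : G.Connected) {v w : V} (h : G.Adj v w) (u : V) :
    G.dist u v ≤ G.dist u w + 1 := by
  have h₁ := hG.dist_triangle (u := u) (v := w) (w := v)
  have h₂ := SimpleGraph.dist_eq_one_iff_adj.2 h.symm
  omega

theorem dist_le_two (hG : G.Connected) {u v w : V} (h₁ : G.Adj u v) (h₂ : G.Adj v w) :
    G.dist u w ≤ 2 := by
  have h₃ := dist_le_succ_of_adj hG h₂.symm u
  have h₄ := SimpleGraph.dist_eq_one_iff_adj.2 h₁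
  omega

theorem dist_eq_two (hG : G.Connected) {u v w : V} (h₁ : G.Adj u v) (h₂ : G.Adj v w)
    (hne : u ≠ w) (hna : ¬ G.Adj u w) : G.dist u w = 2 := by
  have h₃ := dist_le_two hG h₁ h₂
  have h₄ := hG.pos_dist_of_ne hne
  have h₅ : G.dist u w ≠ 1 := fun h => hna (SimpleGraph.dist_eq_one_iff_adj.1 h)
  omega

theorem exists_adj_dist_eq (hG : G.Connected) {u v : V} {n : ℕ} (h : G.dist u v = n + 1) :
    ∃ w, G.Adj w v ∧ G.dist u w = n := by
  obtain ⟨p, hp⟩ := hG.exists_walk_length_eq_dist v u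
  rw [SimpleGraph.dist_comm] at h
  cases p with
  | nil => simp at h
  | @cons _ w _ ha q =>
    refine ⟨w, ha.symm, ?_⟩
    have h₁ := SimpleGraph.dist_le q
    have h₂ := dist_le_succ_of_adj hG ha u
    simp only [SimpleGraph.Walk.length_cons] at hp
    rw [SimpleGraph.dist_comm] at h₁
    rw [SimpleGraph.dist_comm] at h
    rw [SimpleGraph.dist_comm (u := v)] at hp
    omega

theorem exists_common_adj (hG : G.Connected) {u v : V} (h : G.dist u v = 2) :
    ∃ w, G.Adj u w ∧ G.Adj w v := by
  obtain ⟨w, hw, h₁⟩ := exists_adj_dist_eq hG h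
  exact ⟨w, SimpleGraph.dist_eq_one_iff_adj.1 h₁, hw⟩

theorem ne_of_dist_two {u v : V} (h : G.dist u v = 2) : u ≠ v := by
  rintro rfl; simp at h

theorem not_adj_of_dist_two {u v : V} (h : G.dist u v = 2) : ¬ G.Adj u v := by
  intro h'; rw [SimpleGraph.dist_eq_one_iff_adj.2 h'] at h; omega

/-- Any two distinct common neighbors of the ends of an edge are adjacent. -/
def DiamondFree (G : SimpleGraph V) : Prop :=
  ∀ ⦃a b c d : V⦄, G.Adj c d → G.Adj a c → G.Adj a d → G.Adj b c → G.Adj b d → a ≠ b → G.Adj a b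

theorem K4minus_adj (i j : Fin 4) :
    K4minus.Adj i j ↔ i ≠ j ∧ ¬ (i = 0 ∧ j = 1) ∧ ¬ (i = 1 ∧ j = 0) := by
  simp [K4minus, SimpleGraph.deleteEdges_adj]

theorem diamondFree_iff : DiamondFree G ↔ ¬ K4minus.IsIndContained G := by
  constructor
  · rintro h ⟨f⟩
    have key : ∀ i j, K4minus.Adj i j → G.Adj (f i) (f j) := fun i j => f.map_adj_iff.2
    have h01 : ¬ G.Adj (f 0) (f 1) := by
      rw [f.map_adj_iff, K4minus_adj]; decide
    refine h01 (h (c := f 2) (d := f 3) ?_ ?_ ?_ ?_ ?_ fun h => absurd (f.injective h) (by decide))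
    all_goals exact key _ _ ((K4minus_adj _ _).2 (by decide))
  · intro h a b c d hcd hac had hbc hbd hne
    by_contra hab
    refine h ⟨⟨⟨![a, b, c, d], ?_⟩, ?_⟩⟩
    · intro i j hij
      fin_cases i <;> fin_cases j <;>
        simp_all [hac.ne, had.ne, hbc.ne, hbd.ne, hcd.ne, hac.ne', had.ne', hbc.ne', hbd.ne',
          hcd.ne', hne.symm]
    · intro i j
      change G.Adj (![a, b, c, d] i) (![a, b, c, d] j) ↔ _
      have hba : ¬ G.Adj b a := fun h => hab h.symm
      have := hcd.symm; have := hac.symm; have := had.symm; have := hbc.symm; have := hbd.symm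
      rw [K4minus_adj]
      fin_cases i <;> fin_cases j <;> simp [*]

theorem K33minus_adj_inl_inr (i j : Fin 3) :
    K33minus.Adj (Sum.inl i) (Sum.inr j) ↔ ¬ (i = 0 ∧ j = 0) := by
  simp [K33minus, SimpleGraph.deleteEdges_adj]

theorem K33minus_not_adj_inl_inl (i j : Fin 3) : ¬ K33minus.Adj (Sum.inl i) (Sum.inl j) := by
  simp [K33minus, SimpleGraph.deleteEdges_adj]

theorem K33minus_not_adj_inr_inr (i j : Fin 3) : ¬ K33minus.Adj (Sum.inr i) (Sum.inr j) := by
  simp [K33minus, SimpleGraph.deleteEdges_adj]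

theorem K33minus_adj_one (i : Fin 3) : K33minus.Adj (Sum.inl i) (Sum.inr 1) :=
  (K33minus_adj_inl_inr _ _).2 (by simp)

theorem K33minus_adj_one' (i : Fin 3) : K33minus.Adj (Sum.inl 1) (Sum.inr i) :=
  (K33minus_adj_inl_inr _ _).2 (by simp)

theorem K33minus_connected : K33minus.Connected := by
  have h : ∀ x, K33minus.Reachable (Sum.inl 1) x := by
    rintro (i | i)
    · exact (K33minus_adj_one 1).reachable.trans (K33minus_adj_one i).reachable.symm
    · exact (K33minus_adj_one' i).reachable
  exact ⟨fun x y => (h x).symm.trans (h y)⟩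

theorem K33minus_dist_inl_inl {i j : Fin 3} (h : i ≠ j) :
    K33minus.dist (Sum.inl i) (Sum.inl j) = 2 :=
  dist_eq_two K33minus_connected (K33minus_adj_one i) (K33minus_adj_one j).symm (by simpa using h)
    (K33minus_not_adj_inl_inl _ _)

theorem K33minus_dist_inr_inr {i j : Fin 3} (h : i ≠ j) :
    K33minus.dist (Sum.inr i) (Sum.inr j) = 2 :=
  dist_eq_two K33minus_connected (K33minus_adj_one' i).symm (K33minus_adj_one' j)
    (by simpa using h) (K33minus_not_adj_inr_inr _ _)

theorem K33minus_dist_zero : K33minus.dist (Sum.inl 0) (Sum.inr 0) = 3 := by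
  have h₁ := dist_le_succ_of_adj K33minus_connected (K33minus_adj_one' 0).symm (Sum.inl 0)
  have h₂ := K33minus_dist_inl_inl (i := 0) (j := 1) (by decide)
  have h₃ : K33minus.dist (Sum.inl 0) (Sum.inr 0) ≠ 1 := fun h => by
    simpa using (K33minus_adj_inl_inr 0 0).1 (SimpleGraph.dist_eq_one_iff_adj.1 h)
  have h₄ : K33minus.dist (Sum.inl 0) (Sum.inr 0) ≠ 0 := by
    rw [Ne, K33minus_connected.dist_eq_zero_iff]; simp
  have h₅ : K33minus.dist (Sum.inl 0) (Sum.inr 0) ≠ 2 := fun h => by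
    obtain ⟨w | w, h₁, h₂⟩ := exists_common_adj K33minus_connected h
    · exact K33minus_not_adj_inl_inl _ _ h₁
    · exact K33minus_not_adj_inr_inr _ _ h₂
  omega

/-- There is no isometric copy of `K₃,₃⁻`. -/
def CubeCornerFree (G : SimpleGraph V) : Prop :=
  ∀ ⦃a₀ a₁ a₂ b₀ b₁ b₂ : V⦄, G.Adj a₀ b₁ → G.Adj a₀ b₂ → G.Adj a₁ b₀ → G.Adj a₁ b₁ → G.Adj a₁ b₂ →
    G.Adj a₂ b₀ → G.Adj a₂ b₁ → G.Adj a₂ b₂ → G.dist a₁ a₂ = 2 → G.dist b₁ b₂ = 2 →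
    G.dist a₀ b₀ ≤ 2

/-- Only two of the distances 2 have to be assumed: once `a₀` and `b₀` are at distance 3, the
remaining pairs on each side are at distance 2 by the triangle inequality. -/
theorem cubeCornerFree_iff (hG : G.Connected) :
    CubeCornerFree G ↔ ¬ ContainsIsometric G K33minus := by
  constructor
  · rintro h ⟨f, hf⟩
    have key : ∀ i j : Fin 3, ¬ (i = 0 ∧ j = 0) → G.Adj (f (Sum.inl i)) (f (Sum.inr j)) :=
      fun i j hij => SimpleGraph.dist_eq_one_iff_adj.1
        ((hf _ _).trans (SimpleGraph.dist_eq_one_iff_adj.2 ((K33minus_adj_inl_inr i j).2 hij)))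
    have := h (key 0 1 (by decide)) (key 0 2 (by decide)) (key 1 0 (by decide))
      (key 1 1 (by decide)) (key 1 2 (by decide)) (key 2 0 (by decide)) (key 2 1 (by decide))
      (key 2 2 (by decide)) ((hf _ _).trans (K33minus_dist_inl_inl (by decide)))
      ((hf _ _).trans (K33minus_dist_inr_inr (by decide)))
    rw [hf, K33minus_dist_zero] at this
    omega
  · intro h a₀ a₁ a₂ b₀ b₁ b₂ h01 h02 h10 h11 h12 h20 h21 h22 ha hb
    by_contra hd
    have h3 : G.dist a₀ b₀ = 3 := by
      have := dist_le_succ_of_adj hG h10.symm a₀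
      have := dist_le_two hG h01 h11.symm
      omega
    have e : ∀ {x y}, G.Adj x y → G.dist x y = 1 := SimpleGraph.dist_eq_one_iff_adj.2
    have ha' : ∀ {x}, G.Adj x b₀ → G.Adj x b₁ → G.dist a₀ x = 2 := fun {x} h₁ h₂ => by
      have := dist_le_succ_of_adj hG h₁.symm a₀
      have := dist_le_two hG h01 h₂.symm
      omega
    have hb' : ∀ {x}, G.Adj a₀ x → G.Adj a₁ x → G.dist b₀ x = 2 := fun {x} h₁ h₂ => by
      have := dist_le_succ_of_adj hG h₁ b₀
      have := dist_le_two hG h10.symm h₂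
      have := G.dist_comm (u := a₀) (v := b₀)
      omega
    have hA : ∀ i j, i ≠ j → G.dist (![a₀, a₁, a₂] i) (![a₀, a₁, a₂] j) = 2 := by
      have h₁ := ha' h10 h11
      have h₂ := ha' h20 h21
      intro i j hij
      fin_cases i <;> fin_cases j <;> first | exact absurd rfl hij | skip
      · exact h₁
      · exact h₂
      · exact G.dist_comm.trans h₁
      · exact ha
      · exact G.dist_comm.trans h₂
      · exact G.dist_comm.trans ha
    have hB : ∀ i j, i ≠ j → G.dist (![b₀, b₁, b₂] i) (![b₀, b₁, b₂] j) = 2 := by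
      have h₁ := hb' h01 h11
      have h₂ := hb' h02 h12
      intro i j hij
      fin_cases i <;> fin_cases j <;> first | exact absurd rfl hij | skip
      · exact h₁
      · exact h₂
      · exact G.dist_comm.trans h₁
      · exact hb
      · exact G.dist_comm.trans h₂
      · exact G.dist_comm.trans hb
    have hAB : ∀ i j, G.dist (![a₀, a₁, a₂] i) (![b₀, b₁, b₂] j) =
        K33minus.dist (Sum.inl i) (Sum.inr j) := by
      intro i j
      by_cases hij : i = 0 ∧ j = 0
      · obtain ⟨rfl, rfl⟩ := hij
        exact h3.trans K33minus_dist_zero.symm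
      · rw [SimpleGraph.dist_eq_one_iff_adj.2 ((K33minus_adj_inl_inr i j).2 hij)]
        apply e
        fin_cases i <;> fin_cases j <;> first | exact absurd ⟨rfl, rfl⟩ hij | assumption
    refine h ⟨Sum.elim ![a₀, a₁, a₂] ![b₀, b₁, b₂], ?_⟩
    rintro (i | i) (j | j)
    · by_cases hij : i = j
      · simp [hij]
      · exact (hA i j hij).trans (K33minus_dist_inl_inl hij).symm
    · exact hAB i j
    · exact G.dist_comm.trans ((hAB j i).trans SimpleGraph.dist_comm)
    · by_cases hij : i = j
      · simp [hij]
      · exact (hB i j hij).trans (K33minus_dist_inr_inr hij).symm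

theorem mem_interval {u v x : V} :
    x ∈ interval G u v ↔ G.dist u x + G.dist x v = G.dist u v := Iff.rfl

theorem mem_interval_of_adj {u v x : V} (h : G.dist u v = 2) (h₁ : G.Adj u x) (h₂ : G.Adj x v) :
    x ∈ interval G u v := by
  rw [mem_interval, h, SimpleGraph.dist_eq_one_iff_adj.2 h₁, SimpleGraph.dist_eq_one_iff_adj.2 h₂]

/-- The embedding of the 4-cycle determined by two pairs of opposite vertices. -/
def squareEmbedding {a b c d : V} (hab : G.Adj a b) (hbc : G.Adj b c) (hcd : G.Adj c d)
    (hda : G.Adj d a) (hac : a ≠ c) (hbd : b ≠ d) (hac' : ¬ G.Adj a c) (hbd' : ¬ G.Adj b d) :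
    SimpleGraph.cycleGraph 4 ↪g G where
  toFun := ![a, b, c, d]
  inj' := by
    intro i j hij
    have := hab.ne; have := hbc.ne; have := hcd.ne; have := hda.ne
    fin_cases i <;> fin_cases j <;> first | rfl | (exfalso; simp at hij; simp_all)
  map_rel_iff' := by
    intro i j
    have h : ∀ i j : Fin 4, (SimpleGraph.cycleGraph 4).Adj i j ↔ j = i + 1 ∨ i = j + 1 := by decide
    rw [h]
    change G.Adj (![a, b, c, d] i) (![a, b, c, d] j) ↔ _
    have hca : ¬ G.Adj c a := fun h => hac' h.symm
    have hdb : ¬ G.Adj d b := fun h => hbd' h.symm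
    have := hab.symm; have := hbc.symm; have := hcd.symm; have := hda.symm
    fin_cases i <;> fin_cases j <;> simp [*]

theorem cycle_adj (f : SimpleGraph.cycleGraph 4 ↪g G) (i : Fin 4) : G.Adj (f i) (f (i + 1)) := by
  rw [f.map_adj_iff]; fin_cases i <;> decide

theorem cycle_not_adj (f : SimpleGraph.cycleGraph 4 ↪g G) (i : Fin 4) :
    ¬ G.Adj (f i) (f (i + 2)) := by
  rw [f.map_adj_iff]; fin_cases i <;> decide

theorem cycle_ne (f : SimpleGraph.cycleGraph 4 ↪g G) (i : Fin 4) : f i ≠ f (i + 2) := by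
  intro h; have := f.injective h; revert this; fin_cases i <;> decide

/-- If `a` were the only common neighbor, the interval would have three elements and could not
contain a 4-cycle. Two common neighbors are nonadjacent because `u` and `v` are. -/
theorem IsThick.exists_common_adj (hG : G.Connected) (hT : IsThick G) (hD : DiamondFree G)
    {u v a : V} (h : G.dist u v = 2) (h₁ : G.Adj u a) (h₂ : G.Adj a v) :
    ∃ b, G.Adj u b ∧ G.Adj b v ∧ G.dist a b = 2 := by
  have hne := ne_of_dist_two h
  have hna := not_adj_of_dist_two h
  suffices h' : ∃ b, G.Adj u b ∧ G.Adj b v ∧ a ≠ b by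
    obtain ⟨b, hb₁, hb₂, hb⟩ := h'
    exact ⟨b, hb₁, hb₂, dist_eq_two hG h₁.symm hb₁ hb fun hab =>
      hna (hD hab h₁ hb₁ h₂.symm hb₂.symm hne)⟩
  obtain ⟨f, hf⟩ := hT u v h
  have hfi : ∀ i, f i = u ∨ f i = v ∨ (G.Adj u (f i) ∧ G.Adj (f i) v) := by
    intro i
    have hi := hf ⟨i, rfl⟩
    rw [mem_interval, h] at hi
    have h₀ : G.dist u (f i) = 0 ∨ G.dist (f i) v = 0 ∨
      (G.dist u (f i) = 1 ∧ G.dist (f i) v = 1) := by omega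
    rcases h₀ with h₀ | h₀ | ⟨h₀, h₀'⟩
    · exact Or.inl (hG.dist_eq_zero_iff.1 h₀).symm
    · exact Or.inr (Or.inl (hG.dist_eq_zero_iff.1 h₀))
    · exact Or.inr (Or.inr ⟨SimpleGraph.dist_eq_one_iff_adj.1 h₀,
        SimpleGraph.dist_eq_one_iff_adj.1 h₀'⟩)
  by_contra hcon
  push Not at hcon
  have hfa : ∀ i, f i = u ∨ f i = v ∨ f i = a := fun i =>
    (hfi i).imp_right (Or.imp_right fun h => (hcon _ h.1 h.2).symm)
  have hinj : ∀ {i j x}, f i = x → f j = x → i = j := fun h h' => f.injective (h.trans h'.symm)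
  rcases hfa 0 with h0 | h0 | h0 <;> rcases hfa 1 with h1 | h1 | h1 <;>
    rcases hfa 2 with h2 | h2 | h2 <;> rcases hfa 3 with h3 | h3 | h3 <;>
    first
    | exact absurd (hinj h0 h1) (by decide) | exact absurd (hinj h0 h2) (by decide)
    | exact absurd (hinj h0 h3) (by decide) | exact absurd (hinj h1 h2) (by decide)
    | exact absurd (hinj h1 h3) (by decide) | exact absurd (hinj h2 h3) (by decide)

theorem isThick_of_exists (h : ∀ u v, G.dist u v = 2 → ∃ a b, G.Adj u a ∧ G.Adj a v ∧ G.Adj u b ∧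
    G.Adj b v ∧ G.dist a b = 2) : IsThick G := by
  intro u v huv
  obtain ⟨a, b, hua, hav, hub, hbv, hab⟩ := h u v huv
  refine ⟨squareEmbedding hua hav hbv.symm hub.symm (ne_of_dist_two huv) (ne_of_dist_two hab)
    (not_adj_of_dist_two huv) (not_adj_of_dist_two hab), ?_⟩
  rintro _ ⟨i, rfl⟩
  fin_cases i
  · change G.dist u u + G.dist u v = _
    simp
  · exact mem_interval_of_adj huv hua hav
  · change G.dist u v + G.dist v v = _
    simp
  · exact mem_interval_of_adj huv hub hbv

end Basic

/-! ### From the axioms of dual polar graphs to weak modularity -/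

section DualPolarGraph

variable {V : Type*} {G : SimpleGraph V}

theorem exists_maximal_clique {s : Set V} (hs : G.IsClique s) :
    ∃ l, s ⊆ l ∧ Maximal G.IsClique l := by
  refine zorn_subset_nonempty {l | G.IsClique l} ?_ s hs
  intro c hc hch _
  refine ⟨⋃₀ c, ?_, fun t ht => Set.subset_sUnion_of_mem ht⟩
  rintro x ⟨t, ht, hxt⟩ y ⟨t', ht', hyt'⟩ hxy
  rcases hch.total ht ht' with h | h
  · exact hc ht' (h hxt) hyt' hxy
  · exact hc ht hxt (h hyt') hxy

/-- The nearest vertex on a line through `v` and `w` is neither of them: being equidistant from `u`,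
both would be nearest. -/
theorem AxiomA1.exists_closer (hG : G.Connected) (h : AxiomA1 G) {u v w : V} (hvw : G.Adj v w)
    (hd : G.dist u v = G.dist u w) :
    ∃ x, (x ≠ v ∧ x ≠ w) ∧ G.dist u x + 1 = G.dist u v ∧
      ∃ l, Maximal G.IsClique l ∧ v ∈ l ∧ w ∈ l ∧ x ∈ l := by
  obtain ⟨l, hl, hm⟩ := exists_maximal_clique (G := G) (s := {v, w}) (by
    simp [SimpleGraph.isClique_iff, Set.pairwise_insert, hvw, hvw.symm])
  have hv : v ∈ l := hl (by simp)
  have hw : w ∈ l := hl (by simp)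
  obtain ⟨x, ⟨hx, hmin⟩, huniq⟩ := h u l hm
  have hxv : x ≠ v := by
    rintro rfl
    exact hvw.ne (huniq w ⟨hw, fun y hy => hd ▸ hmin y hy⟩).symm
  have hxw : x ≠ w := by
    rintro rfl
    exact hvw.ne (huniq v ⟨hv, fun y hy => hd ▸ hmin y hy⟩)
  refine ⟨x, ⟨hxv, hxw⟩, ?_, l, hm, hv, hw, hx⟩
  have h₁ := hmin v hv
  have h₂ := dist_le_succ_of_adj hG (hm.1 hv hx hxv.symm) u
  have h₃ : G.dist u x ≠ G.dist u v := fun he =>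
    hxv (huniq v ⟨hv, fun y hy => he ▸ hmin y hy⟩).symm
  omega

/-- If `a` and `b` were nonadjacent, a line through `b`, `c`, `d` would miss `a`, and both `c` and
`d` would be nearest to `a` on it. -/
theorem AxiomA1.diamondFree (hG : G.Connected) (h : AxiomA1 G) : DiamondFree G := by
  intro a b c d hcd hac had hbc hbd hne
  by_contra hab
  obtain ⟨l, hl, hm⟩ := exists_maximal_clique (G := G) (s := {b, c, d}) (by
    simp [SimpleGraph.isClique_iff, Set.pairwise_insert, hcd, hcd.symm, hbc, hbc.symm, hbd,
      hbd.symm])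
  have hb : b ∈ l := hl (by simp)
  have hc : c ∈ l := hl (by simp)
  have hd : d ∈ l := hl (by simp)
  have ha : a ∉ l := fun ha => hab (hm.1 ha hb hne)
  obtain ⟨x, _, huniq⟩ := h a l hm
  have hpos : ∀ y ∈ l, 1 ≤ G.dist a y := fun y hy =>
    hG.pos_dist_of_ne fun h => ha (h ▸ hy)
  have h₁ := huniq c ⟨hc, fun y hy => (SimpleGraph.dist_eq_one_iff_adj.2 hac).trans_le (hpos y hy)⟩
  have h₂ := huniq d ⟨hd, fun y hy => (SimpleGraph.dist_eq_one_iff_adj.2 had).trans_le (hpos y hy)⟩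
  exact hcd.ne (h₁.trans h₂.symm)

theorem AxiomA1.triangleCondition (hG : G.Connected) (h : AxiomA1 G) (u : V) :
    TriangleCondition G u := by
  intro v w hvw _ hd
  have hvw' := SimpleGraph.dist_eq_one_iff_adj.1 hvw
  obtain ⟨x, ⟨hxv, hxw⟩, hx, l, hm, hv, hw, hxl⟩ := h.exists_closer hG hvw' hd
  exact ⟨x, hm.1 hxl hv hxv, hm.1 hxl hw hxw, hx⟩

/-- An outside vertex has only its gate as a neighbor in the gated set, so it cannot have two. -/
theorem IsGated.mem_of_adj (hG : G.Connected) {A : Set V} (hA : IsGated G A) {v w z : V} (hv : v ∈ A)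
    (hw : w ∈ A) (hne : v ≠ w) (hzv : G.Adj z v) (hzw : G.Adj z w) : z ∈ A := by
  by_contra hz
  obtain ⟨g, hg, hgate⟩ := hA z hz
  have h₀ : 0 < G.dist z g := hG.pos_dist_of_ne fun h => hz (h ▸ hg)
  have key : ∀ y ∈ A, G.Adj z y → g = y := by
    intro y hy hzy
    have h₁ := hgate y hy
    rw [mem_interval, SimpleGraph.dist_eq_one_iff_adj.2 hzy] at h₁
    exact hG.dist_eq_zero_iff.1 (by omega)
  exact hne ((key v hv hzv).symm.trans (key w hw hzw))

theorem IsGated.exists_gate {A : Set V} (hA : IsGated G A) (u : V) :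
    ∃ g ∈ A, ∀ y ∈ A, G.dist u g + G.dist g y = G.dist u y := by
  by_cases hu : u ∈ A
  · exact ⟨u, hu, by simp⟩
  · exact hA u hu

theorem subset_gatedHull {S : Set V} : S ⊆ gatedHull G S :=
  Set.subset_sInter fun _ h => h.2

/-- Axiom (A3&4) in the form in which it is used. -/
theorem AxiomA34.exists_quad (hG : G.Connected) (h : AxiomA34 G) {u v : V} (huv : G.dist u v = 2) :
    ∃ A, IsGated G A ∧ u ∈ A ∧ v ∈ A ∧ ∀ x ∈ A, ∀ y ∈ A, G.dist x y ≤ 2 :=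
  ⟨gatedHull G {u, v}, isGated_gatedHull G hG (by simp), subset_gatedHull (by simp),
    subset_gatedHull (by simp), fun x hx y hy => (h u v huv).2 ⟨x, hx, y, hy, rfl⟩⟩

/-- The required vertex is the gate `g` of `u` in a gated set of diameter 2 containing `v`, `w` and
hence `z`. The gate is equidistant from `v` and `w`, not equal to them, and one step farther from
`z`; the diameter forces the distances 1, 1 and 2. -/
theorem AxiomA34.quadrangleCondition (hG : G.Connected) (h : AxiomA34 G) (u : V) :
    QuadrangleCondition G u := by
  intro v w z hvz hwz hvw h2 hd hz
  obtain ⟨A, hA, hv, hw, hA2⟩ := h.exists_quad hG hvw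
  have hzA : z ∈ A := hA.mem_of_adj hG hv hw (ne_of_dist_two hvw)
    (SimpleGraph.dist_eq_one_iff_adj.1 hvz).symm (SimpleGraph.dist_eq_one_iff_adj.1 hwz).symm
  obtain ⟨g, hg, hgate⟩ := hA.exists_gate u
  have h₁ := hgate v hv
  have h₂ := hgate w hw
  have h₃ := hgate z hzA
  have h₄ := hA2 g hg z hzA
  have h₅ : G.dist g v ≠ 0 := fun h0 => by
    have e₁ := hG.dist_eq_zero_iff.1 h0
    have e₂ := hG.dist_eq_zero_iff.1 (show G.dist g w = 0 by omega)
    exact ne_of_dist_two hvw (e₁.symm.trans e₂)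
  exact ⟨g, SimpleGraph.dist_eq_one_iff_adj.1 (by omega),
    SimpleGraph.dist_eq_one_iff_adj.1 (by omega), by omega⟩

/-- A gated set of diameter 2 containing `a₁` and `a₂` absorbs all `bᵢ` and then `a₀`. -/
theorem AxiomA34.cubeCornerFree (hG : G.Connected) (h : AxiomA34 G) : CubeCornerFree G := by
  intro a₀ a₁ a₂ b₀ b₁ b₂ h01 h02 h10 h11 h12 h20 h21 h22 ha hb
  obtain ⟨A, hA, m1, m2, hA2⟩ := h.exists_quad hG ha
  have hne := ne_of_dist_two ha
  have n1 := hA.mem_of_adj hG m1 m2 hne h11.symm h21.symm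
  have n2 := hA.mem_of_adj hG m1 m2 hne h12.symm h22.symm
  have n0 := hA.mem_of_adj hG m1 m2 hne h10.symm h20.symm
  exact hA2 _ (hA.mem_of_adj hG n1 n2 (ne_of_dist_two hb) h01 h02) _ n0

theorem AxiomA5.isThick (hG : G.Connected) (h : AxiomA5 G) : IsThick G := by
  refine isThick_of_exists fun u v huv => ?_
  obtain ⟨x, hux, hxv⟩ := exists_common_adj hG huv
  obtain ⟨y, hy, hvy, h₁, h₂, h₃⟩ := h u v (not_adj_of_dist_two huv) x
    (mem_interval_of_adj huv hux hxv) hux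
  exact ⟨x, y, hux, hxv, SimpleGraph.dist_eq_one_iff_adj.1 (by omega), hvy.symm, by omega⟩

end DualPolarGraph

end DualPolar
namespace DualPolar

/-! ### Quads of a thick weakly modular graph -/

section Quads

variable {V : Type*} {G : SimpleGraph V}

/-- The neighbors of `u` at distance at most 2 from `x`. -/
def cone (G : SimpleGraph V) (u x : V) : Set V :=
  {c | G.Adj u c ∧ G.dist c x ≤ 2}

/-- The lines through `u` partition its neighbors; this is transitivity of that partition. -/
theorem DiamondFree.eq_or_adj (hD : DiamondFree G) {u a b c : V} (hua : G.Adj u a) (hub : G.Adj u b)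
    (huc : G.Adj u c) (hb : b = a ∨ G.Adj b a) (hc : c = a ∨ G.Adj c a) : b = c ∨ G.Adj b c := by
  rcases hb with rfl | hb
  · exact hc.imp Eq.symm SimpleGraph.Adj.symm
  · rcases hc with rfl | hc
    · exact Or.inr hb
    · by_cases h : b = c
      · exact Or.inl h
      · exact Or.inr (hD hua hub.symm hb huc.symm hc h)

/-- A `c` at distance 2 from `x` is as far from `x` as `u` is, so TC at `x` applies to the edge
`uc`. Thus a cone consists of the lines through `u` that meet the neighborhood of `x`. -/
theorem exists_adj_of_mem_cone (hT : ∀ u, TriangleCondition G u) {u x c : V}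
    (hx : G.dist u x = 2) (hc : c ∈ cone G u x) :
    ∃ a, G.Adj u a ∧ G.Adj a x ∧ (a = c ∨ G.Adj a c) := by
  obtain ⟨huc, hd⟩ := hc
  have h₀ : G.dist c x ≠ 0 := fun h => by
    rcases SimpleGraph.dist_eq_zero_iff_eq_or_not_reachable.1 h with rfl | h
    · exact not_adj_of_dist_two hx huc
    · exact h (huc.symm.reachable.trans (SimpleGraph.Reachable.of_dist_ne_zero (by omega)))
  by_cases h₁ : G.dist c x = 1
  · exact ⟨c, huc, SimpleGraph.dist_eq_one_iff_adj.1 h₁, Or.inl rfl⟩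
  · rw [SimpleGraph.dist_comm] at hx hd h₀ h₁
    obtain ⟨a, hau, hac, ha⟩ := hT x u c (SimpleGraph.dist_eq_one_iff_adj.2 huc) (by omega) (by omega)
    exact ⟨a, hau.symm, (SimpleGraph.dist_eq_one_iff_adj.1 (by omega)).symm, Or.inr hac⟩

theorem mem_cone_of_adj (hG : G.Connected) {u x a c : V} (huc : G.Adj u c) (hax : G.Adj a x)
    (h : a = c ∨ G.Adj a c) : c ∈ cone G u x := by
  refine ⟨huc, ?_⟩
  rcases h with rfl | h
  · rw [SimpleGraph.dist_eq_one_iff_adj.2 hax]; omega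
  · exact dist_le_two hG h.symm hax

variable (hG : G.Connected) (hD : DiamondFree G) (hT : ∀ u, TriangleCondition G u)
  (hC : CubeCornerFree G)

include hG hD hT

theorem mem_cone_of_line {u x c d : V} (hx : G.dist u x = 2) (hc : c ∈ cone G u x)
    (hud : G.Adj u d) (h : d = c ∨ G.Adj d c) : d ∈ cone G u x := by
  obtain ⟨a, hua, hax, hac⟩ := exists_adj_of_mem_cone hT hx hc
  exact mem_cone_of_adj hG hud hax (hD.eq_or_adj hc.1 hua hud hac h)

theorem cone_subset_of_adj {u x y : V} (hx : G.dist u x = 2) (hy : G.dist u y = 2)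
    (hxy : G.Adj x y) : cone G u x ⊆ cone G u y := by
  intro c hc
  obtain ⟨a, hua, hax, hac⟩ := exists_adj_of_mem_cone hT hx hc
  exact mem_cone_of_line hG hD hT hy ⟨hua, dist_le_two hG hax hxy⟩ hc.1
    (hac.imp Eq.symm SimpleGraph.Adj.symm)

theorem cone_eq_of_adj {u x y : V} (hx : G.dist u x = 2) (hy : G.dist u y = 2)
    (hxy : G.Adj x y) : cone G u x = cone G u y :=
  (cone_subset_of_adj hG hD hT hx hy hxy).antisymm (cone_subset_of_adj hG hD hT hy hx hxy.symm)

include hC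

/-- If `e` is a neighbor of `u` and `x`, then `y, u, x` against `e, a, b` is a `K33minus` with
missing edge `ye`; its exclusion puts `e` within distance 2 of `y`. -/
theorem cone_subset_of_two_adj {u x y a b : V} (hx : G.dist u x = 2) (hy : G.dist u y = 2)
    (hab : G.dist a b = 2) (hua : G.Adj u a) (hub : G.Adj u b) (hax : G.Adj a x) (hbx : G.Adj b x)
    (hay : G.Adj a y) (hby : G.Adj b y) : cone G u x ⊆ cone G u y := by
  intro d hd
  obtain ⟨e, hue, hex, hed⟩ := exists_adj_of_mem_cone hT hx hd
  have h := hC hay.symm hby.symm hue hua hub hex.symm hax.symm hbx.symm hx hab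
  exact mem_cone_of_line hG hD hT hy ⟨hue, G.dist_comm.trans_le h⟩ hd.1
    (hed.imp Eq.symm SimpleGraph.Adj.symm)

theorem cone_eq_of_two_adj {u x y a b : V} (hx : G.dist u x = 2) (hy : G.dist u y = 2)
    (hab : G.dist a b = 2) (hua : G.Adj u a) (hub : G.Adj u b) (hax : G.Adj a x) (hbx : G.Adj b x)
    (hay : G.Adj a y) (hby : G.Adj b y) : cone G u x = cone G u y :=
  (cone_subset_of_two_adj hG hD hT hC hx hy hab hua hub hax hbx hay hby).antisymm
    (cone_subset_of_two_adj hG hD hT hC hy hx hab hua hub hay hby hax hbx)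

theorem cone_eq_of_common_adj {u x y a b b' : V} (hx : G.dist u x = 2) (hy : G.dist u y = 2)
    (hab : G.dist a b = 2) (hua : G.Adj u a) (hub : G.Adj u b)
    (hub' : G.Adj u b') (hax : G.Adj a x) (hbx : G.Adj b x) (hay : G.Adj a y) (hby : G.Adj b' y)
    (hbb' : b = b' ∨ G.Adj b b') : cone G u x = cone G u y := by
  by_cases hxy : x = y
  · rw [hxy]
  by_cases hadj : G.Adj x y
  · exact cone_eq_of_adj hG hD hT hx hy hadj
  by_cases hbx' : G.Adj b y
  · exact cone_eq_of_two_adj hG hD hT hC hx hy hab hua hub hax hbx hay hbx'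
  rcases hbb' with rfl | hbb'
  · exact absurd hby hbx'
  have hby2 : G.dist b y = 2 := dist_eq_two hG hbb' hby (fun h => not_adj_of_dist_two hy (h ▸ hub)) hbx'
  have hux : ¬ G.Adj u x := not_adj_of_dist_two hx
  have huy : ¬ G.Adj u y := not_adj_of_dist_two hy
  have hyx2 : G.dist y x = 2 := dist_eq_two hG hay.symm hax (Ne.symm hxy) fun h => hadj h.symm
  -- TC at `y` for the edge `bx` yields a vertex `w` adjacent to both `x` and `y` and at distance 2
  -- from `u`, through which the cone is carried.
  obtain ⟨w, hwb, hwx, hwy⟩ := hT y b x (SimpleGraph.dist_eq_one_iff_adj.2 hbx)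
    (by rw [SimpleGraph.dist_comm]; omega) (by rw [SimpleGraph.dist_comm]; omega)
  have hwy' : G.Adj y w := SimpleGraph.dist_eq_one_iff_adj.1
    (by rw [SimpleGraph.dist_comm (u := y) (v := b)] at hwy; omega)
  have huw : G.dist u w = 2 := by
    refine dist_eq_two hG hub hwb.symm (fun h => hux (h ▸ hwx)) fun h => hux ?_
    exact hD hwb h hub hwx.symm hbx.symm (ne_of_dist_two hx)
  rw [cone_eq_of_adj hG hD hT hx huw hwx.symm, cone_eq_of_adj hG hD hT huw hy hwy'.symm]

/-- If some line meets the neighborhoods of `x` and `y` in a common vertex, `cone_eq_of_common_adj`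
applies. Otherwise TC at `a'` for the edge `xb` replaces `x` by a neighbor `w` adjacent to `a'`,
without changing the cone. -/
theorem cone_eq_of_two_lines {u x y c c' : V} (hx : G.dist u x = 2) (hy : G.dist u y = 2)
    (hcc : G.dist c c' = 2) (hcx : c ∈ cone G u x) (hcx' : c' ∈ cone G u x)
    (hcy : c ∈ cone G u y) (hcy' : c' ∈ cone G u y) : cone G u x = cone G u y := by
  obtain ⟨a, hua, hax, hac⟩ := exists_adj_of_mem_cone hT hx hcx
  obtain ⟨b, hub, hbx, hbc⟩ := exists_adj_of_mem_cone hT hx hcx'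
  obtain ⟨a', hua', hay, hac'⟩ := exists_adj_of_mem_cone hT hy hcy
  obtain ⟨b', hub', hby, hbc'⟩ := exists_adj_of_mem_cone hT hy hcy'
  have hlines : ∀ p q, G.Adj u p → G.Adj u q → (p = c ∨ G.Adj p c) → (q = c' ∨ G.Adj q c') →
      G.dist p q = 2 := by
    intro p q hp hq hpc hqc
    have key : ¬ (q = p ∨ G.Adj q p) := fun h => by
      have h₁ := hD.eq_or_adj hp hcx.1 hq (hpc.imp Eq.symm SimpleGraph.Adj.symm) h
      have h₂ := hD.eq_or_adj hq hcx.1 hcx'.1 h₁ (hqc.imp Eq.symm SimpleGraph.Adj.symm)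
      rcases h₂ with h₂ | h₂
      · exact ne_of_dist_two hcc h₂
      · exact not_adj_of_dist_two hcc h₂
    exact dist_eq_two hG hp.symm hq (fun h => key (Or.inl h.symm)) fun h => key (Or.inr h.symm)
  have haa' : a = a' ∨ G.Adj a a' := hD.eq_or_adj hcx.1 hua hua' hac hac'
  have hbb' : b = b' ∨ G.Adj b b' := hD.eq_or_adj hcx'.1 hub hub' hbc hbc'
  by_cases ha'x : G.Adj a' x
  · exact cone_eq_of_common_adj hG hD hT hC hx hy (hlines a' b hua' hub hac' hbc) hua' hub hub' ha'x
      hbx hay hby hbb'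
  have hna : a ≠ a' := fun h => ha'x (h ▸ hax)
  have haa'' := haa'.resolve_left hna
  have ha'x2 : G.dist a' x = 2 := dist_eq_two hG haa''.symm hax
    (fun h => not_adj_of_dist_two hx (h ▸ hua')) ha'x
  have ha'b := hlines a' b hua' hub hac' hbc
  obtain ⟨w, hwx, hwb, hw⟩ := hT a' x b (SimpleGraph.dist_eq_one_iff_adj.2 hbx.symm) (by omega)
    (by omega)
  have ha'w : G.Adj a' w := SimpleGraph.dist_eq_one_iff_adj.1 (by omega)
  have huw : G.dist u w = 2 := by
    have hux : ¬ G.Adj u x := not_adj_of_dist_two hx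
    refine dist_eq_two hG hub hwb.symm (fun h => hux (h ▸ hwx)) fun h => hux ?_
    exact hD hwb h hub hwx.symm hbx.symm (ne_of_dist_two hx)
  rw [cone_eq_of_adj hG hD hT hx huw hwx.symm]
  exact cone_eq_of_common_adj hG hD hT hC huw hy ha'b hua' hub hub' ha'w hwb.symm hay hby hbb'

omit hC in
theorem quad_line_closed {u v p q y : V} (hv : G.dist u v = 2) (hp : p ∈ cone G u v)
    (hq : q ∈ cone G u v) (hpq : G.Adj p q) (hyp : G.Adj y p) (hyq : G.Adj y q) (hyu : y ≠ u) :
    y ∈ cone G u v := by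
  have huy := hD hpq hp.1 hq.1 hyp hyq hyu.symm
  exact mem_cone_of_line hG hD hT hv hp huy (Or.inr hyp)

omit hC hG hD hT in
/-- The quad through `u` and `v`, described from its vertex `u`. -/
def quad (G : SimpleGraph V) (u v : V) : Set V :=
  {y | y = u ∨ y ∈ cone G u v ∨ (G.dist u y = 2 ∧ cone G u y = cone G u v)}

/-- Vertices within distance 2 of `u` are placed by the comparison of cones. The two lines through
`a₁` and `a₂` serve to exclude a vertex at distance 3. -/
theorem quad_closed {u v a₁ a₂ : V} (hv : G.dist u v = 2) (h₁ : a₁ ∈ cone G u v)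
    (h₂ : a₂ ∈ cone G u v) (h₁₂ : G.dist a₁ a₂ = 2) {p q y : V} (hp : p ∈ quad G u v)
    (hq : q ∈ quad G u v) (hpq : p ≠ q) (hyp : G.Adj y p) (hyq : G.Adj y q) : y ∈ quad G u v := by
  by_cases hyu : y = u
  · exact Or.inl hyu
  -- `y` adjacent to `u` and to a point of the cone
  have line : ∀ {p}, p ∈ cone G u v → G.Adj y p → G.Adj u y → y ∈ quad G u v := fun hp hyp huy =>
    Or.inr (Or.inl (mem_cone_of_line hG hD hT hv hp huy (Or.inr hyp)))
  -- `y` adjacent to `u` and to a point at distance two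
  have far : ∀ {p}, G.dist u p = 2 → cone G u p = cone G u v → G.Adj y p → G.Adj u y →
      y ∈ quad G u v := fun _ hc hyp huy =>
    Or.inr (Or.inl (hc ▸ mem_cone_of_adj hG huy hyp (Or.inl rfl)))
  -- `y` at distance two, adjacent to a point at distance two
  have two : ∀ {p}, G.dist u p = 2 → cone G u p = cone G u v → G.Adj y p → G.dist u y = 2 →
      y ∈ quad G u v := fun hp hc hyp huy =>
    Or.inr (Or.inr ⟨huy, (cone_eq_of_adj hG hD hT huy hp hyp).trans hc⟩)
  -- a point of the cone and a point at distance two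
  have mixed : ∀ {p q}, p ∈ cone G u v → G.dist u q = 2 → cone G u q = cone G u v → G.Adj y p →
      G.Adj y q → y ∈ quad G u v := by
    intro p q hp hq hc hyp hyq
    by_cases huy : G.Adj u y
    · exact line hp hyp huy
    · exact two hq hc hyq (dist_eq_two hG hp.1 hyp.symm (Ne.symm hyu) huy)
  rcases hp with rfl | hp | ⟨hp, hpc⟩
  · rcases hq with rfl | hq | ⟨hq, hqc⟩
    · exact absurd rfl hpq
    · exact line hq hyq hyp.symm
    · exact far hq hqc hyq hyp.symm
  · rcases hq with rfl | hq | ⟨hq, hqc⟩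
    · exact line hp hyp hyq.symm
    · by_cases huy : G.Adj u y
      · exact line hp hyp huy
      by_cases hadj : G.Adj p q
      · exact Or.inr (Or.inl (quad_line_closed hG hD hT hv hp hq hadj hyp hyq hyu))
      · have hy2 := dist_eq_two hG hp.1 hyp.symm (Ne.symm hyu) huy
        exact Or.inr (Or.inr ⟨hy2, cone_eq_of_two_lines hG hD hT hC hy2 hv
          (dist_eq_two hG hp.1.symm hq.1 hpq hadj) (mem_cone_of_adj hG hp.1 hyp.symm (Or.inl rfl))
          (mem_cone_of_adj hG hq.1 hyq.symm (Or.inl rfl)) hp hq⟩)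
    · exact mixed hp hq hqc hyp hyq
  · rcases hq with rfl | hq | ⟨hq, hqc⟩
    · exact far hp hpc hyp hyq.symm
    · exact mixed hq hp hpc hyq hyp
    · by_cases huy : G.Adj u y
      · exact far hp hpc hyp huy
      by_cases huy2 : G.dist u y ≤ 2
      · have h₀ := hG.pos_dist_of_ne (Ne.symm hyu)
        have h₃ : G.dist u y ≠ 1 := fun h => huy (SimpleGraph.dist_eq_one_iff_adj.1 h)
        exact two hp hpc hyp (by omega)
      have huy3 : G.dist u y = 3 := by
        have := dist_le_succ_of_adj hG hyp u
        omega
      -- Adjacent `p`, `q` have by TC a common neighbor next to `u`, and diamond-freeness joins it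
      -- to `y`. Nonadjacent `p`, `q` turn out to share neighbors `b₁`, `b₂` on two lines through
      -- `u`; then `u, p, q` against `y, b₁, b₂` is a forbidden `K33minus`.
      exfalso
      by_cases hadj : G.Adj p q
      · obtain ⟨c, hcp, hcq, hc⟩ := hT u p q (SimpleGraph.dist_eq_one_iff_adj.2 hadj) (by omega)
          (by omega)
        have huc : G.Adj u c := SimpleGraph.dist_eq_one_iff_adj.1 (by omega)
        have hcy : G.Adj c y := hD hadj hcp hcq hyp hyq (by
          rintro rfl
          rw [SimpleGraph.dist_eq_one_iff_adj.2 huc] at huy3; omega)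
        exact huy2 (dist_le_two hG huc hcy)
      -- the neighbors of `p` and `q` on a line through `u` coincide
      have key : ∀ c ∈ cone G u v, ∃ a, G.Adj u a ∧ G.Adj a p ∧ G.Adj a q ∧
          (a = c ∨ G.Adj a c) := by
        intro c hc
        obtain ⟨a, hua, hap, hac⟩ := exists_adj_of_mem_cone hT hp (hpc ▸ hc)
        obtain ⟨a', hua', haq, hac'⟩ := exists_adj_of_mem_cone hT hq (hqc ▸ hc)
        suffices h : a = a' from ⟨a, hua, hap, h ▸ haq, hac⟩
        by_contra hne
        have haa' := (hD.eq_or_adj hc.1 hua hua' hac hac').resolve_left hne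
        have hfar : ∀ {a}, G.Adj u a → G.dist y a ≥ 2 := fun {a} ha => by
          have h := dist_le_succ_of_adj hG ha y
          rw [SimpleGraph.dist_comm] at huy3; omega
        have hd₁ := dist_le_two hG hyp hap.symm
        have hd₂ := dist_le_two hG hyq haq.symm
        have hd₃ := hfar hua
        have hd₄ := hfar hua'
        -- Distinct `a`, `a'` on one line would both be at distance 2 from `y`; TC at `y` then gives
        -- a neighbor `t` of `y` on that line, hence adjacent to `u`.
        obtain ⟨t, hta, hta', ht⟩ := hT y a a' (SimpleGraph.dist_eq_one_iff_adj.2 haa') (by omega)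
          (by omega)
        have hyt : G.Adj y t := SimpleGraph.dist_eq_one_iff_adj.1 (by omega)
        have htu : G.Adj t u := hD haa' hta hta' hua hua' fun h => by
          rw [h] at hyt; exact huy hyt.symm
        exact huy2 (dist_le_two hG htu.symm hyt.symm)
      obtain ⟨b₁, hub₁, hb₁p, hb₁q, hb₁⟩ := key a₁ h₁
      obtain ⟨b₂, hub₂, hb₂p, hb₂q, hb₂⟩ := key a₂ h₂
      have hb : G.dist b₁ b₂ = 2 := by
        have key : ¬ (b₂ = b₁ ∨ G.Adj b₂ b₁) := fun h => by
          have h₁' := hD.eq_or_adj hub₁ h₁.1 hub₂ (hb₁.imp Eq.symm SimpleGraph.Adj.symm) h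
          have h₂' := hD.eq_or_adj hub₂ h₁.1 h₂.1 h₁' (hb₂.imp Eq.symm SimpleGraph.Adj.symm)
          rcases h₂' with h₂' | h₂'
          · exact ne_of_dist_two h₁₂ h₂'
          · exact not_adj_of_dist_two h₁₂ h₂'
        exact dist_eq_two hG hub₁.symm hub₂ (fun h => key (Or.inl h.symm))
          fun h => key (Or.inr h.symm)
      exact huy2 (hC hub₁ hub₂ hyp.symm hb₁p.symm hb₂p.symm hyq.symm hb₁q.symm hb₂q.symm
        (dist_eq_two hG hyp.symm hyq hpq hadj) hb)

omit hC in
-- The case to exclude is `x`, `y` both at distance 2 from `u` and at distance 3 from each other.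
-- Neighbors `a`, `b` of `y` on two lines of the common cone are at distance 2 from `x`, so QC at
-- `x` gives `t` adjacent to `x`, `a`, `b`. TC at `u` for `tx` gives `c` in the cone, and TC at `y`
-- for `tc` gives `w` adjacent to `y`. Now `w` and `x` both see the edge `ct`, so they are adjacent,
-- and `x`, `y` are at distance at most 2.
theorem quad_diam (hQ : ∀ u, QuadrangleCondition G u) {u v a₁ a₂ : V} (h₁ : a₁ ∈ cone G u v)
    (h₂ : a₂ ∈ cone G u v) (h₁₂ : G.dist a₁ a₂ = 2) {x y : V} (hx : x ∈ quad G u v)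
    (hy : y ∈ quad G u v) : G.dist x y ≤ 2 := by
  have e : ∀ {a b}, G.Adj a b → G.dist a b ≤ 2 := fun h => by
    rw [SimpleGraph.dist_eq_one_iff_adj.2 h]; omega
  have sy : ∀ {a b}, G.dist a b ≤ 2 → G.dist b a ≤ 2 := fun h => G.dist_comm.trans_le h
  rcases hx with rfl | hx | ⟨hx, hxc⟩
  · rcases hy with rfl | hy | ⟨hy, hyc⟩
    · simp
    · exact e hy.1
    · omega
  · rcases hy with rfl | hy | ⟨hy, hyc⟩
    · exact e hx.1.symm
    · exact dist_le_two hG hx.1.symm hy.1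
    · rw [← hyc] at hx; exact hx.2
  · rcases hy with rfl | hy | ⟨hy, hyc⟩
    · exact sy hx.le
    · rw [← hxc] at hy; exact sy hy.2
    · by_contra hd
      have adjx : ∀ {z}, G.Adj x z → ¬ G.Adj z y := fun h₁ h₂ => hd (dist_le_two hG h₁ h₂)
      obtain ⟨a, hua, hay, haa⟩ := exists_adj_of_mem_cone hT hy (hyc ▸ h₁)
      obtain ⟨b, hub, hby, hbb⟩ := exists_adj_of_mem_cone hT hy (hyc ▸ h₂)
      have hab : G.dist a b = 2 := by
        have key : ¬ (b = a ∨ G.Adj b a) := fun h => by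
          have h₁' := hD.eq_or_adj hua h₁.1 hub (haa.imp Eq.symm SimpleGraph.Adj.symm) h
          have h₂' := hD.eq_or_adj hub h₁.1 h₂.1 h₁' (hbb.imp Eq.symm SimpleGraph.Adj.symm)
          rcases h₂' with h₂' | h₂'
          · exact ne_of_dist_two h₁₂ h₂'
          · exact not_adj_of_dist_two h₁₂ h₂'
        exact dist_eq_two hG hua.symm hub (fun h => key (Or.inl h.symm))
          fun h => key (Or.inr h.symm)
      have hxa : ∀ {a}, G.Adj u a → G.Adj a y → G.dist x a = 2 := fun {a} hua hay => by
        have hmem : a ∈ cone G u x := by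
          rw [hxc, ← hyc]; exact mem_cone_of_adj hG hua hay (Or.inl rfl)
        have h₁ := hmem.2
        have h₂ := dist_le_succ_of_adj hG hay.symm x
        rw [SimpleGraph.dist_comm] at h₁
        omega
      have hxy3 : G.dist x y = 3 := by
        have h₁ := hxa hua hay
        have h₂ := dist_le_succ_of_adj hG hay.symm x
        omega
      have hxa2 := hxa hua hay
      have hxb2 := hxa hub hby
      obtain ⟨t, hta, htb, ht⟩ := hQ x a b y (SimpleGraph.dist_eq_one_iff_adj.2 hay)
        (SimpleGraph.dist_eq_one_iff_adj.2 hby) hab (by omega) (by omega) (by omega)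
      have hxt : G.Adj x t := SimpleGraph.dist_eq_one_iff_adj.1 (by omega)
      have hut : G.dist u t = 2 := by
        refine dist_eq_two hG hua hta.symm (fun h => ?_) fun h => ?_
        · exact not_adj_of_dist_two hx (h ▸ hxt.symm)
        · exact not_adj_of_dist_two hab
            (hD h hua.symm hta.symm hub.symm htb.symm (ne_of_dist_two hab))
      obtain ⟨c, hct, hcx, hc⟩ := hT u t x (SimpleGraph.dist_eq_one_iff_adj.2 hxt.symm) (by omega)
        (by omega)
      have huc : G.Adj u c := SimpleGraph.dist_eq_one_iff_adj.1 (by omega)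
      have hcy : G.dist c y ≤ 2 := by
        have hmem : c ∈ cone G u y := by
          rw [hyc, ← hxc]; exact mem_cone_of_adj hG huc hcx (Or.inl rfl)
        exact hmem.2
      have hyc2 : G.dist y c = 2 := by
        have h₁ := dist_le_succ_of_adj hG hcx.symm y
        rw [SimpleGraph.dist_comm] at hcy hxy3
        omega
      have hyt2 : G.dist y t = 2 := by
        have h₁ := dist_le_succ_of_adj hG hxt y
        have h₂ := dist_le_two hG hay.symm hta.symm
        rw [SimpleGraph.dist_comm] at hxy3
        omega
      obtain ⟨w, hwt, hwc, hw⟩ := hT y t c (SimpleGraph.dist_eq_one_iff_adj.2 hct.symm) (by omega)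
        (by omega)
      have hyw : G.Adj y w := SimpleGraph.dist_eq_one_iff_adj.1 (by omega)
      by_cases hwx : w = x
      · exact hd (e (hwx ▸ hyw.symm))
      · exact adjx (hD hct.symm hwt hwc hxt hcx.symm hwx).symm hyw.symm

omit hG hD hT hC in
-- The gate is the nearest point. Two nearest points would, by TC or QC, have a common neighbor
-- nearer to `x`, and closedness keeps it in `A`. Uniqueness then forces distances from `x` to grow
-- by the distance from the gate.
theorem isGated_of_closed (hG : G.Connected) (hT : ∀ u, TriangleCondition G u)
    (hQ : ∀ u, QuadrangleCondition G u) {A : Set V} (hne : A.Nonempty)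
    (hdiam : ∀ x ∈ A, ∀ y ∈ A, G.dist x y ≤ 2)
    (hclosed : ∀ p ∈ A, ∀ q ∈ A, p ≠ q → ∀ y, G.Adj y p → G.Adj y q → y ∈ A) : IsGated G A := by
  intro x hx
  obtain ⟨g, hg, hmin⟩ : ∃ g ∈ A, ∀ y ∈ A, G.dist x g ≤ G.dist x y := by
    obtain ⟨a, ha⟩ := hne
    obtain ⟨g, hg, h⟩ := (measure fun y => G.dist x y).wf.has_min A ⟨a, ha⟩
    exact ⟨g, hg, fun y hy => not_lt.1 (h y hy)⟩
  have hpos : 0 < G.dist x g := hG.pos_dist_of_ne fun h => hx (h ▸ hg)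
  -- two distinct nearest points give a contradiction
  have uniq : ∀ g' ∈ A, ∀ g ∈ A, (∀ y ∈ A, G.dist x g ≤ G.dist x y) → G.dist x g = G.dist x g' →
      g ≠ g' → False := by
    intro g' hg' g hg hmin he hne
    have hpos : 0 < G.dist x g := hG.pos_dist_of_ne fun h => hx (h ▸ hg)
    by_cases h1 : G.dist x g = 1
    · exact hx (hclosed g hg g' hg' hne x (SimpleGraph.dist_eq_one_iff_adj.1 h1)
        (SimpleGraph.dist_eq_one_iff_adj.1 (he ▸ h1)))
    have hd := hdiam g hg g' hg'
    have hd0 := hG.pos_dist_of_ne hne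
    by_cases hd1 : G.dist g g' = 1
    · obtain ⟨z, hzg, hzg', hz⟩ := hT x g g' hd1 (by omega) he
      have := hmin z (hclosed g hg g' hg' hne z hzg hzg')
      omega
    · obtain ⟨m, hgm, hmg'⟩ := exists_common_adj hG (show G.dist g g' = 2 by omega)
      have hm : m ∈ A := hclosed g hg g' hg' hne m hgm.symm hmg'
      have h₁ := hmin m hm
      have h₂ := dist_le_succ_of_adj hG hgm.symm x
      by_cases h₃ : G.dist x m = G.dist x g
      · obtain ⟨z, hzg, hzm, hz⟩ := hT x g m (SimpleGraph.dist_eq_one_iff_adj.2 hgm) (by omega)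
          (by omega)
        have := hmin z (hclosed g hg m hm hgm.ne z hzg hzm)
        omega
      · obtain ⟨z, hzg, hzg', hz⟩ := hQ x g g' m (SimpleGraph.dist_eq_one_iff_adj.2 hgm)
          (SimpleGraph.dist_eq_one_iff_adj.2 hmg'.symm) (by omega) (by omega) he (by omega)
        have := hmin z (hclosed g hg g' hg' hne z hzg hzg')
        omega
  have hadj : ∀ y ∈ A, G.Adj g y → G.dist x y = G.dist x g + 1 := by
    intro y hy hgy
    have h₁ := dist_le_succ_of_adj hG hgy.symm x
    have h₂ := hmin y hy
    have h₃ : G.dist x g ≠ G.dist x y := fun h => uniq y hy g hg hmin h hgy.ne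
    omega
  refine ⟨g, hg, fun y hy => ?_⟩
  rw [mem_interval]
  by_cases hgy : g = y
  · simp [hgy]
  have hd := hdiam g hg y hy
  have hd0 := hG.pos_dist_of_ne hgy
  by_cases hd1 : G.dist g y = 1
  · rw [hadj y hy (SimpleGraph.dist_eq_one_iff_adj.1 hd1), hd1]
  have hd2 : G.dist g y = 2 := by omega
  obtain ⟨m, hgm, hmy⟩ := exists_common_adj hG hd2
  have hm : m ∈ A := hclosed g hg y hy hgy m hgm.symm hmy
  have hxm := hadj m hm hgm
  have h₁ := dist_le_succ_of_adj hG hmy.symm x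
  have h₂ := hmin y hy
  have h₃ : G.dist x g ≠ G.dist x y := fun h => uniq y hy g hg hmin h hgy
  by_cases h₄ : G.dist x y = G.dist x m
  · exfalso
    -- If the distance does not grow from `m` to `y`, TC produces a second nearest point `z`,
    -- distinct from `g` because it is adjacent to `y`.
    obtain ⟨z, hzm, hzy, hz⟩ := hT x m y (SimpleGraph.dist_eq_one_iff_adj.2 hmy) (by omega) h₄.symm
    have hzA : z ∈ A := hclosed m hm y hy hmy.ne z hzm hzy
    refine uniq z hzA g hg hmin (by omega) ?_
    rintro rfl
    rw [SimpleGraph.dist_eq_one_iff_adj.2 hzy] at hd2; omega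
  · omega

theorem axiomA34_of_weaklyModular (hQ : ∀ u, QuadrangleCondition G u) (hThick : IsThick G) :
    AxiomA34 G := by
  intro u v huv
  obtain ⟨a, hua, hav⟩ := exists_common_adj hG huv
  obtain ⟨b, hub, hbv, hab⟩ := hThick.exists_common_adj hG hD huv hua hav
  have h₁ : a ∈ cone G u v := mem_cone_of_adj hG hua hav (Or.inl rfl)
  have h₂ : b ∈ cone G u v := mem_cone_of_adj hG hub hbv (Or.inl rfl)
  have hsub : gatedHull G {u, v} ⊆ quad G u v := by
    refine Set.sInter_subset_of_mem ⟨?_, ?_⟩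
    · exact isGated_of_closed hG hT hQ ⟨u, Or.inl rfl⟩
        (fun x hx y hy => quad_diam hG hD hT hQ h₁ h₂ hab hx hy)
        fun p hp q hq hpq y hyp hyq => quad_closed hG hD hT hC huv h₁ h₂ hab hp hq hpq hyp hyq
    · rintro x (rfl | rfl)
      · exact Or.inl rfl
      · exact Or.inr (Or.inr ⟨huv, rfl⟩)
  refine ⟨⟨u, subset_gatedHull (by simp), v, subset_gatedHull (by simp), huv⟩, ?_⟩
  rintro _ ⟨x, hx, y, hy, rfl⟩
  exact quad_diam hG hD hT hQ h₁ h₂ hab (hsub hx) (hsub hy)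

omit hC in
-- By diamond-freeness and maximality a line contains every common neighbor of two of its vertices.
-- So the vertex that TC supplies for two nearest vertices lies on the line and is nearer.
theorem axiomA1_of_triangleCondition : AxiomA1 G := by
  intro p l hl
  have hne : l.Nonempty := by
    by_contra h
    rw [Set.not_nonempty_iff_eq_empty] at h
    subst h
    exact hl.2 (y := {p}) (by simp [SimpleGraph.isClique_iff]) (by simp) (Set.mem_singleton p)
  obtain ⟨g, hg, hmin⟩ : ∃ g ∈ l, ∀ y ∈ l, G.dist p g ≤ G.dist p y := by
    obtain ⟨g, hg, h⟩ := (measure fun y => G.dist p y).wf.has_min l hne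
    exact ⟨g, hg, fun y hy => not_lt.1 (h y hy)⟩
  refine ⟨g, ⟨hg, hmin⟩, ?_⟩
  rintro g' ⟨hg', hmin'⟩
  by_contra hne
  have he : G.dist p g = G.dist p g' := le_antisymm (hmin _ hg') (hmin' _ hg)
  have hadj : G.Adj g g' := hl.1 hg hg' (Ne.symm hne)
  -- a common neighbor of `g` and `g'` lies on the line `l`
  have mem : ∀ q, G.Adj q g → G.Adj q g' → q ∈ l := by
    intro q hqg hqg'
    refine hl.2 (y := insert q l) ?_ (Set.subset_insert q l) (Set.mem_insert q l)
    refine hl.1.insert fun z hz hqz => ?_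
    by_cases hzg : z = g
    · exact hzg ▸ hqg
    by_cases hzg' : z = g'
    · exact hzg' ▸ hqg'
    exact hD hadj hqg hqg' (hl.1 hz hg hzg) (hl.1 hz hg' hzg') hqz
  rcases Nat.lt_or_ge 1 (G.dist p g) with h1 | h1
  · obtain ⟨q, hqg, hqg', hq⟩ := hT p g g' (SimpleGraph.dist_eq_one_iff_adj.2 hadj) h1 he
    have := hmin q (mem q hqg hqg')
    omega
  · rcases Nat.lt_or_ge 0 (G.dist p g) with h0 | h0
    · have hp := mem p (SimpleGraph.dist_eq_one_iff_adj.1 (by omega))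
        (SimpleGraph.dist_eq_one_iff_adj.1 (by omega))
      have := hmin p hp
      rw [SimpleGraph.dist_self] at this
      omega
    · have e₁ := hG.dist_eq_zero_iff.1 (show G.dist p g = 0 by omega)
      have e₂ := hG.dist_eq_zero_iff.1 (show G.dist p g' = 0 by omega)
      exact hne (e₂.symm.trans e₁)

omit hT hC in
-- Induction along a geodesic from `x` to `v`: let `w` be its vertex before `v`, `y'` the partner
-- found for `w`, and `y` a common neighbor of `y'` and `v` at distance 2 from `w`. In the quad
-- through `y'` and `v` the gate of `x` turns out to be `w`, so `y` is two steps farther from `x`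
-- than `w` is.
theorem axiomA5_of_axiomA34 (hThick : IsThick G) (hA : AxiomA34 G) : AxiomA5 G := by
  have key : ∀ n u v, G.dist u v = n + 2 → ∀ x, G.Adj u x → G.dist x v = n + 1 →
      ∃ y, G.Adj v y ∧ G.dist u y = n + 1 ∧ G.dist x y = n + 2 := by
    intro n
    induction n with
    | zero =>
      intro u v huv x hux hxv
      obtain ⟨y, huy, hyv, hxy⟩ := hThick.exists_common_adj hG hD huv hux
        (SimpleGraph.dist_eq_one_iff_adj.1 hxv)
      exact ⟨y, hyv.symm, SimpleGraph.dist_eq_one_iff_adj.2 huy, hxy⟩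
    | succ n ih =>
      intro u v huv x hux hxv
      obtain ⟨w, hwv, hxw⟩ := exists_adj_dist_eq hG hxv
      have hux' : ∀ z, G.dist u z ≤ G.dist x z + 1 := fun z => by
        have := hG.dist_triangle (u := u) (v := x) (w := z)
        have := SimpleGraph.dist_eq_one_iff_adj.2 hux
        omega
      have huw : G.dist u w = n + 2 := by
        have h₁ := dist_le_succ_of_adj hG hwv.symm u
        have h₂ := hux' w
        omega
      obtain ⟨y', hwy', huy', hxy'⟩ := ih u w huw x hux hxw
      have hy'v : G.dist y' v = 2 := by
        have h₁ := dist_le_two hG hwy'.symm hwv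
        have h₂ := hG.dist_triangle (u := u) (v := y') (w := v)
        omega
      obtain ⟨y, hy'y, hyv, hwy⟩ := hThick.exists_common_adj hG hD hy'v hwy'.symm hwv
      obtain ⟨A, hAg, hy'A, hvA, hA2⟩ := hA.exists_quad hG hy'v
      have hne := ne_of_dist_two hy'v
      have hwA : w ∈ A := hAg.mem_of_adj hG hy'A hvA hne hwy' hwv
      have hyA : y ∈ A := hAg.mem_of_adj hG hy'A hvA hne hy'y.symm hyv
      obtain ⟨g, hg, hgate⟩ := hAg.exists_gate x
      obtain ⟨g', hg', hgate'⟩ := hAg.exists_gate u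
      have e₁ := hgate' v hvA
      have e₂ := hgate' y' hy'A
      have e₃ := hA2 g' hg' v hvA
      -- From `u`, the vertex `v` is two farther than `y'`, which the diameter allows only if `y'`
      -- is the gate.
      have hgy' : g' = y' := hG.dist_eq_zero_iff.1 (by omega)
      subst hgy'
      have e₄ := hgate' g hg
      have e₅ := hux' g
      have e₆ := hgate g' hg'
      have e₇ := hgate w hwA
      have e₈ : G.dist g g' = G.dist g' g := G.dist_comm
      -- Since `x` is adjacent to `u`, comparing the two gates bounds the distance from `g` to `y'`
      -- by 1; thus `g` is at least as far from `x` as `w` is.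
      have hgw : g = w := hG.dist_eq_zero_iff.1 (by omega)
      subst hgw
      have e₉ := hgate y hyA
      refine ⟨y, hyv.symm, ?_, by omega⟩
      have h₁ := dist_le_succ_of_adj hG hyv.symm u
      have h₂ := dist_le_succ_of_adj hG hy'y.symm u
      omega
  intro u v huv x hx hux
  rw [mem_interval, SimpleGraph.dist_eq_one_iff_adj.2 hux] at hx
  have hne : u ≠ v := by
    rintro rfl
    rw [SimpleGraph.dist_self] at hx; omega
  have h₁ := hG.pos_dist_of_ne hne
  have h₂ : G.dist u v ≠ 1 := fun h => huv (SimpleGraph.dist_eq_one_iff_adj.1 h)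
  obtain ⟨n, hn⟩ : ∃ n, G.dist u v = n + 2 := ⟨G.dist u v - 2, by omega⟩
  obtain ⟨y, hvy, huy, hxy⟩ := key n u v hn x hux (by omega)
  refine ⟨y, ?_, hvy, by omega, by omega, by omega⟩
  rw [mem_interval, SimpleGraph.dist_eq_one_iff_adj.2 hvy.symm]
  omega

end Quads

theorem isDualPolar_iff {V : Type*} {G : SimpleGraph V} (hG : G.Connected) :
    IsDualPolar G ↔ IsThick G ∧ IsWeaklyModular G ∧ ¬ K4minus.IsIndContained G ∧
      ¬ ContainsIsometric G K33minus := by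
  rw [← diamondFree_iff, ← cubeCornerFree_iff hG]
  constructor
  · rintro ⟨h₁, h₂, h₃⟩
    exact ⟨h₃.isThick hG, fun u => ⟨h₁.triangleCondition hG u, h₂.quadrangleCondition hG u⟩,
      h₁.diamondFree hG, h₂.cubeCornerFree hG⟩
  · rintro ⟨h₁, h₂, h₃, h₄⟩
    have hA := axiomA34_of_weaklyModular hG h₃ (fun u => (h₂ u).1) h₄ (fun u => (h₂ u).2) h₁
    exact ⟨axiomA1_of_triangleCondition hG h₃ fun u => (h₂ u).1, hA,
      axiomA5_of_axiomA34 hG h₃ h₁ hA⟩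

end DualPolar
namespace DualPolar

/-! ### Extending a ball of the cover by one layer -/

section Layers

variable {V α : Type*}

/-- A relation `A` on `α`, with a map `f : α → V` and a level function, that looks like the ball of
radius `n` around `o` in a triangle-square cover of `G` satisfying the triangle and quadrangle
conditions with respect to `o`. -/
structure IsPartialCover (G : SimpleGraph V) (f : α → V) (lev : α → ℕ) (o : α) (n : ℕ)
    (A : α → α → Prop) : Prop where
  symm : ∀ {x y}, A x y → A y x
  hom : ∀ {x y}, A x y → G.Adj (f x) (f y)
  bound : ∀ {x y}, A x y → lev x ≤ n
  lev_le : ∀ {x y}, A x y → lev x ≤ lev y + 1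
  down : ∀ {x y m}, A x y → lev x = m + 1 → ∃ w, A x w ∧ lev w = m
  inj : ∀ {u x y}, A u x → A u y → f x = f y → x = y
  reflect : ∀ {u x y}, A u x → A u y → G.Adj (f x) (f y) → A x y
  -- The vertices of the ball are `o` and the non-isolated elements; only below the last level are
  -- all neighbors required to be lifted.
  surj : ∀ {u z}, (u = o ∨ ∃ y, A u y) → lev u < n → G.Adj (f u) z → ∃ x, A u x ∧ f x = z
  tc : ∀ {x y m}, A x y → lev x = m + 1 → lev y = m + 1 → ∃ w, A x w ∧ A y w ∧ lev w = m
  qc : ∀ {x y z m}, A z x → A z y → x ≠ y → lev z = m + 2 → lev x = m + 1 → lev y = m + 1 →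
    ∃ w, A x w ∧ A y w ∧ lev w = m
  square : ∀ {a b c d}, A a b → lev a < n → lev b < n → A b c → A a d → G.Adj (f c) (f d) → A c d

/-- The pairs `(w, z)` of a vertex `w` on the last level and a neighbor `z` of its image that has no
lift adjacent to `w` yet. -/
def Missing (G : SimpleGraph V) (f : α → V) (lev : α → ℕ) (o : α) (n : ℕ)
    (A : α → α → Prop) (w : α) (z : V) : Prop :=
  (w = o ∨ ∃ y, A w y) ∧ lev w = n ∧ G.Adj (f w) z ∧ ∀ x, A w x → f x ≠ z

/-- The vertices `w` and `w'` on the last level have to be joined to the same new lift of `z`. -/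
def SameLift (G : SimpleGraph V) (f : α → V) (lev : α → ℕ) (o : α) (n : ℕ)
    (A : α → α → Prop) (z : V) (w w' : α) : Prop :=
  w = w' ∨ (Missing G f lev o n A w z ∧ Missing G f lev o n A w' z ∧
    ∃ u, A w u ∧ A w' u ∧ lev u + 1 = n)

/-- The relation `N` joins the last level to new vertices as required by `Missing` and
`SameLift`. -/
structure IsNewLayer (G : SimpleGraph V) (f : α → V) (lev : α → ℕ) (o : α) (n : ℕ)
    (A N : α → α → Prop) : Prop where
  missing : ∀ {w c}, N w c → Missing G f lev o n A w (f c)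
  lev_eq : ∀ {w c}, N w c → lev c = n + 1
  exists_lift : ∀ {w z}, Missing G f lev o n A w z → ∃ c, N w c ∧ f c = z
  unique : ∀ {w c c'}, N w c → N w c' → f c = f c' → c = c'
  sameLift : ∀ {w w' c}, N w c → N w' c → SameLift G f lev o n A (f c) w w'
  of_sameLift : ∀ {w w' c}, N w c → SameLift G f lev o n A (f c) w w' → N w' c

/-- The extension of `A` by a new layer. -/
def extend (G : SimpleGraph V) (f : α → V) (A N : α → α → Prop) (x y : α) : Prop :=
  A x y ∨ N x y ∨ N y x ∨ ((∃ w, N w x ∧ N w y) ∧ G.Adj (f x) (f y))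

variable {G : SimpleGraph V} {f : α → V} {lev : α → ℕ} {o : α} {n : ℕ} {A N : α → α → Prop}

namespace IsPartialCover

variable (P : IsPartialCover G f lev o n A)
include P

theorem bound' {x y : α} (h : A x y) : lev y ≤ n := P.bound (P.symm h)

theorem ne {x y : α} (h : A x y) : x ≠ y := by
  rintro rfl; exact (P.hom h).ne rfl

/-- Otherwise the lift of `z` at `u` would, by `reflect`, be a lift adjacent to `w`. -/
theorem not_adj_down {w u : α} {z : V} (hZ : Missing G f lev o n A w z) (h : A w u)
    (hu : lev u + 1 = n) : ¬ G.Adj (f u) z := by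
  intro hadj
  obtain ⟨x, hux, rfl⟩ := P.surj (Or.inr ⟨w, P.symm h⟩) (by omega) hadj
  exact hZ.2.2.2 x (P.reflect (P.symm h) hux hZ.2.2.1) rfl

theorem not_adj_level (ho : ∀ x, lev x = 0 → x = o) (hD : DiamondFree G) {w w' : α} {z : V}
    (hZ : Missing G f lev o n A w z) (h : A w w') (hw' : lev w' = n) : ¬ G.Adj (f w') z := by
  intro hadj
  have hw := hZ.2.1
  rcases n with _ | m
  · exact P.ne h ((ho w hw).trans (ho w' hw').symm)
  · obtain ⟨u, hwu, hw'u, hu⟩ := P.tc h hw hw'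
    refine P.not_adj_down hZ hwu (by omega) (hD (P.hom h) (P.hom hwu).symm (P.hom hw'u).symm
      hZ.2.2.1.symm hadj.symm ?_)
    exact hZ.2.2.2 u hwu

theorem not_adj_of_missing (ho : ∀ x, lev x = 0 → x = o) (hD : DiamondFree G) {w w' u : α} {z : V}
    (hZ : Missing G f lev o n A w z) (hZ' : Missing G f lev o n A w' z) (h : A w u) (h' : A w' u) :
    ¬ G.Adj (f w) (f w') := fun hadj =>
  P.not_adj_level ho hD hZ (P.reflect (P.symm h) (P.symm h') hadj) hZ'.2.1 hZ'.2.2.1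

theorem exists_lift {y u w : α} {t : V} (hyu : A y u) (huw : A u w) (hy : lev y < n)
    (hu : lev u < n) (hyt : G.Adj (f y) t) (htw : G.Adj t (f w)) :
    ∃ x, A y x ∧ f x = t ∧ A x w := by
  obtain ⟨x, hyx, rfl⟩ := P.surj (Or.inr ⟨u, hyu⟩) hy hyt
  exact ⟨x, hyx, rfl, P.symm (P.square hyu hy hu huw hyx htw.symm)⟩

theorem dist_two (hG : G.Connected) {y u w : α} (hyu : A y u) (huw : A u w)
    (h : lev y + 2 = lev w) : G.dist (f y) (f w) = 2 := by
  refine dist_eq_two hG (P.hom hyu) (P.hom huw) (fun he => ?_) fun hadj => ?_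
  · have := P.inj (P.symm hyu) huw he
    subst this
    omega
  · have := P.lev_le (P.symm (P.reflect (P.symm hyu) huw hadj))
    omega

/-- At distance 1, `z` itself lifts to a neighbor of `w`. At distance 2, the local triangle
condition (LTC) gives `t`, whose lift lies one level below `w` with image adjacent to `z`, against
`not_adj_down`. -/
theorem dist_three (hG : G.Connected) (hT : ∀ u, LocalTriangleCondition G u) {y u w : α} {z : V}
    (hZ : Missing G f lev o n A w z) (hyu : A y u) (huw : A u w) (h : lev y + 2 = n) :
    G.dist (f y) z = 3 := by
  have hw := hZ.2.1
  have hu := P.lev_le (P.symm hyu)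
  have hd := P.dist_two hG hyu huw (by omega)
  have h₁ := dist_le_succ_of_adj hG hZ.2.2.1.symm (f y)
  have h₂ := dist_le_succ_of_adj hG hZ.2.2.1 (f y)
  have h₃ : G.dist (f y) z ≠ 1 := fun h₃ => by
    obtain ⟨x, hyx, hx, hxw⟩ := P.exists_lift hyu huw (by omega) (by omega)
      (SimpleGraph.dist_eq_one_iff_adj.1 h₃) hZ.2.2.1.symm
    exact hZ.2.2.2 x (P.symm hxw) hx
  have h₄ : G.dist (f y) z ≠ 2 := fun h₄ => by
    obtain ⟨t, hty, htw, htz⟩ := hT (f y) (f w) z hZ.2.2.1 hd h₄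
    obtain ⟨x, hyx, rfl, hxw⟩ := P.exists_lift hyu huw (by omega) (by omega) hty.symm htw
    have h₅ := P.lev_le (P.symm hyx)
    have h₆ := P.lev_le (P.symm hxw)
    exact P.not_adj_down hZ (P.symm hxw) (by omega) htz
  omega

/-- If `w'` already had a lift `x` of `z`, then `x` or a vertex below `x` and `w'` could be joined
with `u` by `qc`, giving a vertex two levels below `w` with image within distance 2 of `z`, against
`dist_three`. -/
theorem missing_of_common_adj (ho : ∀ x, lev x = 0 → x = o) (hG : G.Connected)
    (hT : ∀ u, LocalTriangleCondition G u) {w w' u : α} {z : V} (hZ : Missing G f lev o n A w z)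
    (hwu : A w u) (hw'u : A w' u) (hu : lev u + 1 = n) (hw' : lev w' = n)
    (hadj : G.Adj (f w') z) : Missing G f lev o n A w' z := by
  refine ⟨Or.inr ⟨u, hw'u⟩, hw', hadj, fun x hx hxz => ?_⟩
  subst hxz
  -- some vertex two levels below is at distance two from the image of `x`
  suffices h : ∃ x', (x' = x ∨ A x' x) ∧ A w' x' ∧ lev x' + 1 = n by
    obtain ⟨x', hx'x, hw'x', hx'⟩ := h
    have hne : u ≠ x' := by
      rintro rfl
      rcases hx'x with rfl | h
      · exact hZ.2.2.2 _ hwu rfl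
      · exact P.not_adj_down hZ hwu hu (P.hom h)
    rcases h0 : lev u with _ | m
    · exact hne ((ho u h0).trans (ho x' (by omega)).symm)
    obtain ⟨y, huy, hx'y, hy⟩ := P.qc hw'u hw'x' hne (by omega) h0 (by omega)
    have h₁ := P.dist_three hG hT hZ (P.symm huy) (P.symm hwu) (by omega)
    have h₂ := SimpleGraph.dist_eq_one_iff_adj.2 (P.hom (P.symm hx'y))
    rcases hx'x with rfl | h
    · omega
    · have := dist_le_two hG (P.hom (P.symm hx'y)) (P.hom h)
      omega
  have h₁ := P.bound' hx
  have h₂ := P.lev_le hx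
  by_cases h₃ : lev x = n
  · obtain ⟨x', hx', hxx', hl⟩ := P.tc hx (m := lev u) (by omega) (by omega)
    exact ⟨x', Or.inr (P.symm hxx'), hx', by omega⟩
  · exact ⟨x, Or.inl rfl, hx, by omega⟩

/-- Here the local quadrangle condition enters. Below `u` and `u'` there is `y`, with image at
distance 3 from `z` and 2 from the images of `w` and `w''`. The local conditions give a common
neighbor of the three images, and its lift at `y` is a common lower neighbor of `w` and `w''`. -/
theorem sameLift_trans (ho : ∀ x, lev x = 0 → x = o) (hG : G.Connected)
    (hL : IsLocallyWeaklyModular G) {z : V} {w w' w'' : α}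
    (h : SameLift G f lev o n A z w w') (h' : SameLift G f lev o n A z w' w'') :
    SameLift G f lev o n A z w w'' := by
  rcases h with rfl | ⟨hZ, hZ', u, hwu, hw'u, hu⟩
  · exact h'
  rcases h' with rfl | ⟨_, hZ'', u', hw'u', hw''u', hu'⟩
  · exact Or.inr ⟨hZ, hZ', u, hwu, hw'u, hu⟩
  by_cases hne : u = u'
  · subst hne
    exact Or.inr ⟨hZ, hZ'', u, hwu, hw''u', hu⟩
  rcases h0 : lev u with _ | m
  · exact absurd ((ho u h0).trans (ho u' (by omega)).symm) hne
  have hl := hZ'.2.1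
  have hlw := hZ.2.1
  have hlw'' := hZ''.2.1
  obtain ⟨y, huy, hu'y, hy⟩ := P.qc hw'u hw'u' hne (by omega) h0 (by omega)
  have hyz := P.dist_three hG (fun u => (hL u).1) hZ (P.symm huy) (P.symm hwu) (by omega)
  have hyw := P.dist_two hG (P.symm huy) (P.symm hwu) (by omega)
  have hyw'' := P.dist_two hG (P.symm hu'y) (P.symm hw''u') (by omega)
  obtain ⟨t, hty, htw, htw''⟩ : ∃ t, G.Adj t (f y) ∧ G.Adj t (f w) ∧ G.Adj t (f w'') := by
    by_cases he : f w = f w''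
    · exact ⟨f u, P.hom huy, P.hom (P.symm hwu), he ▸ P.hom (P.symm hwu)⟩
    by_cases hadj : G.Adj (f w) (f w'')
    · exact (hL (f y)).1 _ _ hadj hyw hyw''
    · exact (hL (f y)).2 _ _ z hZ.2.2.1.symm hZ''.2.2.1.symm
        (dist_eq_two hG hZ.2.2.1 hZ''.2.2.1.symm he hadj) hyw hyw'' hyz
  obtain ⟨x, hyx, hx, hxw⟩ := P.exists_lift (P.symm huy) (P.symm hwu) (by omega) (by omega)
    hty.symm htw
  obtain ⟨x', hyx', hx', hx'w⟩ := P.exists_lift (P.symm hu'y) (P.symm hw''u') (by omega) (by omega)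
    hty.symm htw''
  obtain rfl := P.inj hyx hyx' (hx.trans hx'.symm)
  have h₁ := P.lev_le (P.symm hyx)
  have h₂ := P.lev_le (P.symm hxw)
  exact Or.inr ⟨hZ, hZ'', x, P.symm hxw, P.symm hx'w, by omega⟩

omit P in
theorem sameLift_symm {z : V} {w w' : α} (h : SameLift G f lev o n A z w w') :
    SameLift G f lev o n A z w' w := by
  rcases h with rfl | ⟨h₁, h₂, u, h₃, h₄, h₅⟩
  · exact Or.inl rfl
  · exact Or.inr ⟨h₂, h₁, u, h₄, h₃, h₅⟩

end IsPartialCover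

namespace IsNewLayer

variable (P : IsPartialCover G f lev o n A) (L : IsNewLayer G f lev o n A N)
include L

omit L in
theorem extend_symm (hs : ∀ {x y}, A x y → A y x) {x y : α} (h : extend G f A N x y) :
    extend G f A N y x := by
  rcases h with h | h | h | ⟨⟨w, h₁, h₂⟩, h⟩
  · exact Or.inl (hs h)
  · exact Or.inr (Or.inr (Or.inl h))
  · exact Or.inr (Or.inl h)
  · exact Or.inr (Or.inr (Or.inr ⟨⟨w, h₂, h₁⟩, h.symm⟩))

theorem lev_left {w c : α} (h : N w c) : lev w = n := (L.missing h).2.1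

theorem extend_old {x y : α} (h : extend G f A N x y) (hx : lev x ≤ n) : A x y ∨ N x y := by
  rcases h with h | h | h | ⟨⟨w, h₁, h₂⟩, h⟩
  · exact Or.inl h
  · exact Or.inr h
  · have := L.lev_eq h
    omega
  · have := L.lev_eq h₁
    omega

theorem extend_inner {x y : α} (h : extend G f A N x y) (hx : lev x < n) : A x y := by
  rcases L.extend_old h hx.le with h | h
  · exact h
  · have := L.lev_left h
    omega

theorem extend_both_old {x y : α} (h : extend G f A N x y) (hx : lev x ≤ n) (hy : lev y ≤ n) :
    A x y := by
  rcases L.extend_old h hx with h | h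
  · exact h
  · have := L.lev_eq h
    omega

include P

theorem extend_new {x y : α} (h : extend G f A N x y) (hx : lev x = n + 1) :
    N y x ∨ ((∃ w, N w x ∧ N w y) ∧ G.Adj (f x) (f y)) := by
  rcases h with h | h | h
  · have := P.bound h
    omega
  · have := L.lev_left h
    omega
  · exact h

theorem extend_bound {x y : α} (h : extend G f A N x y) : lev x ≤ n + 1 := by
  rcases h with h | h | h | ⟨⟨w, h₁, h₂⟩, h⟩
  · have := P.bound h
    omega
  · have := L.lev_left h
    omega
  · have := L.lev_eq h
    omega
  · have := L.lev_eq h₁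
    omega

theorem extend_hom {x y : α} (h : extend G f A N x y) : G.Adj (f x) (f y) := by
  rcases h with h | h | h | ⟨⟨w, h₁, h₂⟩, h⟩
  · exact P.hom h
  · exact (L.missing h).2.2.1
  · exact (L.missing h).2.2.1.symm
  · exact h

theorem extend_lev_le {x y : α} (h : extend G f A N x y) : lev x ≤ lev y + 1 := by
  rcases h with h | h | h | ⟨⟨w, h₁, h₂⟩, h⟩
  · exact P.lev_le h
  · have := L.lev_left h
    have := L.lev_eq h
    omega
  · have := L.lev_left h
    have := L.lev_eq h
    omega
  · have := L.lev_eq h₁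
    have := L.lev_eq h₂
    omega

theorem extend_down {x y : α} {m : ℕ} (h : extend G f A N x y) (hx : lev x = m + 1) (ho : lev o = 0) :
    ∃ w, extend G f A N x w ∧ lev w = m := by
  have hb := L.extend_bound P h
  by_cases hn : lev x ≤ n
  · have key : ∃ y, A x y := by
      rcases L.extend_old h hn with h | h
      · exact ⟨y, h⟩
      · rcases (L.missing h).1 with rfl | h
        · omega
        · exact h
    obtain ⟨y, hy⟩ := key
    obtain ⟨w, hw, hl⟩ := P.down hy hx
    exact ⟨w, Or.inl hw, hl⟩
  · rcases L.extend_new P h (by omega) with h | ⟨⟨w, h₁, h₂⟩, h⟩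
    · have := L.lev_left h
      exact ⟨y, Or.inr (Or.inr (Or.inl h)), by omega⟩
    · have := L.lev_left h₁
      exact ⟨w, Or.inr (Or.inr (Or.inl h₁)), by omega⟩

variable (ho : ∀ x, lev x = 0 → x = o) (hG : G.Connected) (hD : DiamondFree G)
include ho hD

/-- The old neighbors of a new vertex pairwise share a lower neighbor, so local injectivity and
`not_adj_of_missing` separate their images. -/
theorem eq_or_not_adj {w w' c : α} (h : N w c) (h' : N w' c) :
    w = w' ∨ (f w ≠ f w' ∧ ¬ G.Adj (f w) (f w')) := by
  rcases L.sameLift h h' with h₁ | ⟨hZ, hZ', u, hwu, hw'u, -⟩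
  · exact Or.inl h₁
  · by_cases hne : w = w'
    · exact Or.inl hne
    · exact Or.inr ⟨fun he => hne (P.inj (P.symm hwu) (P.symm hw'u) he),
        P.not_adj_of_missing ho hD hZ hZ' hwu hw'u⟩

/-- Two old vertices joined to a new vertex coincide if their images have another common neighbor
adjacent to the image of the new vertex. -/
theorem eq_of_common_adj {w w' c : α} {z : V} (h : N w c) (h' : N w' c) (hz : G.Adj (f c) z)
    (hwz : G.Adj (f w) z) (hw'z : G.Adj (f w') z) : w = w' := by
  rcases L.eq_or_not_adj P ho hD h h' with h₁ | ⟨h₁, h₂⟩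
  · exact h₁
  · exact absurd (hD hz (L.missing h).2.2.1 hwz (L.missing h').2.2.1 hw'z h₁) h₂

theorem extend_inj {u x y : α} (hx : extend G f A N u x) (hy : extend G f A N u y)
    (he : f x = f y) : x = y := by
  by_cases hu : lev u ≤ n
  · rcases L.extend_old hx hu with hx | hx <;> rcases L.extend_old hy hu with hy | hy
    · exact P.inj hx hy he
    · exact absurd he ((L.missing hy).2.2.2 x hx)
    · exact absurd he.symm ((L.missing hx).2.2.2 y hy)
    · exact L.unique hx hy he
  · have hu' : lev u = n + 1 := by
      have := L.extend_bound P hx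
      omega
    have mixed : ∀ {x y}, N x u → ((∃ w, N w u ∧ N w y) ∧ G.Adj (f u) (f y)) → f x ≠ f y := by
      rintro x y hx ⟨⟨w, hw, hwy⟩, -⟩ he
      have hadj := (L.missing hwy).2.2.1
      rw [← he] at hadj
      rcases L.eq_or_not_adj P ho hD hx hw with rfl | ⟨-, h⟩
      · exact hadj.ne rfl
      · exact h hadj.symm
    rcases L.extend_new P hx hu' with hx | hx <;> rcases L.extend_new P hy hu' with hy | hy
    · rcases L.eq_or_not_adj P ho hD hx hy with h | h
      · exact h
      · exact absurd he h.1
    · exact absurd he (mixed hx hy)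
    · exact absurd he.symm (mixed hy hx)
    · obtain ⟨⟨w, hw, hwx⟩, hux⟩ := hx
      obtain ⟨⟨w', hw', hw'y⟩, huy⟩ := hy
      obtain rfl := L.eq_of_common_adj P ho hD hw hw' hux (L.missing hwx).2.2.1
        (he ▸ (L.missing hw'y).2.2.1)
      exact L.unique hwx hw'y he

theorem extend_reflect {u x y : α} (hx : extend G f A N u x) (hy : extend G f A N u y)
    (hadj : G.Adj (f x) (f y)) : extend G f A N x y := by
  by_cases hu : lev u ≤ n
  · have mixed : ∀ {x y}, A u x → N u y → ¬ G.Adj (f x) (f y) := by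
      intro x y hx hy hadj
      have h₁ := P.lev_le hx
      have h₂ := P.bound' hx
      have h₃ := L.lev_left hy
      by_cases h₄ : lev x = n
      · exact P.not_adj_level ho hD (L.missing hy) hx h₄ hadj
      · exact P.not_adj_down (L.missing hy) hx (by omega) hadj
    rcases L.extend_old hx hu with hx | hx <;> rcases L.extend_old hy hu with hy | hy
    · exact Or.inl (P.reflect hx hy hadj)
    · exact absurd hadj (mixed hx hy)
    · exact absurd hadj.symm (mixed hy hx)
    · exact Or.inr (Or.inr (Or.inr ⟨⟨u, hx, hy⟩, hadj⟩))
  · have hu' : lev u = n + 1 := by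
      have := L.extend_bound P hx
      omega
    have mixed : ∀ {x y}, N x u → ((∃ w, N w u ∧ N w y) ∧ G.Adj (f u) (f y)) →
        G.Adj (f x) (f y) → N x y := by
      rintro x y hx ⟨⟨w, hw, hwy⟩, huy⟩ hadj
      obtain rfl := L.eq_of_common_adj P ho hD hx hw huy hadj (L.missing hwy).2.2.1
      exact hwy
    have hx₀ := hx
    have hy₀ := hy
    rcases L.extend_new P hx hu' with hx | hx <;> rcases L.extend_new P hy hu' with hy | hy
    · rcases L.eq_or_not_adj P ho hD hx hy with rfl | h
      · exact absurd rfl hadj.ne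
      · exact absurd hadj h.2
    · exact Or.inr (Or.inl (mixed hx hy hadj))
    · exact Or.inr (Or.inr (Or.inl (mixed hy hx hadj.symm)))
    · obtain ⟨⟨w, hw, hwx⟩, hux⟩ := hx
      obtain ⟨⟨w', hw', hw'y⟩, huy⟩ := hy
      have hwu : extend G f A N u w := Or.inr (Or.inr (Or.inl hw))
      have hwy : G.Adj (f w) (f y) := by
        -- The images of `w` and `y` both see the edge between those of `u` and `x`, hence are
        -- adjacent; this identifies the old neighbors `w` and `w'`.
        refine hD hux (L.missing hw).2.2.1 (L.missing hwx).2.2.1 huy.symm hadj.symm fun he => ?_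
        have h₁ := L.extend_inj P ho hD hwu hy₀ he
        have h₂ := L.lev_left hw
        have h₃ := L.lev_eq hw'y
        rw [h₁] at h₂
        omega
      obtain rfl := L.eq_of_common_adj P ho hD hw hw' huy hwy (L.missing hw'y).2.2.1
      exact Or.inr (Or.inr (Or.inr ⟨⟨w, hwx, hw'y⟩, hadj⟩))

omit ho hD in
theorem extend_surj {u : α} {z : V} (hm : u = o ∨ ∃ y, extend G f A N u y) (hu : lev u < n + 1)
    (hadj : G.Adj (f u) z) : ∃ x, extend G f A N u x ∧ f x = z := by
  have hm' : u = o ∨ ∃ y, A u y := by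
    rcases hm with hm | ⟨y, hy⟩
    · exact Or.inl hm
    · rcases L.extend_old hy (by omega) with h | h
      · exact Or.inr ⟨y, h⟩
      · exact (L.missing h).1
  by_cases hn : lev u < n
  · obtain ⟨x, hx, he⟩ := P.surj hm' hn hadj
    exact ⟨x, Or.inl hx, he⟩
  · by_cases h : ∃ x, A u x ∧ f x = z
    · obtain ⟨x, hx, he⟩ := h
      exact ⟨x, Or.inl hx, he⟩
    · push Not at h
      obtain ⟨c, hc, he⟩ := L.exists_lift ⟨hm', by omega, hadj, h⟩
      exact ⟨c, Or.inr (Or.inl hc), he⟩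

variable (hT : ∀ u, LocalTriangleCondition G u)
include hG hT

/-- The level of `d` decides. Two below `n`, `c` is reached by lifting from `d`. One below, a vertex
`y` under `a` and `d` reduces the square to inner ones, with LTC at the image of `y` if necessary.
On level `n`, an old `c` is reached through `qc` under `b`, while for a new `c` the vertices `b` and
`d` share `a` and therefore the same new lift. -/
theorem extend_square_of_lev {a b c d : α} (hab : A a b) (ha : lev a + 1 = n) (hb : lev b = n)
    (hbc : extend G f A N b c) (had : extend G f A N a d) (hcd : G.Adj (f c) (f d)) :
    extend G f A N c d := by
  have sy : ∀ {x y}, extend G f A N x y → extend G f A N y x := extend_symm P.symm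
  have hba := P.symm hab
  have had := L.extend_inner had (by omega)
  have hbc₀ : ∀ {t}, A t b → f t = f c → t = c := fun h he =>
    L.extend_inj P ho hD (Or.inl (P.symm h)) hbc he
  by_cases hac : G.Adj (f a) (f c)
  · exact L.extend_reflect P ho hD (L.extend_reflect P ho hD (Or.inl hba) hbc hac) (Or.inl had) hcd
  by_cases hac' : f a = f c
  · rw [← hbc₀ hab hac']; exact Or.inl had
  have hd₁ := P.lev_le had
  have hd₂ := P.lev_le (P.symm had)
  have hcase : lev d + 2 = n ∨ lev d + 1 = n ∨ lev d = n := by omega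
  rcases hcase with hd | hd | hd
  · obtain ⟨t, hdt, ht, htb⟩ := P.exists_lift (P.symm had) hab (by omega) (by omega) hcd.symm
      (L.extend_hom P hbc).symm
    rw [← hbc₀ htb ht]
    exact Or.inl (P.symm hdt)
  · rcases h0 : lev a with _ | m
    · exact absurd ((ho a h0).trans (ho d (by omega)).symm) (P.ne had)
    obtain ⟨y, hay, hdy, hy⟩ := P.tc had h0 (by omega)
    have hyb := P.dist_two hG (P.symm hay) hab (by omega)
    have hyc := dist_le_two hG (P.hom (P.symm hdy)) hcd.symm
    have hyc0 : G.dist (f y) (f c) ≠ 0 := fun h => by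
      rw [hG.dist_eq_zero_iff] at h
      exact not_adj_of_dist_two hyb (h ▸ (L.extend_hom P hbc).symm)
    by_cases hyc1 : G.dist (f y) (f c) = 1
    · obtain ⟨t, hyt, ht, htb⟩ := P.exists_lift (P.symm hay) hab (by omega) (by omega)
        (SimpleGraph.dist_eq_one_iff_adj.1 hyc1) (L.extend_hom P hbc).symm
      obtain rfl := hbc₀ htb ht
      exact Or.inl (P.reflect hyt (P.symm hdy) hcd)
    · obtain ⟨t, hty, htb, htc⟩ := hT (f y) (f b) (f c) (L.extend_hom P hbc) hyb (by omega)
      obtain ⟨x, hyx, rfl, hxb⟩ := P.exists_lift (P.symm hay) hab (by omega) (by omega)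
        hty.symm htb
      have hx := P.lev_le (P.symm hyx)
      have hxc := L.extend_inner (L.extend_reflect P ho hD (Or.inl (P.symm hxb)) hbc htc)
        (by omega)
      exact Or.inl (P.square hyx (by omega) (by omega) hxc (P.symm hdy) hcd)
  · rcases L.extend_old hbc hb.le with hbc | hbc
    · have hc₁ := P.lev_le hbc
      have hc₂ := P.bound' hbc
      obtain ⟨x, hx, hbx, hxl⟩ : ∃ x, (x = c ∨ A x c ∧ lev c = n) ∧ A b x ∧ lev x + 1 = n := by
        by_cases hc : lev c = n
        · obtain ⟨x, hbx, hcx, hxl⟩ := P.tc hbc (m := lev a) (by omega) (by omega)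
          exact ⟨x, Or.inr ⟨P.symm hcx, hc⟩, hbx, by omega⟩
        · exact ⟨c, Or.inl rfl, hbc, by omega⟩
      have hne : a ≠ x := by
        rintro rfl
        rcases hx with rfl | hx
        · exact hac' rfl
        · exact hac (P.hom hx.1)
      rcases h0 : lev a with _ | m
      · exact absurd ((ho a h0).trans (ho x (by omega)).symm) hne
      obtain ⟨y, hay, hxy, hy⟩ := P.qc hba hbx hne (by omega) h0 (by omega)
      rcases hx with rfl | hx
      · obtain ⟨t, hyt, ht, htd⟩ := P.exists_lift (P.symm hay) had (by omega) (by omega)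
          (P.hom (P.symm hxy)) hcd
        rw [P.inj hyt (P.symm hxy) ht] at htd
        exact Or.inl htd
      · obtain ⟨hx, hc⟩ := hx
        have hyd := P.dist_two hG (P.symm hay) had (by omega)
        have hyc := P.dist_two hG (P.symm hxy) hx (by omega)
        obtain ⟨t, hty, htc, htd⟩ := hT (f y) (f c) (f d) hcd hyc hyd
        obtain ⟨t₁, hyt₁, ht₁, ht₁c⟩ := P.exists_lift (P.symm hxy) hx (by omega) (by omega)
          hty.symm htc
        obtain ⟨t₂, hyt₂, ht₂, ht₂d⟩ := P.exists_lift (P.symm hay) had (by omega) (by omega)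
          hty.symm htd
        obtain rfl := P.inj hyt₁ hyt₂ (ht₁.trans ht₂.symm)
        exact Or.inl (P.reflect ht₁c ht₂d hcd)
    · have hZ := L.missing hbc
      have hZ' := P.missing_of_common_adj ho hG hT hZ hba (P.symm had) ha hd hcd.symm
      exact Or.inr (Or.inr (Or.inl (L.of_sameLift hbc
        (Or.inr ⟨hZ, hZ', a, hba, P.symm had, ha⟩))))

theorem extend_square {a b c d : α} (hab : extend G f A N a b) (ha : lev a < n + 1)
    (hb : lev b < n + 1) (hbc : extend G f A N b c) (had : extend G f A N a d)
    (hcd : G.Adj (f c) (f d)) : extend G f A N c d := by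
  have sy : ∀ {x y}, extend G f A N x y → extend G f A N y x := extend_symm P.symm
  have hab₀ := hab
  have hab := L.extend_both_old hab (by omega) (by omega)
  have hl₁ := P.lev_le hab
  have hl₂ := P.lev_le (P.symm hab)
  have hcase : (lev a < n ∧ lev b < n) ∨ (lev a + 1 = n ∧ lev b = n) ∨
    (lev b + 1 = n ∧ lev a = n) ∨ (lev a = n ∧ lev b = n) := by omega
  rcases hcase with ⟨h₁, h₂⟩ | ⟨h₁, h₂⟩ | ⟨h₁, h₂⟩ | ⟨h₁, h₂⟩
  · exact Or.inl (P.square hab h₁ h₂ (L.extend_inner hbc h₂) (L.extend_inner had h₁) hcd)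
  · exact L.extend_square_of_lev P ho hG hD hT hab h₁ h₂ hbc had hcd
  · exact sy (L.extend_square_of_lev P ho hG hD hT (P.symm hab) h₁ h₂ had hbc hcd.symm)
  · by_cases hac : G.Adj (f a) (f c)
    · exact L.extend_reflect P ho hD (L.extend_reflect P ho hD (sy hab₀) hbc hac) had hcd
    by_cases hac' : f a = f c
    · rw [← L.extend_inj P ho hD (sy hab₀) hbc hac']; exact had
    by_cases hbd : G.Adj (f b) (f d)
    · exact L.extend_reflect P ho hD hbc (L.extend_reflect P ho hD hab₀ had hbd) hcd
    by_cases hbd' : f b = f d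
    · rw [← L.extend_inj P ho hD hab₀ had hbd']; exact sy hbc
    obtain _ | m := n
    · exact absurd ((ho a h₁).trans (ho b h₂).symm) (P.ne hab)
    -- Both `a` and `b` are on the last level. With `x` below them, LTC at its image gives a common
    -- neighbor of the images of `x`, `c`, `d`; lifting it to `s` splits the square into two that
    -- have an edge between the last two levels.
    obtain ⟨x, hax, hbx, hx⟩ := P.tc hab h₁ h₂
    have far : ∀ {a b c}, A a b → A a x → A b x → G.Adj (f b) (f c) → f a ≠ f c →
        ¬ G.Adj (f a) (f c) → G.dist (f x) (f c) = 2 := by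
      intro a b c hab hax hbx hbc hne hac
      refine dist_eq_two hG (P.hom hbx).symm hbc (fun he => hac (he ▸ P.hom hax)) fun h => ?_
      exact hac (hD (P.hom hbx) (P.hom hab) (P.hom hax) hbc.symm h.symm hne)
    have hxc := far hab hax hbx (L.extend_hom P hbc) hac' hac
    have hxd := far (P.symm hab) hbx hax (L.extend_hom P had) hbd' hbd
    obtain ⟨t, htx, htc, htd⟩ := hT (f x) (f c) (f d) hcd hxc hxd
    obtain ⟨s, hxs, rfl⟩ := P.surj (Or.inr ⟨a, P.symm hax⟩) (by omega) htx.symm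
    have h₃ := L.extend_square_of_lev P ho hG hD hT (P.symm hbx) (by omega) h₂ hbc (Or.inl hxs)
      htc.symm
    have h₄ := L.extend_square_of_lev P ho hG hD hT (P.symm hax) (by omega) h₁ had (Or.inl hxs)
      htd.symm
    exact L.extend_reflect P ho hD (sy h₃) (sy h₄) hcd

/-- On the new level TC and QC hold by construction: adjacent new vertices share an old neighbor,
and distinct old neighbors of one new vertex share a lower neighbor. -/
theorem isPartialCover_extend (ho' : lev o = 0) :
    IsPartialCover G f lev o (n + 1) (extend G f A N) where
  symm := extend_symm P.symm
  hom := L.extend_hom P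
  bound := L.extend_bound P
  lev_le := L.extend_lev_le P
  down := fun h hx => L.extend_down P h hx ho'
  inj := L.extend_inj P ho hD
  reflect := L.extend_reflect P ho hD
  surj := L.extend_surj P
  tc := by
    intro x y m h hx hy
    by_cases hm : m + 1 ≤ n
    · obtain ⟨w, hxw, hyw, hw⟩ := P.tc (L.extend_both_old h (by omega) (by omega)) hx hy
      exact ⟨w, Or.inl hxw, Or.inl hyw, hw⟩
    · have hb := L.extend_bound P h
      rcases L.extend_new P h (by omega) with h | ⟨⟨w, h₁, h₂⟩, h⟩
      · have := L.lev_left h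
        omega
      · have := L.lev_left h₁
        exact ⟨w, Or.inr (Or.inr (Or.inl h₁)), Or.inr (Or.inr (Or.inl h₂)), by omega⟩
  qc := by
    intro x y z m hx hy hne hz hlx hly
    by_cases hm : m + 2 ≤ n
    · obtain ⟨w, hxw, hyw, hw⟩ := P.qc (L.extend_both_old hx (by omega) (by omega))
        (L.extend_both_old hy (by omega) (by omega)) hne hz hlx hly
      exact ⟨w, Or.inl hxw, Or.inl hyw, hw⟩
    · have hb := L.extend_bound P hx
      have key : ∀ {x}, extend G f A N z x → lev x = m + 1 → N x z := by
        intro x h hx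
        rcases L.extend_new P h (by omega) with h | ⟨⟨w, h₁, h₂⟩, h⟩
        · exact h
        · have := L.lev_eq h₂
          omega
      rcases L.sameLift (key hx hlx) (key hy hly) with h | ⟨-, -, w, hxw, hyw, hw⟩
      · exact absurd h hne
      · exact ⟨w, Or.inl hxw, Or.inl hyw, by omega⟩
  square := L.extend_square P ho hG hD hT

end IsNewLayer

end Layers
end DualPolar
namespace DualPolar

/-! ### The cover as a union of balls -/

section Cover

variable {V : Type*}

/-- A triangle-square cover `A` of `G`, on the vertices that are `o` or not isolated in `A`,
satisfying the triangle and quadrangle conditions with respect to `o`; the function `lev` is the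
distance from `o`. -/
structure IsLayeredCover {α : Type*} (G : SimpleGraph V) (f : α → V) (lev : α → ℕ) (o : α)
    (A : α → α → Prop) : Prop where
  symm : ∀ {x y}, A x y → A y x
  hom : ∀ {x y}, A x y → G.Adj (f x) (f y)
  lev_le : ∀ {x y}, A x y → lev x ≤ lev y + 1
  down : ∀ {x y m}, A x y → lev x = m + 1 → ∃ w, A x w ∧ lev w = m
  inj : ∀ {u x y}, A u x → A u y → f x = f y → x = y
  reflect : ∀ {u x y}, A u x → A u y → G.Adj (f x) (f y) → A x y
  surj : ∀ {u z}, (u = o ∨ ∃ y, A u y) → G.Adj (f u) z → ∃ x, A u x ∧ f x = z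
  tc : ∀ {x y m}, A x y → lev x = m + 1 → lev y = m + 1 → ∃ w, A x w ∧ A y w ∧ lev w = m
  qc : ∀ {x y z m}, A z x → A z y → x ≠ y → lev z = m + 2 → lev x = m + 1 → lev y = m + 1 →
    ∃ w, A x w ∧ A y w ∧ lev w = m
  square : ∀ {a b c d}, A a b → A b c → A a d → G.Adj (f c) (f d) → A c d

/-- The setoid of `SameLift`. -/
def sameLiftSetoid {α : Type*} {G : SimpleGraph V} {f : α → V} {lev : α → ℕ} {o : α} {n : ℕ}
    {A : α → α → Prop} (P : IsPartialCover G f lev o n A) (ho : ∀ x, lev x = 0 → x = o)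
    (hG : G.Connected) (hL : IsLocallyWeaklyModular G) (z : V) : Setoid α where
  r := SameLift G f lev o n A z
  iseqv := ⟨fun _ => Or.inl rfl, IsPartialCover.sameLift_symm, P.sameLift_trans ho hG hL⟩

variable {G : SimpleGraph V} (hG : G.Connected) (hD : DiamondFree G)
  (hL : IsLocallyWeaklyModular G) (v : V)
include hG hL

/-- Lists provide room for all layers: a new lift of `z` is `z` prepended to a representative of its
`SameLift` class. The length is the level, the head is the image, and the default `v` is the image
of the base point `[]`. -/
theorem exists_newLayer {n : ℕ} {A : List V → List V → Prop}
    (P : IsPartialCover G (List.headD · v) List.length [] n A) :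
    ∃ N, IsNewLayer G (List.headD · v) List.length [] n A N := by
  have ho : ∀ x : List V, x.length = 0 → x = [] := fun x => List.length_eq_zero_iff.1
  let S := sameLiftSetoid P ho hG hL
  let rep : V → List V → List V := fun z w => (Quotient.mk (S z) w).out
  have hrep : ∀ z w, SameLift G (List.headD · v) List.length [] n A z (rep z w) w := fun z w =>
    Quotient.exact (s := S z) (Quotient.out_eq _)
  have hrep' : ∀ {z w w'}, SameLift G (List.headD · v) List.length [] n A z w w' →
      rep z w = rep z w' := fun {z w w'} h => congrArg Quotient.out (Quotient.sound (s := S z) h)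
  refine ⟨fun w c => ∃ z, Missing G (List.headD · v) List.length [] n A w z ∧ c = z :: rep z w,
    ?_, ?_, ?_, ?_, ?_, ?_⟩
  · rintro w _ ⟨z, hz, rfl⟩
    exact hz
  · rintro w _ ⟨z, hz, rfl⟩
    rw [List.length_cons]
    rcases hrep z w with h | h
    · rw [h, hz.2.1]
    · rw [h.1.2.1]
  · intro w z hz
    exact ⟨_, ⟨z, hz, rfl⟩, rfl⟩
  · rintro w _ _ ⟨z, hz, rfl⟩ ⟨z', hz', rfl⟩ h
    obtain rfl : z = z' := h
    rfl
  · rintro w w' _ ⟨z, hz, rfl⟩ ⟨z', hz', h⟩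
    obtain ⟨rfl, h⟩ := List.cons.inj h
    exact P.sameLift_trans ho hG hL (IsPartialCover.sameLift_symm (hrep z w)) (h ▸ hrep z w')
  · rintro w w' _ ⟨z, hz, rfl⟩ h
    have h : SameLift G (List.headD · v) List.length [] n A z w w' := h
    refine ⟨z, ?_, by rw [hrep' h]⟩
    rcases h with rfl | h
    · exact hz
    · exact h.2.1

include hD

theorem exists_layeredCover :
    ∃ A, IsLayeredCover G (List.headD · v) List.length [] A := by
  have ho : ∀ x : List V, x.length = 0 → x = [] := fun x => List.length_eq_zero_iff.1
  have step : ∀ n A, IsPartialCover G (List.headD · v) List.length [] n A → ∃ A',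
      IsPartialCover G (List.headD · v) List.length [] (n + 1) A' ∧ (∀ x y, A x y → A' x y) ∧
      ∀ x y : List V, A' x y → x.length ≤ n → y.length ≤ n → A x y := by
    intro n A P
    obtain ⟨N, L⟩ := exists_newLayer hG hL v P
    exact ⟨_, L.isPartialCover_extend P ho hG hD (fun u => (hL u).1) rfl, fun x y h => Or.inl h,
      fun x y h hx hy => L.extend_both_old h hx hy⟩
  -- The ball of radius 0 is the base point alone, so nothing is related.
  have base : IsPartialCover G (List.headD · v) List.length [] 0 fun _ _ => False :=
    ⟨id, False.elim, False.elim, False.elim, fun h => h.elim, False.elim, False.elim,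
      fun _ h => absurd h (Nat.not_lt_zero _), False.elim, False.elim, False.elim⟩
  let s : ∀ n, {A // IsPartialCover G (List.headD · v) List.length [] n A} := fun n =>
    Nat.rec ⟨_, base⟩ (fun n A => ⟨_, (step n A.1 A.2).choose_spec.1⟩) n
  have hs : ∀ n x y, (s n).1 x y → (s (n + 1)).1 x y := fun n =>
    (step n (s n).1 (s n).2).choose_spec.2.1
  have hmono : ∀ {n m x y}, n ≤ m → (s n).1 x y → (s m).1 x y := fun {n m x y} hnm h => by
    induction hnm with
    | refl => exact h
    | step _ ih => exact hs _ _ _ ih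
  let A : List V → List V → Prop := fun x y => ∃ n, (s n).1 x y
  have two : ∀ {a b c d}, A a b → A c d → ∃ n, (s n).1 a b ∧ (s n).1 c d := by
    rintro a b c d ⟨n, h⟩ ⟨m, h'⟩
    exact ⟨max n m, hmono (le_max_left _ _) h, hmono (le_max_right _ _) h'⟩
  refine ⟨A, ?_, ?_, ?_, ?_, ?_, ?_, ?_, ?_, ?_, ?_⟩
  · rintro x y ⟨n, h⟩
    exact ⟨n, (s n).2.symm h⟩
  · rintro x y ⟨n, h⟩
    exact (s n).2.hom h
  · rintro x y ⟨n, h⟩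
    exact (s n).2.lev_le h
  · rintro x y m ⟨n, h⟩ hm
    obtain ⟨w, hw, hl⟩ := (s n).2.down h hm
    exact ⟨w, ⟨n, hw⟩, hl⟩
  · intro u x y h h' he
    obtain ⟨n, h, h'⟩ := two h h'
    exact (s n).2.inj h h' he
  · intro u x y h h' he
    obtain ⟨n, h, h'⟩ := two h h'
    exact ⟨n, (s n).2.reflect h h' he⟩
  · intro u z h hadj
    obtain ⟨n, hn, h⟩ : ∃ n, u.length < n ∧ (u = [] ∨ ∃ y, (s n).1 u y) := by
      rcases h with h | ⟨y, m, h⟩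
      · exact ⟨_, Nat.lt_succ_self _, Or.inl h⟩
      · exact ⟨max m (u.length + 1), by omega, Or.inr ⟨y, hmono (le_max_left _ _) h⟩⟩
    obtain ⟨x, hx, he⟩ := (s n).2.surj h hn hadj
    exact ⟨x, ⟨n, hx⟩, he⟩
  · rintro x y m ⟨n, h⟩ hx hy
    obtain ⟨w, hxw, hyw, hw⟩ := (s n).2.tc h hx hy
    exact ⟨w, ⟨n, hxw⟩, ⟨n, hyw⟩, hw⟩
  · intro x y z m h h' hne hz hx hy
    obtain ⟨n, h, h'⟩ := two h h'
    obtain ⟨w, hxw, hyw, hw⟩ := (s n).2.qc h h' hne hz hx hy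
    exact ⟨w, ⟨n, hxw⟩, ⟨n, hyw⟩, hw⟩
  · rintro a b c d ⟨n₁, h₁⟩ ⟨n₂, h₂⟩ ⟨n₃, h₃⟩ hadj
    -- The lengths plus one put `a` and `b` strictly below the last level.
    let n := max (max n₁ n₂) (max n₃ (max (a.length + 1) (b.length + 1)))
    exact ⟨n, (s n).2.square (hmono (by omega) h₁) (by omega) (by omega) (hmono (by omega) h₂)
      (hmono (by omega) h₃) hadj⟩

end Cover

/-! ### Descent of TC and QC along a section -/

section Descent

variable {V α : Type*} {G : SimpleGraph V} {f : α → V} {lev : α → ℕ} {o : α} {A : α → α → Prop}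

/-- If a layered cover has a section through its base point, then `G` satisfies the triangle and
quadrangle conditions with respect to the image of the base point. -/
theorem IsLayeredCover.conditions (hG : G.Connected) (P : IsLayeredCover G f lev o A)
    (ho : lev o = 0) (ho' : ∀ x, lev x = 0 → x = o) (s : V → α) (hs : ∀ v, f (s v) = v)
    (hso : s (f o) = o) (hadj : ∀ u v, G.Adj u v → A (s u) (s v)) :
    TriangleCondition G (f o) ∧ QuadrangleCondition G (f o) := by
  -- The image of the section contains every `A`-neighbor of its elements, by local injectivity.
  have hsection : ∀ {u x}, A (s u) x → s (f x) = x := fun {u x} h => by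
    have h₁ := P.hom h
    rw [hs] at h₁
    exact P.inj (hadj u (f x) h₁) h (hs _)
  have hle : ∀ n v, G.dist (f o) v = n → lev (s v) ≤ n := by
    intro n
    induction n with
    | zero =>
      intro v hv
      rw [hG.dist_eq_zero_iff] at hv
      rw [← hv, hso, ho]
    | succ n ih =>
      intro v hv
      obtain ⟨w, hwv, hw⟩ := exists_adj_dist_eq hG hv
      have h₁ := P.lev_le (hadj v w hwv.symm)
      have h₂ := ih w hw
      omega
  have hge : ∀ n v, lev (s v) = n → G.dist (f o) v ≤ n := by
    intro n
    induction n with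
    | zero =>
      intro v hv
      rw [← ho' _ hv, hs, SimpleGraph.dist_self]
    | succ n ih =>
      intro v hv
      have hne : f o ≠ v := by
        rintro rfl
        rw [hso, ho] at hv; omega
      obtain ⟨m, hm⟩ : ∃ m, G.dist (f o) v = m + 1 :=
        ⟨G.dist (f o) v - 1, by have := hG.pos_dist_of_ne hne; omega⟩
      obtain ⟨w, hwv, -⟩ := exists_adj_dist_eq hG hm
      obtain ⟨x, hx, hl⟩ := P.down (hadj v w hwv.symm) hv
      have h₁ := ih (f x) (by rw [hsection hx, hl])
      have h₂ := P.hom hx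
      rw [hs] at h₂
      have h₃ := dist_le_succ_of_adj hG h₂ (f o)
      omega
  -- Edges change levels by at most one, and `down` descends inside the section; so the level is the
  -- distance from the base point.
  have hlev : ∀ v, lev (s v) = G.dist (f o) v := fun v => le_antisymm (hle _ v rfl) (hge _ v rfl)
  have back : ∀ {u x m}, A (s u) x → lev x = m → G.Adj (f x) u ∧ G.dist (f o) (f x) = m := by
    intro u x m h hl
    have h₁ := P.hom h
    rw [hs] at h₁
    exact ⟨h₁.symm, by rw [← hlev, hsection h, hl]⟩
  constructor
  · intro v w hvw h1 hd
    obtain ⟨m, hm⟩ : ∃ m, G.dist (f o) v = m + 1 := ⟨G.dist (f o) v - 1, by omega⟩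
    obtain ⟨x, hvx, hwx, hx⟩ := P.tc (hadj v w (SimpleGraph.dist_eq_one_iff_adj.1 hvw))
      ((hlev v).trans hm) ((hlev w).trans (hd ▸ hm))
    have h₁ := back hvx hx
    exact ⟨f x, h₁.1, (back hwx hx).1, by rw [h₁.2, hm]⟩
  · intro v w z hvz hwz hvw h2 hd hz
    obtain ⟨m, hm⟩ : ∃ m, G.dist (f o) v = m + 1 := ⟨G.dist (f o) v - 1, by omega⟩
    have hne : s v ≠ s w := fun h => ne_of_dist_two hvw (by rw [← hs v, h, hs])
    obtain ⟨x, hvx, hwx, hx⟩ := P.qc (hadj z v (SimpleGraph.dist_eq_one_iff_adj.1 hvz).symm)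
      (hadj z w (SimpleGraph.dist_eq_one_iff_adj.1 hwz).symm) hne
      ((hlev z).trans (hz.trans (by rw [hm]))) ((hlev v).trans hm) ((hlev w).trans (hd ▸ hm))
    have h₁ := back hvx hx
    exact ⟨f x, h₁.1, (back hwx hx).1, by rw [h₁.2, hm]⟩

theorem IsWeaklyModular.isLocallyWeaklyModular (h : IsWeaklyModular G) :
    IsLocallyWeaklyModular G := by
  intro u
  constructor
  · intro v w hvw hv hw
    obtain ⟨x, hxv, hxw, hx⟩ := (h u).1 v w (SimpleGraph.dist_eq_one_iff_adj.2 hvw) (by omega)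
      (by omega)
    exact ⟨x, (SimpleGraph.dist_eq_one_iff_adj.1 (by omega)).symm, hxv, hxw⟩
  · intro v w z hzv hzw hvw hv hw hz
    obtain ⟨x, hxv, hxw, hx⟩ := (h u).2 v w z (SimpleGraph.dist_eq_one_iff_adj.2 hzv.symm)
      (SimpleGraph.dist_eq_one_iff_adj.2 hzw.symm) hvw (by omega) (by omega) (by omega)
    exact ⟨x, (SimpleGraph.dist_eq_one_iff_adj.1 (by omega)).symm, hxv, hxw⟩

end Descent
end DualPolar
namespace DualPolar

/-! ### Coordinates and open stars in the complex -/

noncomputable section Star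

open Topology unitInterval

variable {V : Type*} {G : SimpleGraph V}

theorem combination_apply {ι : Type*} [Fintype ι] {φ : ι → V} (hφ : Function.Injective φ)
    (w : ι → ℝ) (i : ι) : combination φ w (φ i) = w i := by
  classical
  unfold combination
  rw [Finset.sum_eq_single i]
  · simp
  · intro j _ hj
    rw [if_neg fun h => hj (hφ h)]
  · simp

theorem combination_of_notMem {ι : Type*} [Fintype ι] {φ : ι → V} (w : ι → ℝ) {v : V}
    (hv : ∀ i, φ i ≠ v) : combination φ w v = 0 := by
  classical
  unfold combination
  exact Finset.sum_eq_zero fun i _ => if_neg (hv i)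

theorem continuous_combination {ι X : Type*} [Fintype ι] [TopologicalSpace X] {φ : ι → V}
    {w : X → ι → ℝ} (hw : Continuous w) (v : V) : Continuous fun x => combination φ (w x) v := by
  classical
  unfold combination
  refine continuous_finsetSum _ fun i _ => ?_
  by_cases h : φ i = v
  · simp only [h, if_true]
    exact (continuous_apply i).comp hw
  · simpa [h] using continuous_const

/-- The point of the triangle-square complex with barycentric coordinates `w` in the simplex
`s`. -/
def simplexPoint (s : Simplex G) (w : stdSimplex ℝ {v : V // v ∈ s.1}) : TriangleSquareComplex G :=
  Quotient.mk (Setoid.ker (coordinates G)) (Sum.inl ⟨s, w⟩)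

/-- The point of the triangle-square complex with parameters `q` in the square `f`. -/
def squarePoint (f : SimpleGraph.cycleGraph 4 ↪g G) (q : I × I) : TriangleSquareComplex G :=
  Quotient.mk (Setoid.ker (coordinates G)) (Sum.inr ⟨f, q⟩)

/-- The coordinates of a point of the triangle-square complex. -/
def coord : TriangleSquareComplex G → V → ℝ :=
  Quotient.lift (coordinates G) fun _ _ h => h

theorem coord_injective : Function.Injective (coord (G := G)) := by
  rintro ⟨a⟩ ⟨b⟩ h
  exact Quotient.sound (s := Setoid.ker (coordinates G)) h

theorem isQuotientMap_mk :
    IsQuotientMap (Quotient.mk (Setoid.ker (coordinates G)) : Cells G → TriangleSquareComplex G) :=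
  isQuotientMap_quotient_mk'

theorem continuous_simplexPoint (s : Simplex G) : Continuous (simplexPoint s) :=
  isQuotientMap_mk.continuous.comp (continuous_inl.comp continuous_sigmaMk)

theorem continuous_squarePoint (f : SimpleGraph.cycleGraph 4 ↪g G) : Continuous (squarePoint f) :=
  isQuotientMap_mk.continuous.comp (continuous_inr.comp continuous_sigmaMk)

theorem point_cases (x : TriangleSquareComplex G) :
    (∃ s w, x = simplexPoint s w) ∨ ∃ f q, x = squarePoint f q := by
  obtain ⟨⟨s, w⟩ | ⟨f, q⟩⟩ := x
  · exact Or.inl ⟨s, w, rfl⟩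
  · exact Or.inr ⟨f, q, rfl⟩

theorem coord_simplexPoint (s : Simplex G) (w : stdSimplex ℝ {v : V // v ∈ s.1}) {v : V}
    (hv : v ∈ s.1) : coord (simplexPoint s w) v = w.1 ⟨v, hv⟩ :=
  combination_apply (φ := Subtype.val) Subtype.val_injective w.1 ⟨v, hv⟩

theorem coord_simplexPoint_of_notMem (s : Simplex G) (w : stdSimplex ℝ {v : V // v ∈ s.1}) {v : V}
    (hv : v ∉ s.1) : coord (simplexPoint s w) v = 0 :=
  combination_of_notMem (φ := Subtype.val) w.1 fun i h => hv (h ▸ i.2)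

theorem coord_squarePoint (f : SimpleGraph.cycleGraph 4 ↪g G) (q : I × I) (i : Fin 4) :
    coord (squarePoint f q) (f i) = cornerWeights q i :=
  combination_apply (φ := f) f.injective _ i

theorem coord_squarePoint_of_notMem (f : SimpleGraph.cycleGraph 4 ↪g G) (q : I × I) {v : V}
    (hv : ∀ i, f i ≠ v) : coord (squarePoint f q) v = 0 :=
  combination_of_notMem (φ := f) _ hv

theorem cornerWeights_nonneg (q : I × I) (i : Fin 4) : 0 ≤ cornerWeights q i := by
  have h₁ := q.1.2.1
  have h₂ := q.1.2.2
  have h₃ := q.2.2.1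
  have h₄ := q.2.2.2
  fin_cases i <;> simp [cornerWeights] <;> apply mul_nonneg <;> linarith

/-- The coordinates of a point are nonnegative with sum 1; hence the open stars cover the complex.
-/
theorem exists_coord_pos (x : TriangleSquareComplex G) : ∃ v, 0 < coord x v := by
  rcases point_cases x with ⟨s, w, rfl⟩ | ⟨f, q, rfl⟩
  · obtain ⟨i, -, hi⟩ := Finset.exists_lt_of_sum_lt (s := Finset.univ)
      (f := fun _ : {v : V // v ∈ s.1} => (0 : ℝ)) (g := w.1) (by
        rw [w.2.2]; simp)
    exact ⟨i.1, by rw [coord_simplexPoint s w i.2]; exact hi⟩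
  · by_contra h
    push Not at h
    have hw : ∀ i, cornerWeights q i = 0 := fun i => le_antisymm
      (by rw [← coord_squarePoint f]; exact h _) (cornerWeights_nonneg q i)
    have h0 := hw 0
    have h1 := hw 1
    have h2 := hw 2
    have h3 := hw 3
    simp only [cornerWeights, Matrix.cons_val] at h0 h1 h2 h3
    linarith

theorem continuous_coord (v : V) : Continuous fun x : TriangleSquareComplex G => coord x v := by
  refine isQuotientMap_mk.continuous_iff.2 (continuous_sum_dom.2 ⟨?_, ?_⟩)
  · refine continuous_sigma fun s => ?_
    exact continuous_combination continuous_subtype_val v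
  · refine continuous_sigma fun f => ?_
    refine continuous_combination (w := cornerWeights) (continuous_pi fun i => ?_) v
    fin_cases i <;> simp only [cornerWeights] <;> fun_prop

/-- The open star of the vertex `v`. -/
def openStar (G : SimpleGraph V) (v : V) : Set (TriangleSquareComplex G) :=
  {x | 0 < coord x v}

theorem mem_openStar {v : V} {x : TriangleSquareComplex G} : x ∈ openStar G v ↔ 0 < coord x v :=
  Iff.rfl

theorem isOpen_openStar (v : V) : IsOpen (openStar G v) :=
  isOpen_lt continuous_const (continuous_coord v)

theorem simplexPoint_mem_openStar {s : Simplex G} {w : stdSimplex ℝ {v : V // v ∈ s.1}} {v : V} :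
    simplexPoint s w ∈ openStar G v ↔ ∃ hv : v ∈ s.1, 0 < w.1 ⟨v, hv⟩ := by
  rw [mem_openStar]
  by_cases hv : v ∈ s.1
  · rw [coord_simplexPoint s w hv]
    exact ⟨fun h => ⟨hv, h⟩, fun ⟨_, h⟩ => h⟩
  · rw [coord_simplexPoint_of_notMem s w hv]
    exact ⟨fun h => absurd h (lt_irrefl _), fun ⟨h, _⟩ => absurd h hv⟩

theorem squarePoint_mem_openStar {f : SimpleGraph.cycleGraph 4 ↪g G} {q : I × I} {v : V} :
    squarePoint f q ∈ openStar G v ↔ ∃ i, f i = v ∧ 0 < cornerWeights q i := by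
  rw [mem_openStar]
  by_cases hv : ∃ i, f i = v
  · obtain ⟨i, rfl⟩ := hv
    rw [coord_squarePoint]
    exact ⟨fun h => ⟨i, rfl, h⟩, fun ⟨j, hj, h⟩ => f.injective hj ▸ h⟩
  · have hv' : ∀ i, f i ≠ v := fun i h => hv ⟨i, h⟩
    rw [coord_squarePoint_of_notMem f q hv']
    exact ⟨fun h => absurd h (lt_irrefl _), fun ⟨i, h, _⟩ => absurd h (hv' i)⟩

theorem simplex_adj (s : Simplex G) {u v : V} (hu : u ∈ s.1) (hv : v ∈ s.1) (h : u ≠ v) :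
    G.Adj u v :=
  s.2.2.2 hu hv h

theorem cycle_adj_iff (f : SimpleGraph.cycleGraph 4 ↪g G) (i j : Fin 4) :
    G.Adj (f i) (f j) ↔ j ≠ i ∧ j ≠ i + 2 := by
  rw [f.map_adj_iff]
  revert i j
  decide

/-- If opposite corners of a square have positive weights then all corners have. -/
theorem cornerWeights_pos {q : I × I} {i : Fin 4} (h : 0 < cornerWeights q i)
    (h' : 0 < cornerWeights q (i + 2)) (j : Fin 4) : 0 < cornerWeights q j := by
  have hmul : cornerWeights q 0 * cornerWeights q 2 = cornerWeights q 1 * cornerWeights q 3 := by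
    simp only [cornerWeights, Matrix.cons_val]
    ring
  have hn := cornerWeights_nonneg q
  have key : ∀ {a b c d : ℝ}, 0 ≤ c → 0 ≤ d → a * b = c * d → 0 < a → 0 < b → 0 < c ∧ 0 < d := by
    intro a b c d hc hd he ha hb
    have := mul_pos ha hb
    rw [he] at this
    exact ⟨pos_of_mul_pos_left this hd, pos_of_mul_pos_right this hc⟩
  have h02 : 0 < cornerWeights q 0 ∧ 0 < cornerWeights q 2 ∧ 0 < cornerWeights q 1 ∧
      0 < cornerWeights q 3 := by
    have hi : i = 0 ∨ i = 1 ∨ i = 2 ∨ i = 3 := by clear h h'; revert i; decide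
    rcases hi with rfl | rfl | rfl | rfl
    · have := key (hn 1) (hn 3) hmul h h'
      exact ⟨h, h', this.1, this.2⟩
    · have := key (hn 0) (hn 2) hmul.symm h h'
      exact ⟨this.1, this.2, h, h'⟩
    · have := key (hn 1) (hn 3) hmul h' h
      exact ⟨h', h, this.1, this.2⟩
    · have := key (hn 0) (hn 2) hmul.symm h' h
      exact ⟨this.1, this.2, h', h⟩
  fin_cases j
  exacts [h02.1, h02.2.2.1, h02.2.1, h02.2.2.2]

/-- Two vertices whose open stars meet are equal, adjacent, or opposite vertices of a square whose
other vertices have open stars containing the given point as well. -/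
theorem openStar_inter {x : TriangleSquareComplex G} {u v : V} (hu : x ∈ openStar G u)
    (hv : x ∈ openStar G v) : u = v ∨ G.Adj u v ∨ ∃ w, x ∈ openStar G w ∧ G.Adj u w ∧ G.Adj w v := by
  rcases point_cases x with ⟨s, w, rfl⟩ | ⟨f, q, rfl⟩
  · obtain ⟨hus, -⟩ := simplexPoint_mem_openStar.1 hu
    obtain ⟨hvs, -⟩ := simplexPoint_mem_openStar.1 hv
    by_cases h : u = v
    · exact Or.inl h
    · exact Or.inr (Or.inl (simplex_adj s hus hvs h))
  · obtain ⟨i, rfl, hi⟩ := squarePoint_mem_openStar.1 hu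
    obtain ⟨j, rfl, hj⟩ := squarePoint_mem_openStar.1 hv
    by_cases h : j = i
    · exact Or.inl (h ▸ rfl)
    by_cases h' : j = i + 2
    · subst h'
      refine Or.inr (Or.inr ⟨f (i + 1), ?_, cycle_adj f i, ?_⟩)
      · exact squarePoint_mem_openStar.2 ⟨_, rfl, cornerWeights_pos hi hj _⟩
      · rw [cycle_adj_iff]; clear hi hu hv h hj; revert i; decide
    · exact Or.inr (Or.inl ((cycle_adj_iff f i j).2 ⟨h, h'⟩))

/-- The vertices whose open stars contain a given point form a clique or lie on a square. -/
theorem openStar_clique_or_square (x : TriangleSquareComplex G) :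
    (∀ u v, x ∈ openStar G u → x ∈ openStar G v → u = v ∨ G.Adj u v) ∨
      ∃ f : SimpleGraph.cycleGraph 4 ↪g G, ∀ u, x ∈ openStar G u → ∃ i, f i = u := by
  rcases point_cases x with ⟨s, w, rfl⟩ | ⟨f, q, rfl⟩
  · refine Or.inl fun u v hu hv => ?_
    obtain ⟨hus, -⟩ := simplexPoint_mem_openStar.1 hu
    obtain ⟨hvs, -⟩ := simplexPoint_mem_openStar.1 hv
    by_cases h : u = v
    · exact Or.inl h
    · exact Or.inr (simplex_adj s hus hvs h)
  · refine Or.inr ⟨f, fun u hu => ?_⟩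
    obtain ⟨i, hi, -⟩ := squarePoint_mem_openStar.1 hu
    exact ⟨i, hi⟩

/-- The segment between two points of a simplex. -/
def simplexSegment {ι : Type*} [Fintype ι] (x y : stdSimplex ℝ ι) (t : I) : stdSimplex ℝ ι :=
  ⟨fun i => (1 - t) * x.1 i + t * y.1 i, fun i => add_nonneg
      (mul_nonneg (sub_nonneg.2 t.2.2) (x.2.1 i)) (mul_nonneg t.2.1 (y.2.1 i)), by
    rw [Finset.sum_add_distrib, ← Finset.mul_sum, ← Finset.mul_sum, x.2.2, y.2.2]; ring⟩

theorem continuous_simplexSegment {ι : Type*} [Fintype ι] (y : stdSimplex ℝ ι) :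
    Continuous fun p : stdSimplex ℝ ι × I => simplexSegment p.1 y p.2 := by
  refine Continuous.subtype_mk (continuous_pi fun i => ?_) _
  have h : Continuous fun p : stdSimplex ℝ ι × I => p.1.1 i :=
    (continuous_apply i).comp (continuous_subtype_val.comp continuous_fst)
  exact ((continuous_const.sub (continuous_subtype_val.comp continuous_snd)).mul h).add
    ((continuous_subtype_val.comp continuous_snd).mul continuous_const)

/-- The segment between two points of the unit square. -/
def squareSegment (x y : I × I) (t : I) : I × I :=
  (Set.Icc.convexComb x.1 y.1 t, Set.Icc.convexComb x.2 y.2 t)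

theorem continuous_squareSegment (y : I × I) :
    Continuous fun p : (I × I) × I => squareSegment p.1 y p.2 := by
  refine Continuous.prodMk (Continuous.subtype_mk ?_ _) (Continuous.subtype_mk ?_ _) <;> fun_prop

/-- The corners of the unit square. -/
def corner : Fin 4 → I × I := ![(0, 0), (1, 0), (1, 1), (0, 1)]

theorem cornerWeights_corner (i j : Fin 4) :
    cornerWeights (corner i) j = if j = i then 1 else 0 := by
  fin_cases i <;> fin_cases j <;> simp [cornerWeights, corner]

/-- Bilinear weights are quadratic along a segment to a corner. The deviation from affine
interpolation involves only the weight of the opposite corner, so the motion can be expressed by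
coordinates alone. -/
theorem cornerWeights_squareSegment (q : I × I) (i j : Fin 4) (t : I) :
    cornerWeights (squareSegment q (corner i) t) j = (1 - t) * cornerWeights q j +
      t * (if j = i then 1 else 0) + t * (1 - t) * cornerWeights q (i + 2) *
        (if j = i ∨ j = i + 2 then -1 else 1) := by
  fin_cases i <;> fin_cases j <;>
    simp [cornerWeights, corner, squareSegment] <;> ring

/-- Positivity of a corner weight is preserved along segments. -/
theorem cornerWeights_segment_pos {x y : I × I} {i : Fin 4} (hx : 0 < cornerWeights x i)
    (hy : 0 < cornerWeights y i) (t : I) : 0 < cornerWeights (squareSegment x y t) i := by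
  have key : ∀ {a b c d : ℝ}, 0 ≤ a → 0 ≤ b → 0 ≤ c → 0 ≤ d → 0 < a * b → 0 < c * d →
      0 < ((1 - (t : ℝ)) * a + t * c) * ((1 - (t : ℝ)) * b + t * d) := by
    intro a b c d ha hb hc hd hab hcd
    have comb : ∀ {a c : ℝ}, 0 < a → 0 < c → 0 < (1 - (t : ℝ)) * a + t * c := by
      intro a c ha hc
      have h₀ := t.2.1
      have h₁ := t.2.2
      rcases h₀.eq_or_lt with h | h
      · rw [← h]; simpa using ha
      · have := mul_pos h hc
        have := mul_nonneg (sub_nonneg.2 h₁) ha.le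
        linarith
    exact mul_pos (comb (pos_of_mul_pos_left hab hb) (pos_of_mul_pos_left hcd hd))
      (comb (pos_of_mul_pos_right hab ha) (pos_of_mul_pos_right hcd hc))
  have n : ∀ r : I, 0 ≤ 1 - (r : ℝ) := fun r => sub_nonneg.2 r.2.2
  have p : ∀ r : I, 0 ≤ (r : ℝ) := fun r => r.2.1
  have hi : i = 0 ∨ i = 1 ∨ i = 2 ∨ i = 3 := by clear hx hy; revert i; decide
  rcases hi with rfl | rfl | rfl | rfl
  · convert key (n x.1) (n x.2) (n y.1) (n y.2) hx hy using 1
    simp only [cornerWeights, squareSegment, Set.Icc.coe_convexComb, Matrix.cons_val]; ring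
  · convert key (p x.1) (n x.2) (p y.1) (n y.2) hx hy using 1
    simp only [cornerWeights, squareSegment, Set.Icc.coe_convexComb, Matrix.cons_val]; ring
  · exact key (p x.1) (p x.2) (p y.1) (p y.2) hx hy
  · convert key (n x.1) (p x.2) (n y.1) (p y.2) hx hy using 1
    simp only [cornerWeights, squareSegment, Set.Icc.coe_convexComb, Matrix.cons_val]; ring

/-- A vertex as a corner of the standard simplex. -/
def simplexCorner (s : Simplex G) {v : V} (hv : v ∈ s.1) : stdSimplex ℝ {v : V // v ∈ s.1} :=
  open Classical in ⟨Pi.single ⟨v, hv⟩ 1, single_mem_stdSimplex ℝ _⟩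

/-- The simplex consisting of one vertex. -/
def vertexSimplex (G : SimpleGraph V) (v : V) : Simplex G :=
  ⟨{v}, by simp, by simp, by simp [SimpleGraph.isClique_iff]⟩

theorem mem_vertexSimplex (v : V) : v ∈ (vertexSimplex G v).1 :=
  Finset.mem_singleton_self v

/-- A vertex as a point of the triangle-square complex. -/
def vertexPoint (G : SimpleGraph V) (v : V) : TriangleSquareComplex G :=
  simplexPoint (vertexSimplex G v) (simplexCorner _ (mem_vertexSimplex v))

open Classical in
theorem coord_simplexCorner (s : Simplex G) {v : V} (hv : v ∈ s.1) (x : V) :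
    coord (simplexPoint s (simplexCorner s hv)) x = if x = v then 1 else 0 := by
  by_cases hx : x ∈ s.1
  · rw [coord_simplexPoint s _ hx, simplexCorner]
    simp [Pi.single_apply]
  · rw [coord_simplexPoint_of_notMem s _ hx, if_neg (show ¬ x = v from fun h => hx (h ▸ hv))]

theorem simplexPoint_corner (s : Simplex G) {v : V} (hv : v ∈ s.1) :
    simplexPoint s (simplexCorner s hv) = vertexPoint G v := by
  classical
  refine coord_injective (funext fun x => ?_)
  rw [vertexPoint, coord_simplexCorner, coord_simplexCorner]

theorem vertexPoint_mem_openStar (v : V) : vertexPoint G v ∈ openStar G v := by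
  classical
  rw [mem_openStar, vertexPoint, coord_simplexCorner, if_pos rfl]
  exact one_pos

end Star

/-! ### Contracting open stars to their centers -/

noncomputable section Contraction

open Topology unitInterval

variable {V : Type*} {G : SimpleGraph V}

open Classical in
/-- The coordinates, in terms of coordinates `c`, of the point at time `t` on the way to `v`. -/
def contractCoord (G : SimpleGraph V) (v : V) (t : I) (c : V → ℝ) (x : V) : ℝ :=
  (1 - t) * c x + t * (if x = v then 1 else 0) +
    t * (1 - t) * (∑ᶠ y, if y ≠ v ∧ ¬ G.Adj v y then c y else 0) *
      (if 0 < c x then if G.Adj v x then 1 else -1 else 0)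

/-- All other vertices of the simplex are adjacent to `v`, so the quadratic correction vanishes. -/
theorem coord_simplexSegment (s : Simplex G) (w : stdSimplex ℝ {v : V // v ∈ s.1}) {v : V}
    (hv : v ∈ s.1) (t : I) : coord (simplexPoint s (simplexSegment w (simplexCorner s hv) t)) =
      contractCoord G v t (coord (simplexPoint s w)) := by
  classical
  funext x
  have hM : (∑ᶠ y, if y ≠ v ∧ ¬ G.Adj v y then coord (simplexPoint s w) y else 0) = 0 := by
    refine finsum_eq_zero_of_forall_eq_zero fun y => ?_
    split_ifs with h
    · exact coord_simplexPoint_of_notMem s w fun hy => h.2 (simplex_adj s hv hy h.1.symm)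
    · rfl
  rw [contractCoord, hM]
  by_cases hx : x ∈ s.1
  · rw [coord_simplexPoint s _ hx, coord_simplexPoint s _ hx, simplexSegment]
    simp [simplexCorner, Pi.single_apply]
  · rw [coord_simplexPoint_of_notMem s _ hx, coord_simplexPoint_of_notMem s _ hx,
      if_neg (show ¬ x = v from fun h => hx (h ▸ hv))]
    simp

/-- The sum in `contractCoord` picks out the corner opposite to `f i`. If its weight is positive, so
are all four, and the restriction of the correction to the support loses nothing. -/
theorem coord_squareSegment (f : SimpleGraph.cycleGraph 4 ↪g G) (q : I × I) (i : Fin 4)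
    (hi : 0 < cornerWeights q i) (t : I) :
    coord (squarePoint f (squareSegment q (corner i) t)) =
      contractCoord G (f i) t (coord (squarePoint f q)) := by
  classical
  funext x
  have hM : (∑ᶠ y, if y ≠ f i ∧ ¬ G.Adj (f i) y then coord (squarePoint f q) y else 0) =
      cornerWeights q (i + 2) := by
    rw [finsum_eq_single _ (f (i + 2)), coord_squarePoint, if_pos]
    · exact ⟨(cycle_ne f i).symm, cycle_not_adj f i⟩
    · intro y hy
      by_cases hx : ∃ j, f j = y
      · obtain ⟨j, rfl⟩ := hx
        rw [if_neg]
        rintro ⟨h₁, h₂⟩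
        exact h₂ ((cycle_adj_iff f i j).2 ⟨fun h => h₁ (h ▸ rfl), fun h => hy (h ▸ rfl)⟩)
      · push Not at hx
        rw [coord_squarePoint_of_notMem f q hx, ite_self]
  rw [contractCoord, hM]
  by_cases hx : ∃ j, f j = x
  · obtain ⟨j, rfl⟩ := hx
    rw [coord_squarePoint, coord_squarePoint, cornerWeights_squareSegment]
    simp only [f.injective.eq_iff, cycle_adj_iff]
    rcases (cornerWeights_nonneg q (i + 2)).eq_or_lt with h | h
    · rw [← h]; simp
    · rw [if_pos (cornerWeights_pos hi h j)]
      congr 2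
      by_cases hj : j = i ∨ j = i + 2
      · rw [if_pos hj, if_neg (by tauto)]
      · rw [if_neg hj, if_pos (by tauto)]
  · push Not at hx
    rw [coord_squarePoint_of_notMem f _ hx, coord_squarePoint_of_notMem f _ hx,
      if_neg fun h => hx i h.symm]
    simp

open Classical in
/-- The path from a point of a cell to `v` inside the cell, if `v` is a vertex of the cell. -/
def cellContraction (G : SimpleGraph V) (v : V) : Cells G → C(I, TriangleSquareComplex G)
  | Sum.inl ⟨s, w⟩ => if hv : v ∈ s.1 then
      (ContinuousMap.curry ⟨fun p : stdSimplex ℝ {v : V // v ∈ s.1} × I =>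
        simplexPoint s (simplexSegment p.1 (simplexCorner s hv) p.2),
        (continuous_simplexPoint s).comp (continuous_simplexSegment _)⟩) w
      else ContinuousMap.const I (vertexPoint G v)
  | Sum.inr ⟨f, q⟩ => if hv : ∃ i, f i = v then
      (ContinuousMap.curry ⟨fun p : (I × I) × I =>
        squarePoint f (squareSegment p.1 (corner hv.choose) p.2),
        (continuous_squarePoint f).comp (continuous_squareSegment _)⟩) q
      else ContinuousMap.const I (vertexPoint G v)

theorem continuous_cellContraction (v : V) : Continuous (cellContraction G v) := by
  classical
  refine continuous_sum_dom.2 ⟨continuous_sigma fun s => ?_, continuous_sigma fun f => ?_⟩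
  · by_cases hv : v ∈ s.1
    · convert ContinuousMap.continuous (ContinuousMap.curry
        ⟨fun p : stdSimplex ℝ {v : V // v ∈ s.1} × I =>
        simplexPoint s (simplexSegment p.1 (simplexCorner s hv) p.2),
        (continuous_simplexPoint s).comp (continuous_simplexSegment _)⟩) using 1
      funext w
      simp [cellContraction, hv]
    · convert continuous_const (y := ContinuousMap.const I (vertexPoint G v)) using 1
      funext w
      simp [cellContraction, hv]
  · by_cases hv : ∃ i, f i = v
    · convert ContinuousMap.continuous (ContinuousMap.curry
        ⟨fun p : (I × I) × I => squarePoint f (squareSegment p.1 (corner hv.choose) p.2),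
        (continuous_squarePoint f).comp (continuous_squareSegment _)⟩) using 1
      funext w
      simp only [Function.comp_apply, cellContraction, dif_pos hv]
    · convert continuous_const (y := ContinuousMap.const I (vertexPoint G v)) using 1
      funext w
      simp only [Function.comp_apply, cellContraction, dif_neg hv]

theorem coord_cellContraction {v : V} {ξ : Cells G} (h : 0 < coordinates G ξ v) (t : I) :
    coord (cellContraction G v ξ t) = contractCoord G v t (coordinates G ξ) := by
  rcases ξ with ⟨s, w⟩ | ⟨f, q⟩
  · obtain ⟨hv, -⟩ := simplexPoint_mem_openStar.1 (show simplexPoint s w ∈ openStar G v from h)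
    simp only [cellContraction, dif_pos hv]
    exact coord_simplexSegment s w hv t
  · obtain ⟨i, hi, hpos⟩ := squarePoint_mem_openStar.1 (show squarePoint f q ∈ openStar G v from h)
    have hv : ∃ i, f i = v := ⟨i, hi⟩
    simp only [cellContraction, dif_pos hv]
    have he : i = hv.choose := f.injective (hi.trans hv.choose_spec.symm)
    rw [he] at hpos
    have := coord_squareSegment f q hv.choose hpos t
    rw [hv.choose_spec] at this
    exact this

/-- The point at time `t` of the contraction of an open star to its center. -/
def starContraction (G : SimpleGraph V) (v : V) (x : openStar G v) : C(I, TriangleSquareComplex G) :=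
  cellContraction G v (Quotient.out (s := Setoid.ker (coordinates G)) x.1)

/-- The contraction does not depend on the cell representing a point, since its coordinates depend
only on those of the starting point. -/
theorem starContraction_mk (v : V) (ξ : Cells G)
    (h : Quotient.mk (Setoid.ker (coordinates G)) ξ ∈ openStar G v) :
    starContraction G v ⟨_, h⟩ = cellContraction G v ξ := by
  have he : coordinates G (Quotient.out (s := Setoid.ker (coordinates G))
      (Quotient.mk (Setoid.ker (coordinates G)) ξ)) = coordinates G ξ :=
    Quotient.exact (s := Setoid.ker (coordinates G)) (Quotient.out_eq _)
  have h₁ : 0 < coordinates G ξ v := h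
  refine ContinuousMap.ext fun t => coord_injective ?_
  rw [starContraction, coord_cellContraction (he ▸ h₁), coord_cellContraction h₁, he]

/-- With values in the path space, continuity can be tested on cells: the quotient map restricted to
an open set is a quotient map, and no product with the interval is needed. -/
theorem continuous_starContraction (v : V) : Continuous (starContraction G v) := by
  have hq := (isQuotientMap_mk (G := G)).restrictPreimage_isOpen (isOpen_openStar v)
  refine hq.continuous_iff.2 ?_
  convert (continuous_cellContraction v).comp continuous_subtype_val using 1
  funext ξ
  exact starContraction_mk v ξ.1 ξ.2

theorem starContraction_zero (v : V) (x : openStar G v) : starContraction G v x 0 = x.1 := by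
  obtain ⟨⟨ξ⟩, h⟩ := x
  have h₁ : 0 < coordinates G ξ v := h
  refine coord_injective ?_
  refine (congrArg (fun c => coord (c 0)) (starContraction_mk v ξ h)).trans ?_
  rw [coord_cellContraction h₁]
  funext y
  simp only [contractCoord, Set.Icc.coe_zero]
  simp
  rfl

theorem starContraction_one (v : V) (x : openStar G v) :
    starContraction G v x 1 = vertexPoint G v := by
  classical
  obtain ⟨⟨ξ⟩, h⟩ := x
  have h₁ : 0 < coordinates G ξ v := h
  refine coord_injective ?_
  refine (congrArg (fun c => coord (c 1)) (starContraction_mk v ξ h)).trans ?_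
  rw [coord_cellContraction h₁]
  funext y
  rw [vertexPoint, coord_simplexCorner]
  simp [contractCoord]

/-- The contraction of an open star to its center, inside the complex. -/
def starHomotopy (G : SimpleGraph V) (v : V) :
    ContinuousMap.Homotopy (⟨Subtype.val, continuous_subtype_val⟩ :
      C(openStar G v, TriangleSquareComplex G)) (ContinuousMap.const _ (vertexPoint G v)) where
  toFun p := starContraction G v p.2 p.1
  continuous_toFun :=
    ((continuous_starContraction v).comp continuous_snd).eval continuous_fst
  map_zero_left := starContraction_zero v
  map_one_left := starContraction_one v

/-- The homotopy class of the path from a point of an open star to its center. -/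
def starPath {v : V} {x : TriangleSquareComplex G} (hx : x ∈ openStar G v) :
    Path.Homotopic.Quotient x (vertexPoint G v) :=
  Path.Homotopic.Quotient.mk ((starHomotopy G v).evalAt ⟨x, hx⟩)

/-- Naturality of the contraction along `γ`; at time 1 it is constant, so the fourth side of the
homotopy square is trivial. -/
theorem trans_starPath {v : V} {x y : TriangleSquareComplex G} (γ : Path x y)
    (hγ : ∀ t, γ t ∈ openStar G v) (hx : x ∈ openStar G v) (hy : y ∈ openStar G v) :
    (Path.Homotopic.Quotient.mk γ).trans (starPath hy) = starPath hx := by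
  let γ' : Path (⟨x, hx⟩ : openStar G v) ⟨y, hy⟩ :=
    ⟨⟨fun t => ⟨γ t, hγ t⟩, γ.continuous.subtype_mk _⟩, Subtype.ext γ.source, Subtype.ext γ.target⟩
  have h := Path.Homotopic.map_trans_evalAt (starHomotopy G v) γ'
  have h' : (Path.Homotopic.Quotient.mk γ).trans (starPath hy) =
      (starPath hx).trans (Path.Homotopic.Quotient.refl _) := Path.Homotopic.Quotient.eq.2 h
  exact h'.trans (Path.Homotopic.Quotient.trans_refl _)

end Contraction

end DualPolar
namespace DualPolar

/-! ### Sections of flat systems from TC and QC -/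

section FlatSystem

variable {V : Type*} {G : SimpleGraph V}

/-- A family of types indexed by the vertices, with transport maps along the edges that are
compatible with the triangles and squares of `G`. -/
structure IsFlatSystem (G : SimpleGraph V) (T : V → Type*) (e : ∀ v w, G.Adj v w → T w → T v) :
    Prop where
  inv : ∀ v w (h : G.Adj v w) t, e v w h (e w v h.symm t) = t
  triangle : ∀ u v w (huv : G.Adj u v) (hvw : G.Adj v w) (huw : G.Adj u w) t,
    e u v huv (e v w hvw t) = e u w huw t
  square : ∀ a b c d (hab : G.Adj a b) (hbc : G.Adj b c) (had : G.Adj a d) (hdc : G.Adj d c) t,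
    a ≠ c → b ≠ d → ¬ G.Adj a c → ¬ G.Adj b d →
      e a b hab (e b c hbc t) = e a d had (e d c hdc t)

/-- The elements obtained from `t₀` by transport along geodesics starting in `b`. -/
inductive GeodesicTransport (G : SimpleGraph V) (T : V → Type*) (e : ∀ v w, G.Adj v w → T w → T v)
    (b : V) (t₀ : T b) : ∀ v, T v → Prop
  | base : GeodesicTransport G T e b t₀ b t₀
  | step {v w : V} (h : G.Adj v w) (t : T w) : G.dist b v = G.dist b w + 1 →
      GeodesicTransport G T e b t₀ w t → GeodesicTransport G T e b t₀ v (e v w h t)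

variable {T : V → Type*} {e : ∀ v w, G.Adj v w → T w → T v}

/-- Induction on the distance from `b` shows that transport along geodesics is well defined and
compatible with edges between equidistant vertices. Two last steps `w`, `w'` are compared by a
triangle if adjacent, and otherwise by the square that QC completes; equidistant adjacent vertices
are compared by the triangle from TC. -/
theorem IsFlatSystem.exists_section (hF : IsFlatSystem G T e) (hG : G.Connected) (b : V)
    (hTC : TriangleCondition G b) (hQC : QuadrangleCondition G b) (t₀ : T b) :
    ∃ s : ∀ v, T v, ∀ v w (h : G.Adj v w), s v = e v w h (s w) := by
  let Q := GeodesicTransport G T e b t₀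
  have hstep : ∀ {n v t}, Q v t → G.dist b v = n + 1 →
      ∃ w, ∃ h : G.Adj v w, G.dist b w = n ∧ ∃ t', Q w t' ∧ t = e v w h t' := by
    intro n v t h hd
    cases h with
    | base => simp at hd
    | @step _ w h t' hd' h' => exact ⟨w, h, by omega, t', h', rfl⟩
  have hex : ∀ n v, G.dist b v = n → ∃ t, Q v t := by
    intro n
    induction n with
    | zero =>
      intro v hv
      obtain rfl := hG.dist_eq_zero_iff.1 hv
      exact ⟨t₀, .base⟩
    | succ n ih =>
      intro v hv
      obtain ⟨w, hwv, hw⟩ := exists_adj_dist_eq hG hv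
      obtain ⟨t, ht⟩ := ih w hw
      exact ⟨_, .step hwv.symm t (by omega) ht⟩
  have hmain : ∀ n, (∀ v, G.dist b v = n → ∀ t t', Q v t → Q v t' → t = t') ∧
      ∀ v w (h : G.Adj v w), G.dist b v = n → G.dist b w = n → ∀ t t', Q v t → Q w t' →
        t = e v w h t' := by
    intro n
    induction n using Nat.strong_induction_on with
    | _ n ih =>
    have huniq : ∀ v, G.dist b v = n → ∀ t t', Q v t → Q v t' → t = t' := by
      intro v hv t t' ht ht'
      rcases n with _ | n
      · obtain rfl := hG.dist_eq_zero_iff.1 hv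
        have key : ∀ v t, Q v t → ∀ h : b = v, t = h ▸ t₀ := by
          intro v t h
          cases h with
          | base => intro h; rfl
          | step h t' hd h' =>
            rintro rfl
            simp at hd
        exact (key b t ht rfl).trans (key b t' ht' rfl).symm
      · obtain ⟨w, hw, hdw, s, hs, rfl⟩ := hstep ht hv
        obtain ⟨w', hw', hdw', s', hs', rfl⟩ := hstep ht' hv
        by_cases hne : w = w'
        · subst hne
          rw [(ih n (Nat.lt_succ_self n)).1 w hdw s s' hs hs']
        by_cases hadj : G.Adj w w'
        · rw [(ih n (Nat.lt_succ_self n)).2 w w' hadj hdw hdw' s s' hs hs']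
          exact hF.triangle v w w' hw hadj hw' s'
        · obtain ⟨m, rfl⟩ : ∃ m, n = m + 1 := by
            rcases n with _ | m
            · exact absurd ((hG.dist_eq_zero_iff.1 hdw).symm.trans (hG.dist_eq_zero_iff.1 hdw')) hne
            · exact ⟨m, rfl⟩
          obtain ⟨x, hxw, hxw', hx⟩ : ∃ x, G.Adj x w ∧ G.Adj x w' ∧ G.dist b x = m := by
            -- At distance 1 the vertex `b` itself closes the square, a case that QC does not cover.
            rcases m with _ | m
            · exact ⟨b, SimpleGraph.dist_eq_one_iff_adj.1 hdw,
                SimpleGraph.dist_eq_one_iff_adj.1 hdw', by simp⟩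
            · obtain ⟨x, h₁, h₂, h₃⟩ := hQC w w' v (SimpleGraph.dist_eq_one_iff_adj.2 hw.symm)
                (SimpleGraph.dist_eq_one_iff_adj.2 hw'.symm)
                (dist_eq_two hG hw.symm hw' hne hadj) (by omega) (by omega) (by omega)
              exact ⟨x, h₁, h₂, by omega⟩
          obtain ⟨r, hr⟩ := hex m x hx
          rw [(ih (m + 1) (by omega)).1 w hdw s _ hs (.step hxw.symm r (by omega) hr),
            (ih (m + 1) (by omega)).1 w' hdw' s' _ hs' (.step hxw'.symm r (by omega) hr)]
          refine hF.square v w x w' hw hxw.symm hw' hxw'.symm r ?_ hne ?_ hadj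
          · rintro rfl
            omega
          · intro h
            have := dist_le_succ_of_adj hG h b
            omega
    refine ⟨huniq, ?_⟩
    intro v w hvw hv hw t t' ht ht'
    obtain ⟨m, rfl⟩ : ∃ m, n = m + 1 := by
      rcases n with _ | m
      · exact absurd ((hG.dist_eq_zero_iff.1 hv).symm.trans (hG.dist_eq_zero_iff.1 hw)) hvw.ne
      · exact ⟨m, rfl⟩
    obtain ⟨x, hxv, hxw, hx⟩ : ∃ x, G.Adj x v ∧ G.Adj x w ∧ G.dist b x = m := by
      rcases m with _ | m
      · exact ⟨b, SimpleGraph.dist_eq_one_iff_adj.1 hv, SimpleGraph.dist_eq_one_iff_adj.1 hw,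
          by simp⟩
      · obtain ⟨x, h₁, h₂, h₃⟩ := hTC v w (SimpleGraph.dist_eq_one_iff_adj.2 hvw) (by omega)
          (by omega)
        exact ⟨x, h₁, h₂, by omega⟩
    obtain ⟨r, hr⟩ := hex m x hx
    rw [huniq v hv t _ ht (.step hxv.symm r (by omega) hr),
      huniq w hw t' _ ht' (.step hxw.symm r (by omega) hr)]
    exact (hF.triangle v w x hvw hxw.symm hxv.symm r).symm
  choose s hs using fun v => hex _ v rfl
  refine ⟨s, fun v w h => ?_⟩
  have h₁ := dist_le_succ_of_adj hG h b
  have h₂ := dist_le_succ_of_adj hG h.symm b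
  have hcase : G.dist b v = G.dist b w ∨ G.dist b v = G.dist b w + 1 ∨
    G.dist b w = G.dist b v + 1 := by omega
  rcases hcase with hd | hd | hd
  · exact (hmain _).2 v w h hd rfl _ _ (hs v) (hs w)
  · exact (hmain _).1 v rfl _ _ (hs v) (.step h _ hd (hs w))
  · rw [(hmain _).1 w rfl _ _ (hs w) (.step h.symm _ hd (hs v)), hF.inv]

end FlatSystem

/-! ### Weak modularity implies simple connectedness -/

noncomputable section EdgeClass

open Topology unitInterval

variable {V : Type*} {G : SimpleGraph V}

theorem simplexSegment_zero {ι : Type*} [Fintype ι] (x y : stdSimplex ℝ ι) :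
    simplexSegment x y 0 = x := by
  ext i; simp [simplexSegment]

theorem simplexSegment_one {ι : Type*} [Fintype ι] (x y : stdSimplex ℝ ι) :
    simplexSegment x y 1 = y := by
  ext i; simp [simplexSegment]

theorem squareSegment_zero (x y : I × I) : squareSegment x y 0 = x := by
  ext <;> simp [squareSegment]

theorem squareSegment_one (x y : I × I) : squareSegment x y 1 = y := by
  ext <;> simp [squareSegment]

theorem coord_simplexPoint_segment (s : Simplex G) (a b : stdSimplex ℝ {v : V // v ∈ s.1}) (t : I)
    (x : V) : coord (simplexPoint s (simplexSegment a b t)) x =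
      (1 - t) * coord (simplexPoint s a) x + t * coord (simplexPoint s b) x := by
  by_cases hx : x ∈ s.1
  · simp only [coord_simplexPoint s _ hx]; rfl
  · simp only [coord_simplexPoint_of_notMem s _ hx]; simp

/-- One half, as an element of the unit interval. -/
def half : I := ⟨1 / 2, by norm_num, by norm_num⟩

/-- The simplex formed by the ends of an edge. -/
def edgeSimplex {v w : V} (h : G.Adj v w) : Simplex G :=
  letI := Classical.decEq V
  ⟨{v, w}, by simp, Finset.card_le_two.trans (by norm_num), by
    simp [SimpleGraph.isClique_iff, Set.pairwise_insert, h, h.symm]⟩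

theorem left_mem_edgeSimplex {v w : V} (h : G.Adj v w) : v ∈ (edgeSimplex h).1 := by
  simp [edgeSimplex]

theorem right_mem_edgeSimplex {v w : V} (h : G.Adj v w) : w ∈ (edgeSimplex h).1 := by
  simp [edgeSimplex]

/-- The midpoint of an edge. -/
def midpoint {v w : V} (h : G.Adj v w) : TriangleSquareComplex G :=
  simplexPoint (edgeSimplex h) (simplexSegment (simplexCorner _ (left_mem_edgeSimplex h))
    (simplexCorner _ (right_mem_edgeSimplex h)) half)

theorem simplexPoint_midpoint {v w : V} (h : G.Adj v w) (s : Simplex G) (hv : v ∈ s.1)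
    (hw : w ∈ s.1) : simplexPoint s (simplexSegment (simplexCorner s hv) (simplexCorner s hw) half) =
      midpoint h := by
  refine coord_injective (funext fun x => ?_)
  rw [midpoint, coord_simplexPoint_segment, coord_simplexPoint_segment]
  simp only [coord_simplexCorner]

theorem squarePoint_midpoint (f : SimpleGraph.cycleGraph 4 ↪g G) {i j : Fin 4}
    (h : G.Adj (f i) (f j)) :
    squarePoint f (squareSegment (corner i) (corner j) half) = midpoint h := by
  classical
  have hij := (cycle_adj_iff f i j).1 h
  refine coord_injective (funext fun x => ?_)
  rw [midpoint, coord_simplexPoint_segment]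
  simp only [coord_simplexCorner]
  by_cases hx : ∃ k, f k = x
  · obtain ⟨k, rfl⟩ := hx
    rw [coord_squarePoint, cornerWeights_squareSegment]
    have h' : j + 2 ≠ i := by
      rintro rfl
      exact hij.2 (by clear h hij; revert j; decide)
    simp only [cornerWeights_corner, f.injective.eq_iff, if_neg h']
    ring
  · push Not at hx
    rw [coord_squarePoint_of_notMem f _ hx, if_neg fun h => hx i h.symm,
      if_neg fun h => hx j h.symm]
    ring

theorem simplexCorner_nonneg (s : Simplex G) {v w : V} (hv : v ∈ s.1) (hw : w ∈ s.1) :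
    0 < (simplexSegment (simplexCorner s hv) (simplexCorner s hw) half).1 ⟨v, hv⟩ ∧
      0 < (simplexSegment (simplexCorner s hv) (simplexCorner s hw) half).1 ⟨w, hw⟩ := by
  classical
  simp only [simplexSegment, simplexCorner, half, Pi.single_apply]
  constructor <;> split_ifs <;> norm_num

theorem simplexSegment_pos {ι : Type*} [Fintype ι] {x y : stdSimplex ℝ ι} {i : ι} (hx : 0 < x.1 i)
    (hy : 0 < y.1 i) (t : I) : 0 < (simplexSegment x y t).1 i := by
  simp only [simplexSegment]
  rcases t.2.1.eq_or_lt with h | h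
  · rw [← h]; simpa using hx
  · have := mul_pos h hy
    have := mul_nonneg (sub_nonneg.2 t.2.2) hx.le
    linarith

/-- The open stars of adjacent vertices have path connected intersection. -/
theorem exists_path_midpoint {v w : V} (h : G.Adj v w) {x : TriangleSquareComplex G}
    (hv : x ∈ openStar G v) (hw : x ∈ openStar G w) :
    ∃ γ : Path x (midpoint h), (∀ t, γ t ∈ openStar G v) ∧ ∀ t, γ t ∈ openStar G w := by
  rcases point_cases x with ⟨s, a, rfl⟩ | ⟨f, q, rfl⟩
  · obtain ⟨hvs, hv⟩ := simplexPoint_mem_openStar.1 hv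
    obtain ⟨hws, hw⟩ := simplexPoint_mem_openStar.1 hw
    have hm := simplexCorner_nonneg s hvs hws
    refine ⟨⟨⟨fun t => simplexPoint s (simplexSegment a
      (simplexSegment (simplexCorner s hvs) (simplexCorner s hws) half) t), ?_⟩, ?_, ?_⟩, ?_, ?_⟩
    · exact (continuous_simplexPoint s).comp ((continuous_simplexSegment _).comp
        (continuous_const.prodMk continuous_id))
    · exact congrArg (simplexPoint s) (simplexSegment_zero _ _)
    · exact (congrArg (simplexPoint s) (simplexSegment_one _ _)).trans
        (simplexPoint_midpoint h s hvs hws)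
    · exact fun t => simplexPoint_mem_openStar.2 ⟨hvs, simplexSegment_pos hv hm.1 t⟩
    · exact fun t => simplexPoint_mem_openStar.2 ⟨hws, simplexSegment_pos hw hm.2 t⟩
  · obtain ⟨i, rfl, hi⟩ := squarePoint_mem_openStar.1 hv
    obtain ⟨j, rfl, hj⟩ := squarePoint_mem_openStar.1 hw
    clear hv hw
    have hm := squarePoint_midpoint f h
    have hij := (cycle_adj_iff f i j).1 h
    have hmi : 0 < cornerWeights (squareSegment (corner i) (corner j) half) i := by
      have := hij.1
      have h' : j + 2 ≠ i := by
        rintro rfl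
        exact hij.2 (by clear h hij hi hj hm this; revert j; decide)
      rw [cornerWeights_squareSegment]
      simp only [cornerWeights_corner, if_neg h', if_neg hij.1.symm, half]
      norm_num
    have hmj : 0 < cornerWeights (squareSegment (corner i) (corner j) half) j := by
      have h' : j + 2 ≠ i := by
        rintro rfl
        exact hij.2 (by clear h hij hi hj hm hmi; revert j; decide)
      rw [cornerWeights_squareSegment]
      simp only [cornerWeights_corner, if_neg h', if_neg hij.1, half]
      norm_num
    refine ⟨⟨⟨fun t => squarePoint f (squareSegment q
      (squareSegment (corner i) (corner j) half) t), ?_⟩, ?_, ?_⟩, ?_, ?_⟩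
    · exact (continuous_squarePoint f).comp ((continuous_squareSegment _).comp
        (continuous_const.prodMk continuous_id))
    · exact congrArg (squarePoint f) (squareSegment_zero _ _)
    · exact (congrArg (squarePoint f) (squareSegment_one _ _)).trans hm
    · exact fun t => squarePoint_mem_openStar.2 ⟨i, rfl, cornerWeights_segment_pos hi hmi t⟩
    · exact fun t => squarePoint_mem_openStar.2 ⟨j, rfl, cornerWeights_segment_pos hj hmj t⟩

theorem midpoint_mem_left {v w : V} (h : G.Adj v w) : midpoint h ∈ openStar G v :=
  simplexPoint_mem_openStar.2 ⟨left_mem_edgeSimplex h, (simplexCorner_nonneg _ _ _).1⟩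

theorem midpoint_mem_right {v w : V} (h : G.Adj v w) : midpoint h ∈ openStar G w :=
  simplexPoint_mem_openStar.2 ⟨right_mem_edgeSimplex h, (simplexCorner_nonneg _ _ _).2⟩

theorem exists_mem_openStar_simplex (s : Simplex G) : ∃ x, ∀ v ∈ s.1, x ∈ openStar G v := by
  have hpos : (0 : ℝ) < (Fintype.card {v : V // v ∈ s.1} : ℝ) := by
    obtain ⟨v, hv⟩ := s.2.1
    have : Nonempty {v : V // v ∈ s.1} := ⟨⟨v, hv⟩⟩
    exact_mod_cast Fintype.card_pos
  let w : stdSimplex ℝ {v : V // v ∈ s.1} :=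
    ⟨fun _ => (Fintype.card {v : V // v ∈ s.1} : ℝ)⁻¹, fun _ => (inv_pos.2 hpos).le, by
      rw [Finset.sum_const, Finset.card_univ, nsmul_eq_mul, mul_inv_cancel₀ hpos.ne']⟩
  exact ⟨simplexPoint s w, fun v hv => simplexPoint_mem_openStar.2 ⟨hv, inv_pos.2 hpos⟩⟩

theorem exists_mem_openStar_triangle {u v w : V} (huv : G.Adj u v) (hvw : G.Adj v w)
    (huw : G.Adj u w) : ∃ x, x ∈ openStar G u ∧ x ∈ openStar G v ∧ x ∈ openStar G w := by
  classical
  let s : Simplex G := ⟨{u, v, w}, by simp, Finset.card_le_three, by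
    simp [SimpleGraph.isClique_iff, Set.pairwise_insert, huv, huv.symm, huw, huw.symm, hvw,
      hvw.symm]⟩
  obtain ⟨x, hx⟩ := exists_mem_openStar_simplex s
  exact ⟨x, hx u (by simp [s]), hx v (by simp [s]), hx w (by simp [s])⟩

theorem exists_mem_openStar_square (f : SimpleGraph.cycleGraph 4 ↪g G) :
    ∃ x, ∀ i, x ∈ openStar G (f i) := by
  refine ⟨squarePoint f (half, half), fun i => squarePoint_mem_openStar.2 ⟨i, rfl, ?_⟩⟩
  have hi : i = 0 ∨ i = 1 ∨ i = 2 ∨ i = 3 := by revert i; decide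
  rcases hi with rfl | rfl | rfl | rfl <;> simp only [cornerWeights, half, Matrix.cons_val] <;>
    norm_num

/-- The homotopy class of an edge. -/
def edgeClass {v w : V} (h : G.Adj v w) :
    Path.Homotopic.Quotient (vertexPoint G v) (vertexPoint G w) :=
  (starPath (midpoint_mem_left h)).symm.trans (starPath (midpoint_mem_right h))

open Path.Homotopic.Quotient in
theorem quotient_cancel_left {X : Type*} [TopologicalSpace X] {x y z : X}
    (a : Path.Homotopic.Quotient x y) {b c : Path.Homotopic.Quotient y z}
    (h : a.trans b = a.trans c) : b = c := by
  have := congrArg (a.symm.trans ·) h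
  simpa only [← trans_assoc, symm_trans, refl_trans] using this

open Path.Homotopic.Quotient in
-- Any common point of the two stars can replace the midpoint: a path inside both stars connects
-- them, and `trans_starPath` absorbs it on either side.
theorem starPath_trans_edgeClass {v w : V} (h : G.Adj v w) {x : TriangleSquareComplex G}
    (hv : x ∈ openStar G v) (hw : x ∈ openStar G w) :
    (starPath hv).trans (edgeClass h) = starPath hw := by
  obtain ⟨γ, hγv, hγw⟩ := exists_path_midpoint h hv hw
  rw [← trans_starPath γ hγv hv (midpoint_mem_left h), ← trans_starPath γ hγw hw
    (midpoint_mem_right h), edgeClass, trans_assoc, ← trans_assoc (starPath _), trans_symm,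
    refl_trans]

open Path.Homotopic.Quotient in
-- Some point lies in the open stars of all vertices of the given edge, triangle or square. After
-- prefixing its path to the first vertex, each edge class merely moves the end of that star path,
-- so both sides agree.
theorem isFlatSystem_edgeClass (b : V) : IsFlatSystem G
    (fun v => Path.Homotopic.Quotient (vertexPoint G v) (vertexPoint G b))
    (fun _ _ h γ => (edgeClass h).trans γ) where
  inv v w h γ := by
    refine quotient_cancel_left (starPath (midpoint_mem_left h)) ?_
    rw [← trans_assoc, ← trans_assoc, starPath_trans_edgeClass h _ (midpoint_mem_right h),
      starPath_trans_edgeClass h.symm _ (midpoint_mem_left h)]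
  triangle u v w huv hvw huw γ := by
    obtain ⟨x, hu, hv, hw⟩ := exists_mem_openStar_triangle huv hvw huw
    refine quotient_cancel_left (starPath hu) ?_
    rw [← trans_assoc, ← trans_assoc, ← trans_assoc, starPath_trans_edgeClass huv hu hv,
      starPath_trans_edgeClass hvw hv hw, starPath_trans_edgeClass huw hu hw]
  square a b' c d hab hbc had hdc γ hac hbd hac' hbd' := by
    obtain ⟨x, hx⟩ := exists_mem_openStar_square
      (squareEmbedding hab hbc hdc.symm had.symm hac hbd hac' hbd')
    have ha : x ∈ openStar G a := hx 0
    have hb : x ∈ openStar G b' := hx 1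
    have hc : x ∈ openStar G c := hx 2
    have hd : x ∈ openStar G d := hx 3
    refine quotient_cancel_left (starPath ha) ?_
    rw [← trans_assoc, ← trans_assoc, ← trans_assoc, ← trans_assoc,
      starPath_trans_edgeClass hab ha hb, starPath_trans_edgeClass hbc hb hc,
      starPath_trans_edgeClass had ha hd, starPath_trans_edgeClass hdc hd hc]

open Path.Homotopic.Quotient in
theorem cast_trans_eq {X : Type*} [TopologicalSpace X] {b : X}
    (c : ∀ x, Path.Homotopic.Quotient x b) {x y x' y' : X} (γ : Path x y) (hx : x' = x)
    (hy : y' = y) (h : (mk (γ.cast hx hy)).trans (c y') = c x') : (mk γ).trans (c y) = c x := by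
  subst hx hy
  exact h

open Path.Homotopic.Quotient in
/-- If every path inside an open set of a cover has the class prescribed by a choice of paths to a
base point, then the space is simply connected. -/
theorem simplyConnectedSpace_of_cover {X ι : Type*} [TopologicalSpace X] (U : ι → Set X)
    (hU : ∀ i, IsOpen (U i)) (hcov : ∀ x, ∃ i, x ∈ U i) (b : X)
    (c : ∀ x, Path.Homotopic.Quotient x b)
    (hc : ∀ i x y (γ : Path x y), (∀ t, γ t ∈ U i) → (mk γ).trans (c y) = c x) :
    SimplyConnectedSpace X := by
  have key : ∀ {x y} (γ : Path x y), (mk γ).trans (c y) = c x := by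
    intro x y γ
    -- A Lebesgue subdivision: each piece lies in one set of the cover, and the pieces are composed
    -- by induction.
    obtain ⟨t, ht0, hmono, ⟨N, hN⟩, ht⟩ := exists_monotone_Icc_subset_open_cover_unitInterval
      (c := fun i => γ ⁻¹' U i) (fun i => (hU i).preimage γ.continuous) (fun s _ => by
        obtain ⟨i, hi⟩ := hcov (γ s)
        exact Set.mem_iUnion.2 ⟨i, hi⟩)
    have hsub : ∀ n, (mk (γ.subpath 0 (t n))).trans (c (γ (t n))) = c (γ 0) := by
      intro n
      induction n with
      | zero =>
        rw [ht0, Path.subpath_self, mk_refl, refl_trans]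
      | succ n ih =>
        obtain ⟨i, hi⟩ := ht n
        have h₁ := eq.2 ⟨Path.Homotopy.subpathTransSubpath γ 0 (t n) (t (n + 1))⟩
        rw [mk_trans] at h₁
        rw [← h₁, trans_assoc, hc i _ _ _ fun s => ?_, ih]
        have hs : γ.subpath (t n) (t (n + 1)) s ∈ Set.range (γ.subpath (t n) (t (n + 1))) := ⟨s, rfl⟩
        rw [Path.range_subpath_of_le γ _ _ (hmono (Nat.le_succ n))] at hs
        obtain ⟨r, hr, hrs⟩ := hs
        rw [← hrs]
        exact hi hr
    have h := hsub N
    rw [hN N le_rfl, Path.subpath_zero_one] at h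
    exact cast_trans_eq c γ _ _ h
  rw [simply_connected_iff_paths_homotopic']
  refine ⟨⟨⟨b⟩, fun x y => ?_⟩, fun {x y} p q => ?_⟩
  · obtain ⟨γ, -⟩ := mk_surjective (c x)
    obtain ⟨γ', -⟩ := mk_surjective (c y)
    exact ⟨γ.trans γ'.symm⟩
  -- Both classes equal `c x` followed by the inverse of `c y`.
  · rw [← eq]
    have h := (key p).trans (key q).symm
    have := congrArg (fun a => a.trans (c y).symm) h
    simpa only [trans_assoc, trans_symm, trans_refl] using this

open Path.Homotopic.Quotient in
-- The section `P` chooses for each vertex a class of paths to `b`. A point is sent to `b` through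
-- the center of any star containing it; by `openStar_inter` all choices agree, and paths inside one
-- star respect them.
theorem IsWeaklyModular.simplyConnectedSpace (hG : G.Connected) (h : IsWeaklyModular G) :
    SimplyConnectedSpace (TriangleSquareComplex G) := by
  obtain ⟨b⟩ := hG.nonempty
  obtain ⟨P, hP⟩ := (isFlatSystem_edgeClass (G := G) b).exists_section hG b (h b).1 (h b).2
    (Path.Homotopic.Quotient.refl _)
  have hadj : ∀ {x u v} (hu : x ∈ openStar G u) (hv : x ∈ openStar G v), G.Adj u v →
      (starPath hu).trans (P u) = (starPath hv).trans (P v) := by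
    intro x u v hu hv h
    rw [hP u v h, ← trans_assoc, starPath_trans_edgeClass h hu hv]
  have hall : ∀ {x u v} (hu : x ∈ openStar G u) (hv : x ∈ openStar G v),
      (starPath hu).trans (P u) = (starPath hv).trans (P v) := by
    intro x u v hu hv
    rcases openStar_inter hu hv with rfl | h | ⟨w, hw, huw, hwv⟩
    · rfl
    · exact hadj hu hv h
    · exact (hadj hu hw huw).trans (hadj hw hv hwv)
  have hex : ∀ x, ∃ v, x ∈ openStar G v := exists_coord_pos
  refine simplyConnectedSpace_of_cover (openStar G) isOpen_openStar hex
    (vertexPoint G b) (fun x => (starPath (hex x).choose_spec).trans (P _)) ?_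
  intro v x y γ hγ
  have hx : x ∈ openStar G v := by simpa using hγ 0
  have hy : y ∈ openStar G v := by simpa using hγ 1
  rw [hall _ hy, hall _ hx, ← trans_assoc, trans_starPath γ hγ hx hy]

end EdgeClass

end DualPolar
namespace DualPolar

/-! ### Transport between vertices of a common cell -/

section Transport

variable {V F : Type*} {G : SimpleGraph V}

open Classical in
/-- Transport between vertices at distance at most two. -/
noncomputable def transport (e : ∀ v w, G.Adj v w → F → F) (u v : V) (t : F) : F :=
  if u = v then t else if h : G.Adj u v then e u v h t
    else if h : ∃ k, G.Adj u k ∧ G.Adj k v then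
      e u h.choose h.choose_spec.1 (e h.choose v h.choose_spec.2 t) else t

variable {e : ∀ v w, G.Adj v w → F → F}

theorem transport_self (u : V) (t : F) : transport e u u t = t := by
  simp [transport]

theorem transport_of_adj {u v : V} (h : G.Adj u v) (t : F) : transport e u v t = e u v h t := by
  rw [transport, if_neg h.ne, dif_pos h]

/-- The chosen common neighbor is irrelevant: two adjacent ones are compared by two triangles, two
nonadjacent ones by a square. -/
theorem transport_of_common_adj (he : IsFlatSystem G (fun _ => F) e) {u k v : V} (hne : u ≠ v)
    (hadj : ¬ G.Adj u v) (h₁ : G.Adj u k) (h₂ : G.Adj k v) (t : F) :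
    transport e u v t = e u k h₁ (e k v h₂ t) := by
  have hex : ∃ k, G.Adj u k ∧ G.Adj k v := ⟨k, h₁, h₂⟩
  rw [transport, if_neg hne, dif_neg hadj, dif_pos hex]
  have h₃ := hex.choose_spec.1
  have h₄ := hex.choose_spec.2
  change e u hex.choose h₃ (e hex.choose v h₄ t) = _
  generalize hex.choose = m at h₃ h₄ ⊢
  by_cases hkm : m = k
  · subst hkm; rfl
  by_cases hkm' : G.Adj m k
  · rw [← he.triangle m k v hkm' h₂ h₄, he.triangle u m k h₃ hkm' h₁]
  · exact he.square u m v k h₃ h₄ h₁ h₂ t hne hkm hadj hkm'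

/-- The last three conditions express that in a common clique or square, the third vertex is an end
of any given nonadjacent pair or a common neighbor of it. -/
theorem transport_trans (he : IsFlatSystem G (fun _ => F) e) {u v w : V}
    (huv : u = v ∨ G.Adj u v ∨ ∃ k, G.Adj u k ∧ G.Adj k v)
    (h₁ : u ≠ w → ¬ G.Adj u w → v = u ∨ v = w ∨ G.Adj u v ∧ G.Adj v w)
    (h₂ : u ≠ v → ¬ G.Adj u v → w = u ∨ w = v ∨ G.Adj u w ∧ G.Adj w v)
    (h₃ : v ≠ w → ¬ G.Adj v w → u = v ∨ u = w ∨ G.Adj v u ∧ G.Adj u w) (t : F) :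
    transport e u v (transport e v w t) = transport e u w t := by
  by_cases e₁ : u = v
  · rw [e₁, transport_self]
  by_cases e₂ : v = w
  · rw [e₂, transport_self]
  by_cases e₃ : u = w
  · subst e₃
    rw [transport_self]
    rcases huv with h | h | ⟨k, h, h'⟩
    · exact absurd h e₁
    · rw [transport_of_adj h, transport_of_adj h.symm, he.inv]
    · by_cases hadj : G.Adj u v
      · rw [transport_of_adj hadj, transport_of_adj hadj.symm, he.inv]
      · rw [transport_of_common_adj he e₁ hadj h h', transport_of_common_adj he e₂
          (fun h => hadj h.symm) h'.symm h.symm, he.inv, he.inv]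
  by_cases a₁ : G.Adj u v
  · by_cases a₂ : G.Adj v w
    · rw [transport_of_adj a₁, transport_of_adj a₂]
      by_cases a₃ : G.Adj u w
      · rw [transport_of_adj a₃, he.triangle u v w a₁ a₂ a₃]
      · rw [transport_of_common_adj he e₃ a₃ a₁ a₂]
    · obtain ⟨h, h'⟩ := ((h₃ e₂ a₂).resolve_left e₁).resolve_left e₃
      rw [transport_of_adj a₁, transport_of_common_adj he e₂ a₂ h h', he.inv, transport_of_adj h']
  · obtain ⟨h, h'⟩ := ((h₂ e₁ a₁).resolve_left (Ne.symm e₃)).resolve_left (Ne.symm e₂)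
    rw [transport_of_common_adj he e₁ a₁ h h', transport_of_adj h'.symm, he.inv,
      transport_of_adj h]

theorem openStar_opposite {x : TriangleSquareComplex G} {u v w : V} (hu : x ∈ openStar G u)
    (hv : x ∈ openStar G v) (hw : x ∈ openStar G w) (hne : u ≠ w) (hadj : ¬ G.Adj u w) :
    v = u ∨ v = w ∨ G.Adj u v ∧ G.Adj v w := by
  rcases openStar_clique_or_square x with h | ⟨f, h⟩
  · rcases h u w hu hw with h | h
    · exact absurd h hne
    · exact absurd h hadj
  · obtain ⟨i, rfl⟩ := h u hu
    obtain ⟨j, rfl⟩ := h v hv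
    obtain ⟨k, rfl⟩ := h w hw
    simp only [cycle_adj_iff, f.injective.eq_iff, ne_eq] at hne hadj ⊢
    clear hu hv hw h
    revert i j k
    decide

theorem transport_trans_of_mem (he : IsFlatSystem G (fun _ => F) e) {x : TriangleSquareComplex G}
    {u v w : V} (hu : x ∈ openStar G u) (hv : x ∈ openStar G v) (hw : x ∈ openStar G w) (t : F) :
    transport e u v (transport e v w t) = transport e u w t :=
  transport_trans he ((openStar_inter hu hv).imp_right (Or.imp_right fun ⟨k, _, h⟩ => ⟨k, h⟩))
    (openStar_opposite hu hv hw) (openStar_opposite hu hw hv) (openStar_opposite hv hu hw) t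

end Transport

/-! ### The covering space of a flat system -/

noncomputable section Bundle

open Topology unitInterval

variable {V F : Type*} {G : SimpleGraph V} [TopologicalSpace F] [DiscreteTopology F]
  {e : ∀ v w, G.Adj v w → F → F}

/-- The fiber bundle of a flat system. -/
def flatBundle (he : IsFlatSystem G (fun _ => F) e) :
    FiberBundleCore V (TriangleSquareComplex G) F where
  baseSet := openStar G
  isOpen_baseSet := isOpen_openStar
  indexAt x := (exists_coord_pos x).choose
  mem_baseSet_at x := (exists_coord_pos x).choose_spec
  coordChange i j _ := transport e j i
  coordChange_self i _ _ t := transport_self i t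
  continuousOn_coordChange _ _ :=
    (Continuous.comp (g := transport e _ _) continuous_of_discreteTopology
      continuous_snd).continuousOn
  coordChange_comp _ _ _ _ hx t := transport_trans_of_mem he hx.2 hx.1.2 hx.1.1 t

variable (he : IsFlatSystem G (fun _ => F) e)

theorem isCoveringMap_flatBundle : IsCoveringMap (flatBundle he).proj :=
  FiberBundle.isCoveringMap

/-- The point over `x` with coordinate `a` in the chart of `v`. -/
def chartPoint (v : V) (x : TriangleSquareComplex G) (a : F) : (flatBundle he).proj ⁻¹' {x} :=
  ⟨⟨x, (flatBundle he).coordChange v ((flatBundle he).indexAt x) x a⟩, rfl⟩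

theorem chartPoint_transport {v w : V} {x : TriangleSquareComplex G} (hv : x ∈ openStar G v)
    (hw : x ∈ openStar G w) (a : F) :
    chartPoint he w x (transport e w v a) = chartPoint he v x a :=
  Subtype.ext (congrArg (Bundle.TotalSpace.mk x)
    ((flatBundle he).coordChange_comp v w _ x
      ⟨⟨hv, hw⟩, (flatBundle he).mem_baseSet_at x⟩ a))

theorem chartPoint_surjective {v : V} {x : TriangleSquareComplex G} (hv : x ∈ openStar G v)
    (p : (flatBundle he).proj ⁻¹' {x}) : ∃ a, chartPoint he v x a = p := by
  obtain ⟨⟨y, t⟩, rfl⟩ := p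
  refine ⟨(flatBundle he).coordChange ((flatBundle he).indexAt y) v y t, Subtype.ext
    (congrArg (Bundle.TotalSpace.mk y) ?_)⟩
  exact ((flatBundle he).coordChange_comp _ v _ y
    ⟨⟨(flatBundle he).mem_baseSet_at y, hv⟩, (flatBundle he).mem_baseSet_at y⟩ t).trans
    ((flatBundle he).coordChange_self _ y ((flatBundle he).mem_baseSet_at y) t)

theorem chartPoint_injective {v : V} {x : TriangleSquareComplex G} (hv : x ∈ openStar G v) :
    Function.Injective (chartPoint he v x) := by
  intro a a' h
  have h₁ : transport e ((flatBundle he).indexAt x) v a =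
      transport e ((flatBundle he).indexAt x) v a' := by
    exact eq_of_heq (Bundle.TotalSpace.mk.inj (congrArg Subtype.val h)).2
  have h₂ := congrArg (transport e v ((flatBundle he).indexAt x)) h₁
  rwa [transport_trans_of_mem he hv ((flatBundle he).mem_baseSet_at x) hv,
    transport_trans_of_mem he hv ((flatBundle he).mem_baseSet_at x) hv, transport_self,
    transport_self] at h₂

/-- In the chart of `v`, keeping the coordinate constant lifts `γ`. -/
theorem monodromy_chartPoint {v : V} {x y : TriangleSquareComplex G} (γ : Path x y)
    (hγ : ∀ t, γ t ∈ openStar G v) (a : F) :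
    (isCoveringMap_flatBundle he).monodromy (.mk γ) (chartPoint he v x a) =
      chartPoint he v y a := by
  let Z := flatBundle he
  have hc : Continuous fun t => (Z.localTriv v).toOpenPartialHomeomorph.symm (γ t, a) := by
    refine (Z.localTriv v).toOpenPartialHomeomorph.symm.continuousOn.comp_continuous
      (γ.continuous.prodMk continuous_const) fun t => ?_
    exact (Z.localTriv v).mem_target.2 (hγ t)
  let Γ : Path (chartPoint he v x a).1 (chartPoint he v y a).1 :=
    ⟨⟨_, hc⟩, by simp only [γ.source]; rfl, by simp only [γ.target]; rfl⟩
  refine (isCoveringMap_flatBundle he).monodromy_eq_of_map_eq (.mk Γ) ?_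
  rfl

theorem exists_path_vertexPoint {s : Simplex G} {v : V} (hv : v ∈ s.1)
    {m : stdSimplex ℝ {v : V // v ∈ s.1}} (hm : 0 < m.1 ⟨v, hv⟩) :
    ∃ γ : Path (vertexPoint G v) (simplexPoint s m), ∀ t, γ t ∈ openStar G v := by
  refine ⟨⟨⟨fun t => simplexPoint s (simplexSegment (simplexCorner s hv) m t), ?_⟩, ?_, ?_⟩, ?_⟩
  · exact (continuous_simplexPoint s).comp ((continuous_simplexSegment _).comp
      (continuous_const.prodMk continuous_id))
  · exact (congrArg (simplexPoint s) (simplexSegment_zero _ _)).trans (simplexPoint_corner s hv)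
  · exact congrArg (simplexPoint s) (simplexSegment_one _ _)
  · refine fun t => simplexPoint_mem_openStar.2 ⟨hv, simplexSegment_pos ?_ hm t⟩
    simp [simplexCorner]

include he in
-- The value at `v` is the coordinate reached from `t₀` by monodromy along any path to `v`, all
-- paths being homotopic. For an edge, the path to `v` is routed through `w` and the midpoint, where
-- the change of charts is the transport along the edge.
theorem exists_section_of_simplyConnected_of_const [SimplyConnectedSpace (TriangleSquareComplex G)]
    (b : V) (t₀ : F) : ∃ s : V → F, s b = t₀ ∧ ∀ v w (h : G.Adj v w), s v = e v w h (s w) := by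
  have hcl : ∀ v, Nonempty (Path.Homotopic.Quotient (vertexPoint G b) (vertexPoint G v)) :=
    fun v => ⟨.mk (PathConnectedSpace.somePath _ _)⟩
  have hsub : ∀ {x y : TriangleSquareComplex G} (p q : Path.Homotopic.Quotient x y), p = q :=
    fun p q => Subsingleton.elim p q
  choose s hs using fun v => chartPoint_surjective he (vertexPoint_mem_openStar v)
    ((isCoveringMap_flatBundle he).monodromy (hcl v).some (chartPoint he b _ t₀))
  refine ⟨s, ?_, fun v w h => ?_⟩
  · refine chartPoint_injective he (vertexPoint_mem_openStar b) ((hs b).trans ?_)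
    rw [hsub (hcl b).some (.refl _), IsCoveringMap.monodromy_refl]
    rfl
  · obtain ⟨γ, hγ⟩ := exists_path_vertexPoint (left_mem_edgeSimplex h)
      (simplexCorner_nonneg _ _ (right_mem_edgeSimplex h)).1
    obtain ⟨δ, hδ⟩ := exists_path_vertexPoint (right_mem_edgeSimplex h)
      (simplexCorner_nonneg _ (left_mem_edgeSimplex h) _).2
    refine chartPoint_injective he (vertexPoint_mem_openStar v) ?_
    have h₁ := monodromy_chartPoint he δ hδ (s w)
    have h₂ := monodromy_chartPoint he γ.symm (fun t => hγ _) (e v w h (s w))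
    have h₃ := chartPoint_transport he (midpoint_mem_right h) (midpoint_mem_left h) (s w)
    rw [transport_of_adj h] at h₃
    rw [hs v, hsub (hcl v).some (((hcl w).some.trans (.mk δ)).trans (.mk γ.symm)),
      IsCoveringMap.monodromy_trans_apply, IsCoveringMap.monodromy_trans_apply, ← hs w, h₁]
    exact (congrArg _ h₃.symm).trans h₂

end Bundle

/-- The bundle needs a constant fiber. Transport along walks identifies each fiber with the one over
`b`, and the flat system is conjugated by these identifications. -/
theorem IsFlatSystem.exists_section_of_simplyConnected {V : Type*} {G : SimpleGraph V}
    {T : V → Type*} {e : ∀ v w, G.Adj v w → T w → T v} (he : IsFlatSystem G T e)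
    (hG : G.Connected) (hX : SimplyConnectedSpace (TriangleSquareComplex G)) (b : V) (t₀ : T b) :
    ∃ s : ∀ v, T v, s b = t₀ ∧ ∀ v w (h : G.Adj v w), s v = e v w h (s w) := by
  have hθ : ∀ {b v : V}, G.Walk b v → Nonempty (T b ≃ T v) := by
    intro b v p
    induction p with
    | nil => exact ⟨Equiv.refl _⟩
    | cons h p ih =>
      exact ih.map fun θ => Equiv.trans ⟨e _ _ h.symm, e _ _ h, he.inv _ _ h, he.inv _ _ h.symm⟩ θ
  have hθ' : ∀ v, Nonempty (T b ≃ T v) := fun v => (hG.preconnected b v).elim hθ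
  let θ : ∀ v, T b ≃ T v := fun v => (hθ' v).some
  let _ : TopologicalSpace (T b) := ⊥
  have : DiscreteTopology (T b) := ⟨rfl⟩
  have he' : IsFlatSystem G (fun _ => T b) fun v w h t => (θ v).symm (e v w h (θ w t)) :=
    { inv := fun v w h t => by simp [he.inv]
      triangle := fun u v w huv hvw huw t => by simp [he.triangle u v w huv hvw huw]
      square := fun u v w x h₁ h₂ h₃ h₄ t h₅ h₆ h₇ h₈ => by
        simp [he.square u v w x h₁ h₂ h₃ h₄ _ h₅ h₆ h₇ h₈] }
  obtain ⟨s, hs, hs'⟩ := exists_section_of_simplyConnected_of_const he' b ((θ b).symm t₀)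
  exact ⟨fun v => θ v (s v), by simp [hs], fun v w h => by simp [hs' v w h]⟩

end DualPolar
namespace DualPolar

/-! ### From simple connectedness to weak modularity -/

section Descent

variable {V α : Type*} {G : SimpleGraph V} {f : α → V} {lev : α → ℕ} {o : α} {A : α → α → Prop}

/-- The fiber over `v` of a layered cover. -/
def LayerFiber (f : α → V) (o : α) (A : α → α → Prop) (v : V) : Type _ :=
  {x : α // (x = o ∨ ∃ y, A x y) ∧ f x = v}

theorem IsLayeredCover.exists_lift (P : IsLayeredCover G f lev o A) {v w : V} (h : G.Adj v w)
    (x : LayerFiber f o A w) : ∃ y : LayerFiber f o A v, A x.1 y.1 := by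
  obtain ⟨y, hy, hfy⟩ := P.surj (z := v) x.2.1 (by rw [x.2.2]; exact h.symm)
  exact ⟨⟨y, Or.inr ⟨_, P.symm hy⟩, hfy⟩, hy⟩

/-- Lifts of edges are unique by `inj`; `reflect` closes lifted triangles and `square` closes lifted
squares. -/
theorem IsLayeredCover.exists_isFlatSystem (P : IsLayeredCover G f lev o A) :
    ∃ e : ∀ v w, G.Adj v w → LayerFiber f o A w → LayerFiber f o A v,
      IsFlatSystem G (LayerFiber f o A) e ∧ ∀ v w h x, A x.1 (e v w h x).1 := by
  choose e he using fun v w (h : G.Adj v w) (x : LayerFiber f o A w) => P.exists_lift h x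
  refine ⟨e, ⟨?_, ?_, ?_⟩, he⟩
  · intro v w h t
    refine Subtype.ext (P.inj (he v w h _) (P.symm (he w v h.symm t)) ?_)
    rw [t.2.2, (e v w h _).2.2]
  · intro u v w huv hvw huw t
    refine Subtype.ext (P.inj (he u v huv _) (P.reflect (he v w hvw t) (he u w huw t) ?_) ?_)
    · rwa [(e v w hvw t).2.2, (e u w huw t).2.2, G.adj_comm]
    · rw [(e u w huw t).2.2, (e u v huv _).2.2]
  · intro a b c d hab hbc had hdc t _ _ _ _
    refine Subtype.ext (P.inj (P.symm (P.square (he b c hbc t) (he a b hab _) (he d c hdc t) ?_))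
      (he a d had _) ?_)
    · rwa [(e a b hab _).2.2, (e d c hdc t).2.2]
    · rw [(e a b hab _).2.2, (e a d had _).2.2]

/-- Each vertex needs its own cover, since TC and QC are built in only with respect to the base
point. -/
theorem IsLocallyWeaklyModular.isWeaklyModular (hG : G.Connected) (hD : DiamondFree G)
    (hL : IsLocallyWeaklyModular G) (hX : SimplyConnectedSpace (TriangleSquareComplex G)) :
    IsWeaklyModular G := by
  intro v
  obtain ⟨A, P⟩ := exists_layeredCover hG hD hL v
  obtain ⟨e, hF, he⟩ := P.exists_isFlatSystem
  obtain ⟨s, hs, hs'⟩ := hF.exists_section_of_simplyConnected hG hX v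
    (⟨[], Or.inl rfl, rfl⟩ : LayerFiber (List.headD · v) [] A v)
  refine P.conditions hG rfl (fun x => List.length_eq_zero_iff.1) (fun w => (s w).1)
    (fun w => (s w).2.2) (congrArg Subtype.val hs) fun u w h => P.symm ?_
  have := he u w h (s w)
  rwa [← hs' u w h] at this

end Descent

end DualPolar

theorem mainTheorem5 {V : Type*} (G : SimpleGraph V) (hG : G.Connected) :
    List.TFAE [
      DualPolar.IsDualPolar G,
      DualPolar.IsThick G ∧ DualPolar.IsWeaklyModular G ∧
        ¬ DualPolar.K4minus.IsIndContained G ∧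
        ¬ DualPolar.ContainsIsometric G DualPolar.K33minus,
      DualPolar.IsThick G ∧ DualPolar.IsLocallyWeaklyModular G ∧
        ¬ DualPolar.K4minus.IsIndContained G ∧
        ¬ DualPolar.ContainsIsometric G DualPolar.K33minus ∧
        SimplyConnectedSpace (DualPolar.TriangleSquareComplex G)] := by
  tfae_have 1 ↔ 2 := DualPolar.isDualPolar_iff hG
  tfae_have 2 → 3 := fun ⟨h₁, h₂, h₃, h₄⟩ =>
    ⟨h₁, h₂.isLocallyWeaklyModular, h₃, h₄, h₂.simplyConnectedSpace hG⟩
  tfae_have 3 → 2 := fun ⟨h₁, h₂, h₃, h₄, h₅⟩ =>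
    ⟨h₁, h₂.isWeaklyModular hG (DualPolar.diamondFree_iff.2 h₃) h₅, h₃, h₄⟩
  tfae_finish
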